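/- **Sequences.** Let $\mathcal W$ be the set of finite sequences of positive integers and $\mathcal W_2$ the set of those with all entries $\ge 2$. For nonempty $a=(a_1,\dots,a_k)$ put $\alpha a=(a_1,\dots,a_k+1)$, $a\alpha=(a_1+1,\dots,a_k)$, $\gamma a=(a_1,\dots,a_k,2)$, $a\gamma=(2,a_1,\dots,a_k)$. The map $R:\mathcal W\to\mathcal W$ is given by $R(())=()$, $R((2))=(2)$, $R(\alpha a)=\gamma R(a)$ and $R(\gamma a)=\alpha R(a)$ for $()\ne a\in\mathcal W_2$, and $R(a(1)a')=R(a)(1)R(a')$. Positions of $a$ are associated with positions of $R(a)$ as follows. If $a$ has length $\ell$ and $R(a)$ has length $r$, then passing from $a$ to $(a_1,\dots,a_\ell,1)$ associates position $\ell+1$ with $r+1$; appending the entry $2$ associates position $\ell+1$ with $r$, or with $r+1$ if $a$ is empty or ends in $1$; increasing a last entry that is $\ge 2$ by one associates position $\ell$ also with $r+1$; earlier associations are kept. Let $\Gamma(a)$ be the chain of $k$ nodes labelled consecutively $-a_1,\dots,-a_k$. Blowing down a $-1$-node removes it, increases the labels of its neighbours by $1$, and joins these to each other. **P-resolutions.**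 Graphs of type T are the $\Gamma(R(2,a,2))$, $a\ge2$, and, if $\Gamma(b)$ is of type T, also $\Gamma(\alpha b\gamma)$ and $\Gamma(\gamma b\alpha)$. A P-resolution (of a cyclic quotient singularity) is given by $b\in\mathcal W$ and a set $C$ of nodes of $\Gamma(b)$ such that: $\Gamma(b)$ can be blown down successively to some $\Gamma(c)$ with $()\ne c\in\mathcal W_2$; each maximal interval of $C$ is of type T or consists of $-2$-nodes; and, for a chain of smooth rational curves $E_i$ with dual graph $\Gamma(b)$, the divisor $K+\sum_{j\in C}\delta_jE_j$ ($\delta_j\in\mathbb Q$) of degree $0$ on all $E_i$, $i\in C$, has degree $>0$ on all $E_i$, $i\notin C$. (Contracting $C$ gives a surface $Y$ whose minimal resolution has graph $\Gamma(b)$, and the degrees for $i\notin C$ are the numbers $K_Y\cdot E_i$.) Let $I_1,\dots,I_s$ be the maximal intervals of $C$ of type T. **Labelled subdivisions.** Fix a countably infinite linearly ordered set $\mathcal V$. A subdivision $(V,\Delta)$ consists of a finite set $V=\{v_0<\dots<v_k\}\subset\mathcal V$, $k\ge1$, and the set $\Delta$ of vertex sets of the triangles of a triangulation of the $(k+1)$-gon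 with consecutive vertices $v_0,\dots,v_k$, without new vertices ($\Delta=\emptyset$ if $k=1$). A sequence $a=(a_1,\dots,a_k)\in\mathcal W$ labels $v_i$ with $a_i$ for $1\le i\le k$; $v_0$ has no label. Consider on $\Delta$ the equivalence relation generated by: two triangles have an edge in common and one of them has a vertex with label $1$. The degree of a vertex is the number of classes that contain a triangle with this vertex. The triple $(V,\Delta,a)$ is a labelled subdivision if $\deg v_i\le a_i$ for $1\le i\le k$. An isomorphism $(V,\Delta,a)\to(V',\Delta',a')$ is a bijection $V\to V'$ that maps $\Delta$ onto $\Delta'$ and preserves the labels (so $v_0\mapsto v_0'$, and the order of the other vertices is preserved or reversed). Let $T$ be the set of subdivisions in which $\{v_0,v_1,v_k\}$ is the only triangle with vertex $v_0$ and whose other triangles arise from one triangle $\{v_{i-1},v_i,v_{i+1}\}$, $1<i<k$, by successively gluing a triangle to the edge joining the smallest and the largest vertex reached so far, the third vertex being the next smaller or the next larger one; $v_i$ is the central vertex. If $\Gamma(b)$ is of type T, then on a given vertex set of suitable cardinality there is exactly one subdivision in $T$ for which $R(b)$ gives a labelled subdivision with $\deg v=\text{label of }v$ for all vertices $v\neq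 v_0$ other than the central one; call it the T-subdivision of $b$. Let $\mathcal M$ be the set of labelled subdivisions $(V,\Delta,a)$ with $a\in\mathcal W_2$. Let $\mathcal P$ be the set of labelled subdivisions $(V,\Delta,a)$ that arise from a P-resolution $(b,C)$ as follows: $a=R(b)$; if $H_j$ is the set of positions of $a$ associated with positions in $I_j$, then $\Delta$ consists of the triangles of the T-subdivisions of $b|_{I_j}$ on $\{v_0\}\cup\{v_i:i\in H_j\}$, $j=1,\dots,s$, and of the triangles $\{v_0,v_i,v_{i+1}\}$, $1\le i<k$, such that no $H_j$ contains both $i$ and $i+1$. **Theorem.** There is a bijection between the set of isomorphism classes of $\mathcal P$ and the set of isomorphism classes of $\mathcal M$ such that, whenever the classes of $(V,\Delta,a)\in\mathcal P$ and $(V',\Delta',a')\in\mathcal M$ correspond to each other, $\Gamma(R(a'))$ is obtained, up to isomorphism of labelled graphs, from $\Gamma(R(a))$ by successively blowing down (finitely many, possibly no) $-1$-nodes. -/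

import Mathlib

namespace PRes

/-! ### Sequences -/

/-- Sequences of positive integers. -/
def IsW (a : List ℕ) : Prop := ∀ x ∈ a, 1 ≤ x

/-- Sequences of integers that are at least two. -/
def IsW2 (a : List ℕ) : Prop := ∀ x ∈ a, 2 ≤ x

/-- The action of `α` from the right: it increases the first entry, and fixes the empty sequence. -/
def alphaRight : List ℕ → List ℕ
  | [] => []
  | x :: a => (x + 1) :: a

/-- The action of `α` from the left: it increases the last entry. -/
def alphaLeft (a : List ℕ) : List ℕ := (alphaRight a.reverse).reverse

/-- The action of `γ` from the left: it appends the entry `2`. -/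
def gammaLeft (a : List ℕ) : List ℕ := a ++ [2]

/-- The action of `γ` from the right: it prepends the entry `2`. -/
def gammaRight (a : List ℕ) : List ℕ := 2 :: a

/-- For a reversed sequence: the empty sequence, or a sequence whose last entry is `1`. The next
entry of the sequence then starts a new maximal block of entries `≥ 2`. -/
def StartsBlock (a : List ℕ) : Prop := a = [] ∨ a.head? = some 1

instance (a : List ℕ) : Decidable (StartsBlock a) := by
  unfold StartsBlock; infer_instance

/-- The operator `R` on sequences that are written in reversed order, so that the left actions of
`α`, `β`, `γ` change the head. The sequence with next entry `n + 2` is `αⁿ γ a`, hence its image is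
`γⁿ α R(a)` inside a block; at the start of a block, `R (2) = (2)`. An entry `1` is kept, and `R`
is applied separately on both sides of it. (The entry `0` does not occur in the sequences that
are considered.) -/
def Rrev : List ℕ → List ℕ
  | [] => []
  | 0 :: a => 0 :: Rrev a
  | 1 :: a => 1 :: Rrev a
  | (n + 2) :: a =>
      List.replicate n 2 ++ (if StartsBlock a then 2 :: Rrev a else alphaRight (Rrev a))

/-- The operator `R`, determined by `R (α a) = γ R(a)` and `R (γ a) = α R(a)` for nonempty
sequences `a` with entries `≥ 2`, by `R () = ()`, `R (2) = (2)`, and by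
`R (a (1) a') = R(a) (1) R(a')`. -/
def R (a : List ℕ) : List ℕ := (Rrev a.reverse).reverse

/-- The relation between the positions `i` of a sequence and the positions `j` of its image under
`R`, where the sequence is given in reversed order; positions are counted `1, 2, …` from the
beginning of the (unreversed) sequences. If `a` has length `ℓ` and `R a` has length `r`, then
position `ℓ + 1` of `γ a` goes with position `r` of `R (γ a) = α R(a)` (with position `r + 1` at the
start of a block), each further `α` adds one position at the end of the image, which goes
with the last position of the sequence, and position `ℓ + 1` of `β a` goes with position `r + 1` of
`R (β a) = β R(a)`. -/
def AssocRev : List ℕ → ℕ → ℕ → Prop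
  | [], _, _ => False
  | 0 :: a, i, j => AssocRev a i j ∨ (i = a.length + 1 ∧ j = (Rrev a).length + 1)
  | 1 :: a, i, j => AssocRev a i j ∨ (i = a.length + 1 ∧ j = (Rrev a).length + 1)
  | (n + 2) :: a, i, j => AssocRev a i j ∨
      (i = a.length + 1 ∧
        (if StartsBlock a then (Rrev a).length + 1 else (Rrev a).length) ≤ j ∧
        j ≤ (if StartsBlock a then (Rrev a).length + 1 else (Rrev a).length) + n)

/-- Position `i` of `a` is associated with position `j` of `R a` (positions start with `1`). -/
def Assoc (a : List ℕ) (i j : ℕ) : Prop := AssocRev a.reverse i j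

/-- The entries of `b` at the positions `l, …, u` (positions start with `1`). -/
def slice (b : List ℕ) (l u : ℕ) : List ℕ := (b.drop (l - 1)).take (u + 1 - l)

/-! ### Weighted graphs and blowing down -/

/-- A graph whose nodes are labelled with integers (self-intersection numbers). -/
structure WGraph where
  N : Type
  graph : SimpleGraph N
  weight : N → ℤ

namespace WGraph

/-- Isomorphism of weighted graphs. -/
def Iso (G H : WGraph) : Prop :=
  ∃ e : G.graph ≃g H.graph, ∀ x, H.weight (e x) = G.weight x

open Classical in
/-- Blowing down the node `v`: it is removed, its neighbours are joined to each other, and their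
weights increase by one. -/
noncomputable def blowDown (G : WGraph) (v : G.N) : WGraph where
  N := {x : G.N // x ≠ v}
  graph :=
    { Adj := fun x y => x ≠ y ∧
        (G.graph.Adj x.1 y.1 ∨ (G.graph.Adj x.1 v ∧ G.graph.Adj y.1 v))
      symm := ⟨fun _ _ h => ⟨h.1.symm, h.2.imp (fun k => k.symm) (fun k => ⟨k.2, k.1⟩)⟩⟩
      loopless := ⟨fun _ h => h.1 rfl⟩ }
  weight := fun x => G.weight x.1 + if G.graph.Adj x.1 v then 1 else 0

/-- `H` is obtained from `G` by blowing down one node of weight `-1`. -/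
def Step (G H : WGraph) : Prop := ∃ v : G.N, G.weight v = -1 ∧ (G.blowDown v).Iso H

/-- `H` is obtained from `G` by successively blowing down (finitely many, possibly no) nodes of
weight `-1`. -/
def BlowsDownTo (G H : WGraph) : Prop := ∃ K, Relation.ReflTransGen Step G K ∧ K.Iso H

open Classical in
/-- The intersection number of the curves that belong to the nodes `x` and `y`. -/
noncomputable def inter (G : WGraph) (x y : G.N) : ℤ :=
  if x = y then G.weight x else if G.graph.Adj x y then 1 else 0

end WGraph

/-- The chain `Γ(a)` whose nodes are labelled consecutively with `-a₁, …, -a_k`. -/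
def Gam (a : List ℕ) : WGraph where
  N := Fin a.length
  graph := SimpleGraph.pathGraph a.length
  weight := fun i => -((a.get i : ℕ) : ℤ)

/-! ### P-resolutions -/

/-- `Γ(b)` is a graph of type T. -/
inductive IsTypeT : List ℕ → Prop
  | first (a : ℕ) (ha : 2 ≤ a) : IsTypeT (R [2, a, 2])
  | second_left (b : List ℕ) (hb : IsTypeT b) : IsTypeT (gammaRight (alphaLeft b))
  | second_right (b : List ℕ) (hb : IsTypeT b) : IsTypeT (gammaLeft (alphaRight b))

/-- `Γ(b)` is a chain of `-2`-nodes, that is, a graph of type `A_k` with `k ≥ 1`. -/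
def IsTypeA (b : List ℕ) : Prop := b ≠ [] ∧ ∀ x ∈ b, x = 2

/-- `{l, …, u}` is a maximal interval of the set `C` of positions. -/
def IsComponent (C : Finset ℕ) (l u : ℕ) : Prop :=
  l ≤ u ∧ (∀ i, l ≤ i → i ≤ u → i ∈ C) ∧ l - 1 ∉ C ∧ u + 1 ∉ C

/-- The intersection number of `K + ∑ⱼ δⱼ Eⱼ` with `E_i` on a smooth surface with a chain of smooth
rational curves with dual graph `Γ(b)`; by adjunction `K · E_i = -E_i² - 2`. -/
noncomputable def canonicalDeg (b : List ℕ) (δ : Fin b.length → ℚ) (i : Fin b.length) : ℚ :=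
  (-((Gam b).weight i : ℚ) - 2) + ∑ j : Fin b.length, δ j * ((Gam b).inter j i : ℚ)

/-- `Γ(b)` is the graph of the minimal resolution of a P-resolution `Y ⟶ X` of a cyclic quotient
singularity `X`, and `C` is the set of positions of the curves that are contracted in `Y`.
Here `K + ∑ δⱼ Eⱼ`, with `δ` supported on `C` and of degree `0` on all curves of `C`, is the pull-back
of `K_Y`, and its degree on another curve is the intersection number of `K_Y` with the image
of that curve, an exceptional curve of `Y ⟶ X`. -/
structure IsPResolution (b : List ℕ) (C : Finset ℕ) : Prop where
  entries : IsW b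
  subset : C ⊆ Finset.Icc 1 b.length
  /-- `Γ(b)` is a resolution graph of a cyclic quotient singularity: it blows down to the graph
  of a minimal resolution. -/
  quotient : ∃ c : List ℕ, c ≠ [] ∧ IsW2 c ∧ (Gam b).BlowsDownTo (Gam c)
  singularities : ∀ l u, IsComponent C l u → IsTypeT (slice b l u) ∨ IsTypeA (slice b l u)
  ample : ∃ δ : Fin b.length → ℚ,
    (∀ i, i.1 + 1 ∉ C → δ i = 0) ∧
    (∀ i, i.1 + 1 ∈ C → canonicalDeg b δ i = 0) ∧
    (∀ i, i.1 + 1 ∉ C → 0 < canonicalDeg b δ i)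

/-- `{l, …, u}` is a maximal interval of the set `J` of the nodes of `Γ(b)` that are contracted to
singularities of type T. -/
def IsTComponent (b : List ℕ) (C : Finset ℕ) (l u : ℕ) : Prop :=
  IsComponent C l u ∧ IsTypeT (slice b l u)

/-! ### Labelled subdivisions of polygons -/

section Subdivisions

variable {α : Type*} [LinearOrder α]

/-- `Δ` is the set of triangles of a subdivision into triangles of a polygon whose vertices, in
consecutive order, are the elements of `V` in increasing order. A digon has no triangle. A polygon
with at least three vertices is cut by its triangle on the edge that joins the smallest and
the largest vertex into the two polygons on the remaining edges of this triangle. -/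
inductive IsSubdivision : Finset α → Finset (Finset α) → Prop
  | digon (x y : α) (h : x < y) : IsSubdivision {x, y} ∅
  | glue (V₁ V₂ : Finset α) (Δ₁ Δ₂ : Finset (Finset α)) (x y z : α)
      (h₁ : IsSubdivision V₁ Δ₁) (h₂ : IsSubdivision V₂ Δ₂)
      (hx : IsLeast (V₁ : Set α) x) (hy₁ : IsGreatest (V₁ : Set α) y)
      (hy₂ : IsLeast (V₂ : Set α) y) (hz : IsGreatest (V₂ : Set α) z) :
      IsSubdivision (V₁ ∪ V₂) (insert {x, y, z} (Δ₁ ∪ Δ₂))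

/-- The index `i` of the vertex `v = v_i` of `V = {v₀ < … < v_k}`. -/
def idx (V : Finset α) (v : α) : ℕ := (V.filter (fun w => w < v)).card

/-- The sequence `a = (a₁, …, a_k)` labels `v_i` with `a_i` for `1 ≤ i ≤ k`. The distinguished vertex
`v₀` has no label, which is expressed by the value `0`. -/
def label (V : Finset α) (a : List ℕ) (v : α) : ℕ :=
  match idx V v with
  | 0 => 0
  | i + 1 => a.getD i 0

/-- The two triangles have an edge in common and one of them has a vertex with label `1`. -/
def Linked (V : Finset α) (a : List ℕ) (s t : Finset α) : Prop :=
  (s ∩ t).card = 2 ∧ ∃ v ∈ s ∪ t, label V a v = 1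

/-- The equivalence relation on the triangles that is generated by `Linked`. -/
def triangleSetoid (V : Finset α) (Δ : Finset (Finset α)) (a : List ℕ) :
    Setoid {t : Finset α // t ∈ Δ} :=
  Relation.EqvGen.setoid (fun s t => Linked V a s.1 t.1)

/-- The degree of the vertex `v`: the number of classes of triangles with vertex `v`. -/
noncomputable def degree (V : Finset α) (Δ : Finset (Finset α)) (a : List ℕ) (v : α) : ℕ :=
  Set.ncard {c : Quotient (triangleSetoid V Δ a) |
    ∃ t : {t : Finset α // t ∈ Δ}, v ∈ t.1 ∧ Quotient.mk (triangleSetoid V Δ a) t = c}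

/-- `(V, Δ, a)` is a labelled subdivision: `a` is an admissible labelling of the vertices of `V`
different from `v₀`. -/
structure IsLabelled (V : Finset α) (Δ : Finset (Finset α)) (a : List ℕ) : Prop where
  subdivision : IsSubdivision V Δ
  length : a.length + 1 = V.card
  entries : IsW a
  admissible : ∀ v ∈ V, idx V v ≠ 0 → degree V Δ a v ≤ label V a v

/-- A triangulated polygon that is built from a triangle `{x, c, z}` with `x < c < z` by successively
gluing a triangle to the edge that joins the smallest and the largest vertex, where
the new vertex becomes the new smallest or the new largest vertex. The first three
arguments are the smallest vertex, the central vertex `c`, and the largest vertex. -/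
inductive IsTCore : α → α → α → Finset α → Finset (Finset α) → Prop
  | base (x c z : α) (h₁ : x < c) (h₂ : c < z) : IsTCore x c z {x, c, z} {{x, c, z}}
  | right (x c z w : α) (V : Finset α) (Δ : Finset (Finset α)) (h : IsTCore x c z V Δ)
      (hw : z < w) : IsTCore x c w (insert w V) (insert {x, z, w} Δ)
  | left (x c z w : α) (V : Finset α) (Δ : Finset (Finset α)) (h : IsTCore x c z V Δ)
      (hw : w < x) : IsTCore w c z (insert w V) (insert {w, x, z} Δ)

/-- `(V, Δ)` is a subdivision in the set `T` with central vertex `c`. The triangle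
`{v₀, v₁, v_k}` is the only one with vertex `v₀`. -/
def IsTSubdivision (V : Finset α) (Δ : Finset (Finset α)) (c : α) : Prop :=
  ∃ (v₀ x z : α) (V' : Finset α) (Δ' : Finset (Finset α)),
    IsTCore x c z V' Δ' ∧ v₀ < x ∧ V = insert v₀ V' ∧ Δ = insert {v₀, x, z} Δ'

/-- `(V, Δ)` is the subdivision in `T` that belongs to the graph `Γ(b)` of type T: the sequence
`R b` labels it such that all vertices except `v₀` and the central one have defect `0`. -/
def IsTSubdivisionOf (b : List ℕ) (V : Finset α) (Δ : Finset (Finset α)) : Prop :=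
  IsLabelled V Δ (R b) ∧ ∃ c, IsTSubdivision V Δ c ∧
    ∀ v ∈ V, idx V v ≠ 0 → v ≠ c → degree V Δ (R b) v = label V (R b) v

end Subdivisions

open Classical in
/-- The set `H` of the positions of `R b` that are associated with the positions `l, …, u`
of `b`. -/
noncomputable def assocPositions (b : List ℕ) (l u : ℕ) : Finset ℕ :=
  (Finset.Icc 1 (R b).length).filter (fun j => ∃ i, l ≤ i ∧ i ≤ u ∧ Assoc b i j)

/-- `Δ` is the set of triangles of the subdivision, with vertices `0, 1, …, k` for
`k = (R b).length`, that belongs to a P-resolution given by `b` and `C`. It is the product of the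
following factors. Each set `H` that comes from a maximal interval `{l, …, u}` of `J` contributes the
subdivision in `T` of the polygon with vertex set `{0} ∪ H`. Each maximal interval `M` of the complement
of these sets contributes the polygon with vertex set `{0} ∪ M` in which all triangles have vertex
`0`. Consecutive factors with a common position `> 0` are multiplied by `*`, which takes
the union of the sets of triangles. If there is no common position, then they are multiplied by
`·`, which adds the triangle `{0, i, i + 1}`, where `i` is the last position of the
first factor and `i + 1` the first one of the second factor. So the triangles outside the factors in
`T` are the sets `{0, i, i + 1}` with `i`, `i + 1` not in a common `H`. -/
def IsPTriangulation (b : List ℕ) (C : Finset ℕ) (Δ : Finset (Finset ℕ)) : Prop :=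
  ∃ D : ℕ → ℕ → Finset (Finset ℕ),
    (∀ l u, IsTComponent b C l u →
      IsTSubdivisionOf (slice b l u) (insert 0 (assocPositions b l u)) (D l u)) ∧
    ∀ t : Finset ℕ, t ∈ Δ ↔
      (∃ l u, IsTComponent b C l u ∧ t ∈ D l u) ∨
      (∃ i, 1 ≤ i ∧ i + 1 ≤ (R b).length ∧
        (¬ ∃ l u, IsTComponent b C l u ∧
          i ∈ assocPositions b l u ∧ i + 1 ∈ assocPositions b l u) ∧
        t = {0, i, i + 1})

/-- The set `𝒮` of labelled subdivisions `(V, Δ, a)` with vertices in `α`. -/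
structure LabelledSubdivision (α : Type*) [LinearOrder α] where
  V : Finset α
  Δ : Finset (Finset α)
  a : List ℕ
  isLabelled : IsLabelled V Δ a

/-- An isomorphism of labelled subdivisions is a bijection of the vertices that maps the triangles
onto the triangles and preserves the labels. (It maps the distinguished vertex, the only one
without a label, to the distinguished vertex.) -/
def LabelledSubdivision.IsIso {α : Type*} [LinearOrder α] (S S' : LabelledSubdivision α)
    (f : α → α) : Prop :=
  Set.BijOn f S.V S'.V ∧ S'.Δ = S.Δ.image (fun t => t.image f) ∧
    ∀ v ∈ S.V, label S'.V S'.a (f v) = label S.V S.a v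

theorem IsSubdivision.subset {α : Type*} [LinearOrder α] {V : Finset α} {Δ : Finset (Finset α)}
    (h : IsSubdivision V Δ) : ∀ t ∈ Δ, t ⊆ V := by
  induction h with
  | digon x y h => simp
  | glue V₁ V₂ Δ₁ Δ₂ x y z h₁ h₂ hx hy₁ hy₂ hz ih₁ ih₂ =>
    intro t ht
    rw [Finset.mem_insert, Finset.mem_union] at ht
    rcases ht with rfl | ht | ht
    · intro w hw
      have h1 : x ∈ V₁ := hx.1
      have h2 : y ∈ V₁ := hy₁.1
      have h3 : z ∈ V₂ := hz.1
      simp only [Finset.mem_insert, Finset.mem_singleton] at hw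
      rw [Finset.mem_union]
      rcases hw with rfl | rfl | rfl
      · exact Or.inl h1
      · exact Or.inl h2
      · exact Or.inr h3
    · exact (ih₁ t ht).trans Finset.subset_union_left
    · exact (ih₂ t ht).trans Finset.subset_union_right

/-- Isomorphism of labelled subdivisions as an equivalence relation. -/
instance isoSetoid (α : Type*) [LinearOrder α] : Setoid (LabelledSubdivision α) where
  r S S' := ∃ f, S.IsIso S' f
  iseqv :=
    { refl := fun S => ⟨id, Set.bijOn_id _, by simp, fun _ _ => rfl⟩
      symm := by
        rintro S S' ⟨f, hf, hΔ, hl⟩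
        have hne : Nonempty α := by
          have := S.isLabelled.length
          obtain ⟨x, -⟩ := Finset.card_pos.1 (show 0 < S.V.card by omega)
          exact ⟨x⟩
        have hinv := hf.invOn_invFunOn
        refine ⟨Function.invFunOn f S.V, hf.symm hinv.symm, ?_, ?_⟩
        · rw [hΔ, Finset.image_image]
          ext t
          simp only [Finset.mem_image, Function.comp]
          have key : ∀ s ∈ S.Δ, (s.image f).image (Function.invFunOn f S.V) = s := by
            intro s hs
            rw [Finset.image_image]
            conv_rhs => rw [← Finset.image_id (s := s)]
            apply Finset.image_congr
            intro v hv
            exact hinv.1 (S.isLabelled.subdivision.subset s hs hv)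
          constructor
          · intro ht
            exact ⟨t, ht, key t ht⟩
          · rintro ⟨s, hs, rfl⟩
            rw [key s hs]
            exact hs
        · intro v hv
          obtain ⟨w, hw, rfl⟩ := hf.surjOn hv
          rw [hinv.1 hw, hl w hw]
      trans := by
        rintro S S' S'' ⟨f, hf, hΔ, hl⟩ ⟨g, hg, hΔ', hl'⟩
        refine ⟨g ∘ f, hg.comp hf, ?_, ?_⟩
        · rw [hΔ', hΔ, Finset.image_image]
          simp only [Function.comp_def, Finset.image_image]
        · intro v hv
          rw [Function.comp, hl' _ (hf.mapsTo hv), hl v hv] }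

/-- The set of isomorphism classes of a set of labelled subdivisions. -/
def IsoClasses {α : Type*} [LinearOrder α] (X : Set (LabelledSubdivision α)) : Type _ :=
  Quotient ((isoSetoid α).comap (Subtype.val : X → LabelledSubdivision α))

/-- The isomorphism class of an element. -/
def isoClass {α : Type*} [LinearOrder α] {X : Set (LabelledSubdivision α)} (S : X) :
    IsoClasses X :=
  Quotient.mk ((isoSetoid α).comap (Subtype.val : X → LabelledSubdivision α)) S

/-- The set `ℳ` of labelled subdivisions whose labels are all at least two. -/
def setM (α : Type*) [LinearOrder α] : Set (LabelledSubdivision α) := {S | IsW2 S.a}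

/-- The set `𝒫` of labelled subdivisions `(V, Δ, a)` that are constructed from a P-resolution: the
graph of its minimal resolution is `Γ(b)` with `a = R(b)`, and, after replacing the vertex `v_i` by its
index `i`, the set `Δ` is the one constructed from the P-resolution. -/
def setP (α : Type*) [LinearOrder α] : Set (LabelledSubdivision α) :=
  {S | ∃ b C, IsPResolution b C ∧ S.a = R b ∧
    IsPTriangulation b C (S.Δ.image (fun t => t.image (idx S.V)))}

end PRes

namespace PRes

/-! ### The operator `R` -/

/-! Both sides of the bijection are described by one kind of code: a list of `Item`s, each an entry
of a chain or a triangulated polygon `Tr` whose interior vertices carry a defect, label minus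
degree.

Elements of ℳ. The diagonals from v₀ cut a subdivision into polygons over the edges opposite to v₀.
Polygons with triangles become items `tr t`; single edges and surplus labels become entries ≥ 2.
`Tr.chain` is made so that `R` turns it into the vertex labels (`Tr.Rrev_chain`). Since `R` of a
concatenation glues the last label of one part to the first label of the next (`openR_append`), `R
(chain X) = lab X` for whole lists (`Valid.R_chain`). Labels and triangles determine the list, and
every element of ℳ has one (`Valid.ext`, `exists_code_of_bound`).

Elements of 𝒫. A graph of type T is the chain of `path w d`, a polygon with a single vertex of
positive defect, whose place in the binary tree of triangles is the word `w`. If K + ∑ δⱼEⱼ has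
degree 0 on the curves of such an interval, the numbers 1 - δⱼ are harmonic along the chain, and at
the two ends they are a/(a+b) and b/(a+b), where (a,b) is the Stern–Brocot pair of `w`
(`exists_isMult`, `eq_of_harmonic`). So a -1-curve can have positive degree only between two
intervals of type T, and it has positive degree there exactly if the left word precedes the right
one in the order of the tree (`wlt_iff_sum_lt`). P-resolutions therefore amount to lists in which
`1` occurs only between one-vertex polygons whose words increase (`IsPResolution.exists_items`,
`isPResolution_contracted`).

The bijection. An increasing list of words with positive defects is the same as one polygon: read
off its vertices of positive defect from left to right (`flat_injective`, `IsRun.exists_tr`).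
Replacing each polygon by that list is `expand`, which is a bijection from codes of ℳ to lists of
P-resolutions (`IsCode.expand_injective`, `exists_code`). The -1-nodes between the chains of type T
can be blown down until the chain of the polygon is left (`run_flat`). As `R` is an involution,
these chains are `R a` and `R a'`.

Isomorphisms. The sides of a polygon are the pairs of vertices that lie in an odd number of
triangles, so an isomorphism is the identity or the reflection of v₁, …, v_k (`eq_id_or_reverse`).
Reflection is `mirror` on codes and commutes with `expand`. In 𝒫 the vertices near a label 1 lie in
one triangle too many; the link of two of these triangles lowers the degree to what the label admits
(`Valid.bound`). -/

@[simp] theorem alphaRight_nil : alphaRight [] = [] := rfl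
@[simp] theorem alphaRight_cons (x : ℕ) (a : List ℕ) : alphaRight (x :: a) = (x + 1) :: a := rfl

theorem alphaRight_append {a : List ℕ} (h : a ≠ []) (b : List ℕ) :
    alphaRight (a ++ b) = alphaRight a ++ b := by
  cases a with
  | nil => exact absurd rfl h
  | cons x a => rfl

@[simp] theorem alphaLeft_concat (a : List ℕ) (x : ℕ) : alphaLeft (a ++ [x]) = a ++ [x + 1] := by
  simp [alphaLeft]

theorem alphaLeft_append (a : List ℕ) {b : List ℕ} (h : b ≠ []) :
    alphaLeft (a ++ b) = a ++ alphaLeft b := by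
  unfold alphaLeft
  rw [List.reverse_append, alphaRight_append (by simpa using h)]
  simp

theorem alphaLeft_cons (x : ℕ) {b : List ℕ} (h : b ≠ []) :
    alphaLeft (x :: b) = x :: alphaLeft b := alphaLeft_append [x] h

theorem reverse_alphaLeft (a : List ℕ) : (alphaLeft a).reverse = alphaRight a.reverse := by
  simp [alphaLeft]

theorem reverse_alphaRight (a : List ℕ) : (alphaRight a).reverse = alphaLeft a.reverse := by
  simp [alphaLeft]

@[simp] theorem length_alphaRight (a : List ℕ) : (alphaRight a).length = a.length := by
  cases a <;> rfl

@[simp] theorem length_alphaLeft (a : List ℕ) : (alphaLeft a).length = a.length := by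
  simp [alphaLeft]

@[simp] theorem alphaRight_eq_nil {a : List ℕ} : alphaRight a = [] ↔ a = [] := by
  cases a <;> simp

@[simp] theorem alphaLeft_eq_nil {a : List ℕ} : alphaLeft a = [] ↔ a = [] := by
  simp [alphaLeft]

theorem alphaRight_alphaLeft (a : List ℕ) :
    alphaRight (alphaLeft a) = alphaLeft (alphaRight a) := by
  rcases List.eq_nil_or_concat a with rfl | ⟨a, y, rfl⟩
  · rfl
  · cases a with
    | nil => rfl
    | cons x a => rw [List.concat_eq_append, alphaLeft_concat, List.cons_append, alphaRight_cons, List.cons_append,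
        alphaRight_cons, ← List.cons_append, ← List.cons_append, alphaLeft_concat]

theorem IsW2.alphaRight {a : List ℕ} (h : IsW2 a) : IsW2 (alphaRight a) := by
  cases a with
  | nil => exact h
  | cons x a =>
    intro y hy
    rcases List.mem_cons.1 hy with rfl | hy
    · have := h x (by simp); omega
    · exact h y (by simp [hy])

theorem IsW2.reverse {a : List ℕ} (h : IsW2 a) : IsW2 a.reverse := fun x hx => h x (by simpa using hx)

theorem IsW2.alphaLeft {a : List ℕ} (h : IsW2 a) : IsW2 (alphaLeft a) :=
  h.reverse.alphaRight.reverse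

theorem IsW2.append {a b : List ℕ} (ha : IsW2 a) (hb : IsW2 b) : IsW2 (a ++ b) := by
  intro x hx
  rcases List.mem_append.1 hx with h | h
  exacts [ha x h, hb x h]

theorem isW2_replicate (n : ℕ) : IsW2 (List.replicate n 2) := by
  intro x hx; rw [List.eq_of_mem_replicate hx]

theorem IsW2.isW {a : List ℕ} (h : IsW2 a) : IsW a := fun x hx => le_trans one_le_two (h x hx)

theorem IsW.append {a b : List ℕ} (ha : IsW a) (hb : IsW b) : IsW (a ++ b) := by
  intro x hx
  rcases List.mem_append.1 hx with h | h
  exacts [ha x h, hb x h]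

theorem IsW.alphaRight {a : List ℕ} (h : IsW a) : IsW (alphaRight a) := by
  cases a with
  | nil => exact h
  | cons x a =>
    intro y hy
    rcases List.mem_cons.1 hy with rfl | hy
    · omega
    · exact h y (by simp [hy])

theorem IsW2.cons {x : ℕ} {a : List ℕ} (hx : 2 ≤ x) (ha : IsW2 a) : IsW2 (x :: a) := by
  intro y hy
  rcases List.mem_cons.1 hy with rfl | hy
  exacts [hx, ha y hy]

theorem IsW.reverse {a : List ℕ} (h : IsW a) : IsW a.reverse := fun x hx => h x (by simpa using hx)

theorem IsW.of_cons {x : ℕ} {a : List ℕ} (h : IsW (x :: a)) : 1 ≤ x ∧ IsW a :=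
  ⟨h x (by simp), fun y hy => h y (by simp [hy])⟩

theorem IsW2.of_cons {x : ℕ} {a : List ℕ} (h : IsW2 (x :: a)) : 2 ≤ x ∧ IsW2 a :=
  ⟨h x (by simp), fun y hy => h y (by simp [hy])⟩

@[simp] theorem Rrev_nil : Rrev [] = [] := by simp [Rrev]
@[simp] theorem Rrev_one (a : List ℕ) : Rrev (1 :: a) = 1 :: Rrev a := by simp [Rrev]
theorem Rrev_add_two (n : ℕ) (a : List ℕ) : Rrev ((n + 2) :: a) = List.replicate n 2 ++
    (if StartsBlock a then 2 :: Rrev a else alphaRight (Rrev a)) := by simp [Rrev]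

@[simp] theorem startsBlock_nil : StartsBlock [] := Or.inl rfl
@[simp] theorem startsBlock_cons (x : ℕ) (a : List ℕ) : StartsBlock (x :: a) ↔ x = 1 := by
  simp [StartsBlock]

/-- The image under `Rrev`, with an additional entry `1` where a new block of entries `≥ 2` may be
attached. -/
def openR (a : List ℕ) : List ℕ := if StartsBlock a then 1 :: Rrev a else Rrev a

@[simp] theorem openR_nil : openR [] = [1] := by simp [openR]
theorem openR_one (a : List ℕ) : openR (1 :: a) = 1 :: 1 :: Rrev a := by simp [openR]

/-- At the start of a block `2 :: Rrev a` is `alphaRight (1 :: Rrev a)`, so the extra entry `1` in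
`openR` merges the two cases of the definition into one rule. -/
theorem Rrev_eq_openR (n : ℕ) (a : List ℕ) :
    Rrev ((n + 2) :: a) = List.replicate n 2 ++ alphaRight (openR a) := by
  rw [Rrev_add_two, openR]
  split_ifs <;> rfl

theorem openR_add_two (n : ℕ) (a : List ℕ) :
    openR ((n + 2) :: a) = List.replicate n 2 ++ alphaRight (openR a) := by
  rw [← Rrev_eq_openR, openR, if_neg (by simp)]

theorem openR_eq_Rrev {a : List ℕ} (h : ¬ StartsBlock a) : openR a = Rrev a := if_neg h

theorem openR_of_isW2 {a : List ℕ} (h : IsW2 a) (h0 : a ≠ []) : openR a = Rrev a := by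
  cases a with
  | nil => exact absurd rfl h0
  | cons x a => exact openR_eq_Rrev (by have := h.of_cons.1; simp; omega)

theorem Rrev_ne_nil {a : List ℕ} (h : IsW a) (h0 : a ≠ []) : Rrev a ≠ [] := by
  match a, h, h0 with
  | 0 :: a, h, _ => have := h.of_cons.1; omega
  | 1 :: a, _, _ => simp
  | (n + 2) :: a, h, _ =>
    rw [Rrev_eq_openR]
    have : openR a ≠ [] := by
      unfold openR
      split_ifs with hs
      · simp
      · exact Rrev_ne_nil h.of_cons.2 (fun h => hs (Or.inl h))
    simp [this]

theorem openR_ne_nil {a : List ℕ} (h : IsW a) : openR a ≠ [] := by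
  unfold openR
  split_ifs with hs
  · simp
  · exact Rrev_ne_nil h (fun h => hs (Or.inl h))

theorem isW_Rrev {a : List ℕ} (h : IsW a) : IsW (Rrev a) := by
  match a, h with
  | [], h => simpa using h
  | 0 :: a, h => have := h.of_cons.1; omega
  | 1 :: a, h =>
    intro x hx
    simp only [Rrev_one, List.mem_cons] at hx
    rcases hx with rfl | hx
    · rfl
    · exact isW_Rrev h.of_cons.2 x hx
  | (n + 2) :: a, h =>
    rw [Rrev_eq_openR]
    refine (isW2_replicate n).isW.append (IsW.alphaRight ?_)
    have := isW_Rrev h.of_cons.2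
    unfold openR
    split_ifs
    · intro x hx
      rcases List.mem_cons.1 hx with rfl | hx
      exacts [le_rfl, this x hx]
    · exact this

theorem isW2_Rrev {a : List ℕ} (h : IsW2 a) : IsW2 (Rrev a) := by
  match a, h with
  | [], h => simpa using h
  | 0 :: a, h => have := h.of_cons.1; omega
  | 1 :: a, h => have := h.of_cons.1; omega
  | (n + 2) :: a, h =>
    rw [Rrev_eq_openR]
    refine (isW2_replicate n).append ?_
    rcases eq_or_ne a [] with rfl | ha
    · intro x hx; simp at hx; omega
    · rw [openR_of_isW2 h.of_cons.2 ha]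
      exact (isW2_Rrev h.of_cons.2).alphaRight

theorem Rrev_two_cons {a : List ℕ} (h : ¬ StartsBlock a) : Rrev (2 :: a) = alphaRight (Rrev a) := by
  have := Rrev_eq_openR 0 a
  rwa [openR_eq_Rrev h] at this

theorem Rrev_alphaRight {a : List ℕ} (h : IsW a) (h' : ¬ StartsBlock a) :
    Rrev (alphaRight a) = 2 :: Rrev a := by
  match a, h, h' with
  | [], _, h' => simp at h'
  | 0 :: a, h, _ => have := h.of_cons.1; omega
  | 1 :: a, _, h' => simp at h'
  | (n + 2) :: a, _, _ =>
    have := Rrev_eq_openR (n + 1) a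
    rw [alphaRight_cons, Rrev_eq_openR n]
    exact this

/-- Entries `1` are kept and every block produces entries ≥ 2 only, so the same case of the
recursion applies to a sequence and to its image. -/
theorem startsBlock_Rrev {a : List ℕ} (h : IsW a) : StartsBlock (Rrev a) ↔ StartsBlock a := by
  match a, h with
  | [], h => simp
  | 0 :: a, h => have := h.of_cons.1; omega
  | 1 :: a, h => simp
  | (n + 2) :: a, h =>
    rw [Rrev_eq_openR]
    have h1 := openR_ne_nil h.of_cons.2
    have h2 : IsW (openR a) := by
      have := isW_Rrev h.of_cons.2
      unfold openR
      split_ifs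
      · intro x hx
        rcases List.mem_cons.1 hx with rfl | hx
        exacts [le_rfl, this x hx]
      · exact this
    cases n with
    | succ n => simp [List.replicate_succ]
    | zero =>
      obtain ⟨y, ys, hy⟩ := List.exists_cons_of_ne_nil h1
      rw [hy] at h2 ⊢
      have := h2.of_cons.1
      simp; omega

/-- `Rrev` is an involution. -/
theorem Rrev_Rrev {a : List ℕ} (h : IsW a) : Rrev (Rrev a) = a := by
  -- An entry `n + 2` puts `n` entries `2` in front; applying `Rrev` again turns each of them into
  -- one increase of the head, which restores the entry.
  have key : ∀ (n : ℕ) (b : List ℕ), IsW b → ¬ StartsBlock b →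
      Rrev (List.replicate n 2 ++ b) = alphaRight^[n] (Rrev b) := by
    intro n b hb hb'
    induction n with
    | zero => rfl
    | succ n ih =>
      rw [List.replicate_succ, List.cons_append, Rrev_two_cons, ih, Function.iterate_succ_apply']
      cases n <;> simp [List.replicate_succ, hb']
  have it : ∀ (n x : ℕ) (b : List ℕ), alphaRight^[n] (x :: b) = (n + x) :: b := by
    intro n
    induction n with
    | zero => simp
    | succ n ih => intro x b; rw [Function.iterate_succ_apply, alphaRight_cons, ih]; congr 1; ring
  match a, h with
  | [], h => simp
  | 0 :: a, h => have := h.of_cons.1; omega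
  | 1 :: a, h => simp [Rrev_Rrev h.of_cons.2]
  | (n + 2) :: a, h =>
    have ha := h.of_cons.2
    have ih := Rrev_Rrev ha
    have hw := isW_Rrev ha
    rw [Rrev_add_two]
    split_ifs with hs
    · have hs' := (startsBlock_Rrev ha).2 hs
      rw [key, show (2 : ℕ) = 0 + 2 from rfl, Rrev_add_two, if_pos hs', ih]
      · exact it n 2 a
      · intro x hx
        rcases List.mem_cons.1 hx with rfl | hx
        exacts [one_le_two, hw x hx]
      · simp
    · have hs' := (startsBlock_Rrev ha).not.2 hs
      rw [key _ _ hw.alphaRight, Rrev_alphaRight hw hs', ih]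
      · exact it n 2 a
      · obtain ⟨y, ys, hy⟩ := List.exists_cons_of_ne_nil (fun h => hs' (Or.inl h))
        rw [hy] at hw ⊢
        have := hw.of_cons.1
        simp; omega

/-! ### Symmetry of `R` under reversal -/

theorem Rrev_concat_one {a : List ℕ} (h : IsW a) : Rrev (a ++ [1]) = Rrev a ++ [1] := by
  match a, h with
  | [], h => simp
  | 0 :: a, h => have := h.of_cons.1; omega
  | 1 :: a, h => simp [Rrev_concat_one h.of_cons.2]
  | (n + 2) :: a, h =>
    have ih := Rrev_concat_one h.of_cons.2
    have hs : StartsBlock (a ++ [1]) ↔ StartsBlock a := by cases a <;> simp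
    rw [List.cons_append, Rrev_add_two, Rrev_add_two, ih, List.append_assoc]
    simp only [hs]
    split_ifs with h1
    · simp
    · rw [alphaRight_append (Rrev_ne_nil h.of_cons.2 (fun h => h1 (Or.inl h)))]

/-- The mirror image of the defining recursion. It holds because increasing the first and increasing
the last entry commute, also for a single entry (`alphaRight_alphaLeft`). -/
theorem Rrev_concat_add_two {a : List ℕ} (h : IsW a) (n : ℕ) : Rrev (a ++ [n + 2]) =
    (if StartsBlock a.reverse then Rrev a ++ [2] else alphaLeft (Rrev a)) ++
      List.replicate n 2 := by
  match a, h with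
  | [], h => simp [Rrev_add_two, ← List.replicate_succ, ← List.replicate_succ']
  | 0 :: a, h => have := h.of_cons.1; omega
  | 1 :: a, h =>
    have ih := Rrev_concat_add_two h.of_cons.2 n
    rcases eq_or_ne a [] with rfl | ha
    · simp at ih
      simp [ih]
    · have hs : StartsBlock (1 :: a).reverse ↔ StartsBlock a.reverse := by
        rcases List.eq_nil_or_concat a with rfl | ⟨a, y, rfl⟩
        · exact absurd rfl ha
        · simp
      simp only [hs, List.cons_append, Rrev_one, ih]
      split_ifs
      · simp
      · rw [alphaLeft_cons _ (Rrev_ne_nil h.of_cons.2 ha)]; simp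
  | (m + 2) :: a, h =>
    have hw := h.of_cons.2
    have ih := Rrev_concat_add_two hw n
    rcases eq_or_ne a [] with rfl | ha
    · simp at ih
      rw [List.cons_append, List.nil_append, Rrev_add_two, ih]
      simp [Rrev_add_two]
    · have hs : StartsBlock ((m + 2) :: a).reverse ↔ StartsBlock a.reverse := by
        rcases List.eq_nil_or_concat a with h | ⟨a, y, rfl⟩
        · exact absurd h ha
        · simp
      have hs2 : StartsBlock (a ++ [n + 2]) ↔ StartsBlock a := by
        cases a with
        | nil => exact absurd rfl ha
        | cons x a => simp
      have hR := Rrev_ne_nil hw ha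
      rw [List.cons_append, Rrev_add_two, Rrev_add_two, ih]
      rw [if_congr hs rfl rfl, if_congr hs2 rfl rfl]
      split_ifs
      · simp
      · rw [alphaLeft_append _ (by simp), alphaLeft_cons _ hR]; simp
      · rw [alphaRight_append (by simp), alphaRight_append hR]; simp
      · rw [alphaRight_append (by simpa using hR), alphaLeft_append _ (by simpa using hR),
          alphaRight_alphaLeft]; simp

/-- `Rrev` commutes with the reversal of sequences. -/
theorem Rrev_reverse {a : List ℕ} (h : IsW a) : Rrev a.reverse = (Rrev a).reverse := by
  match a, h with
  | [], h => simp
  | 0 :: a, h => have := h.of_cons.1; omega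
  | 1 :: a, h =>
    rw [List.reverse_cons, Rrev_concat_one h.of_cons.2.reverse, Rrev_reverse h.of_cons.2]; simp
  | (n + 2) :: a, h =>
    rw [List.reverse_cons, Rrev_concat_add_two h.of_cons.2.reverse, Rrev_reverse h.of_cons.2,
      List.reverse_reverse, Rrev_add_two]
    split_ifs <;> simp [reverse_alphaRight]

/-- Invariance under reversal makes it irrelevant from which end the recursion runs, so all later
computations peel off the first entry instead of the last. -/
theorem R_eq_Rrev {a : List ℕ} (h : IsW a) : R a = Rrev a := by
  rw [R, Rrev_reverse h, List.reverse_reverse]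

theorem R_R {a : List ℕ} (h : IsW a) : R (R a) = a := by
  rw [R_eq_Rrev h, R_eq_Rrev (isW_Rrev h), Rrev_Rrev h]

theorem R_reverse {a : List ℕ} (h : IsW a) : R a.reverse = (R a).reverse := by
  rw [R_eq_Rrev h.reverse, R_eq_Rrev h, Rrev_reverse h]

/-- Identify the last entry of a sequence with the first entry of another one; the entry
becomes their sum minus `1`. -/
def merge : List ℕ → List ℕ → List ℕ
  | [], q => q
  | [_], [] => []
  | [x], y :: q => (x + y - 1) :: q
  | x :: z :: p, q => x :: merge (z :: p) q

theorem merge_concat (p : List ℕ) (x y : ℕ) (q : List ℕ) :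
    merge (p ++ [x]) (y :: q) = p ++ (x + y - 1) :: q := by
  induction p with
  | nil => rfl
  | cons z p ih =>
    cases p with
    | nil => rfl
    | cons w p => simp only [List.cons_append] at ih ⊢; rw [merge, ih]

/-- The recursion for `a` only changes the head of what is already there. Run over `openR b` instead
of over `openR [] = [1]`, it meets the head `y` of `openR b` in place of `1`; everything else is the
same. -/
theorem openR_append {a : List ℕ} (h : IsW2 a) (h0 : a ≠ []) (b : List ℕ) (hb : IsW b) :
    openR (a ++ b) = merge (Rrev a) (openR b) := by
  obtain ⟨y, q, hy⟩ := List.exists_cons_of_ne_nil (openR_ne_nil hb)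
  rw [← openR_of_isW2 h h0]
  -- Invariant of the induction: the entry that began as `1` is now `x`, and over `b` the entry that
  -- began as `y` is larger by `y - 1`.
  have key : ∀ a : List ℕ, IsW2 a → ∃ p x, 1 ≤ x ∧ openR a = p ++ [x] ∧
      openR (a ++ b) = p ++ (x + y - 1) :: q := by
    intro a ha
    induction a with
    | nil => exact ⟨[], 1, le_rfl, by simp, by simp [hy]⟩
    | cons z a ih =>
      obtain ⟨p, x, hx, h1, h2⟩ := ih ha.of_cons.2
      obtain ⟨n, rfl⟩ := Nat.exists_eq_add_of_le' ha.of_cons.1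
      rw [List.cons_append, openR_add_two, openR_add_two, h1, h2]
      cases p with
      | nil =>
        refine ⟨List.replicate n 2, x + 1, by omega, by simp, ?_⟩
        simp; omega
      | cons w p => exact ⟨List.replicate n 2 ++ (w + 1) :: p, x, hx, by simp, by simp⟩
  obtain ⟨p, x, hx, h1, h2⟩ := key a h
  rw [h1, h2, hy, merge_concat]

end PRes

namespace PRes

/-! ### Triangulated polygons over a base edge -/

/-- A triangulated polygon with a base edge: a single edge, or a triangle on the base edge with
polygons on its two other edges. The apex of each triangle carries a number, the difference of its
label and its degree. -/
inductive Tr where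
  | leaf : Tr
  | node (l : Tr) (d : ℕ) (r : Tr) : Tr

namespace Tr

/-- The number of triangles at the first vertex. -/
def first : Tr → ℕ
  | leaf => 0
  | node l _ _ => l.first + 1

/-- The number of triangles at the last vertex. -/
def last : Tr → ℕ
  | leaf => 0
  | node _ _ r => r.last + 1

/-- The labels of the interior vertices. -/
def mid : Tr → List ℕ
  | leaf => []
  | node l d r => l.mid ++ (l.last + r.first + 1 + d) :: r.mid

/-- The number of edges other than the base edge. -/
def size : Tr → ℕ
  | leaf => 1
  | node l _ r => l.size + r.size

/-- Forget the numbers at the vertices. -/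
def strip : Tr → Tr
  | leaf => leaf
  | node l _ r => node l.strip 0 r.strip

/-- Every vertex of degree one has label at least two. -/
def Good : Tr → Prop
  | leaf => True
  | node l d r => l.Good ∧ r.Good ∧ (l = leaf → r = leaf → 1 ≤ d)

/-- The image under reflection. -/
def mirror : Tr → Tr
  | leaf => leaf
  | node l d r => node r.mirror d l.mirror

/-- The labels of all vertices, after the base edge is joined to a further vertex. -/
def labels (t : Tr) : List ℕ := (t.first + 1) :: t.mid ++ [t.last + 1]

/-- Append a chain `c` and the entry `2`; for empty `c` increase the last entry instead. -/
def attach (u c : List ℕ) : List ℕ := if c = [] then alphaLeft u else u ++ c ++ [2]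

/-- The chain that corresponds to the polygon. -/
def chain : Tr → List ℕ
  | leaf => []
  | node l d r =>
      if l.chain = [] then alphaRight (attach (List.replicate d 2) r.chain)
      else attach (2 :: (l.chain ++ List.replicate d 2)) r.chain

@[simp] theorem chain_leaf : leaf.chain = [] := rfl

theorem size_pos (t : Tr) : 1 ≤ t.size := by
  induction t with
  | leaf => rfl
  | node l d r hl hr => simp only [size]; omega

theorem length_mid (t : Tr) : t.mid.length + 1 = t.size := by
  induction t with
  | leaf => rfl
  | node l d r hl hr => simp only [size, mid, List.length_append, List.length_cons]; omega

theorem length_labels (t : Tr) : t.labels.length = t.size + 1 := by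
  have := t.length_mid
  simp [labels]; omega

@[simp] theorem strip_eq_leaf {t : Tr} : t.strip = leaf ↔ t = leaf := by
  cases t <;> simp [strip]

@[simp] theorem first_strip (t : Tr) : t.strip.first = t.first := by
  induction t with
  | leaf => rfl
  | node l d r hl hr => simp [strip, first, hl]

@[simp] theorem last_strip (t : Tr) : t.strip.last = t.last := by
  induction t with
  | leaf => rfl
  | node l d r hl hr => simp [strip, last, hr]

@[simp] theorem size_strip (t : Tr) : t.strip.size = t.size := by
  induction t with
  | leaf => rfl
  | node l d r hl hr => simp [strip, size, hr, hl]

@[simp] theorem strip_strip (t : Tr) : t.strip.strip = t.strip := by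
  induction t with
  | leaf => rfl
  | node l d r hl hr => simp [strip, hr, hl]

@[simp] theorem size_mirror (t : Tr) : t.mirror.size = t.size := by
  induction t with
  | leaf => rfl
  | node l d r hl hr => simp [mirror, size, hr, hl, Nat.add_comm]

@[simp] theorem mirror_eq_leaf {t : Tr} : t.mirror = leaf ↔ t = leaf := by
  cases t <;> simp [mirror]

theorem mirror_strip (t : Tr) : t.strip.mirror = t.mirror.strip := by
  induction t with
  | leaf => rfl
  | node l d r hl hr => simp [mirror, strip, hr, hl]

theorem Good.mirror {t : Tr} (h : t.Good) : t.mirror.Good := by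
  induction t with
  | leaf => trivial
  | node l d r hl hr =>
    exact ⟨hr h.2.1, hl h.1, fun h1 h2 => h.2.2 (mirror_eq_leaf.1 h2) (mirror_eq_leaf.1 h1)⟩

theorem attach_isW2 {u c : List ℕ} (hu : IsW2 u) (hc : IsW2 c) : IsW2 (attach u c) := by
  unfold attach
  split_ifs
  · exact hu.alphaLeft
  · exact (hu.append hc).append (isW2_replicate 1)

theorem chain_isW2 (t : Tr) : IsW2 t.chain := by
  induction t with
  | leaf => intro x hx; simp [chain] at hx
  | node l d r hl hr =>
    unfold chain
    split_ifs
    · exact (attach_isW2 (isW2_replicate d) hr).alphaRight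
    · exact attach_isW2 (IsW2.cons le_rfl (hl.append (isW2_replicate d))) hr

/-- A chain could become empty only at a single triangle whose apex has defect `0`, and this is what
`Good` excludes. -/
theorem chain_ne_nil {t : Tr} (h : t.Good) (h0 : t ≠ leaf) : t.chain ≠ [] := by
  induction t with
  | leaf => exact absurd rfl h0
  | node l d r hl hr =>
    unfold chain
    split_ifs with h1
    · have hl0 : l = leaf := by by_contra h2; exact hl h.1 h2 h1
      rw [Ne, alphaRight_eq_nil]
      unfold attach
      split_ifs with h2
      · have hr0 : r = leaf := by by_contra h3; exact hr h.2.1 h3 h2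
        have := h.2.2 hl0 hr0
        simp; omega
      · simp
    · unfold attach
      split_ifs <;> simp

theorem chain_eq_nil {t : Tr} (h : t.Good) : t.chain = [] ↔ t = leaf := by
  constructor
  · intro h1; by_contra h2; exact chain_ne_nil h h2 h1
  · rintro rfl; rfl

end Tr

/-! ### Rules for `Rrev` on sequences with entries ≥ 2, and the labels of a polygon -/

theorem openR_replicate_append (d : ℕ) {v q : List ℕ} {y : ℕ} (h : openR v = y :: q) :
    openR (List.replicate d 2 ++ v) = (y + d) :: q := by
  induction d with
  | zero => simpa using h
  | succ d ih =>
    have := openR_add_two 0 (List.replicate d 2 ++ v)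
    rw [ih] at this
    exact this

section

variable {u v : List ℕ}

theorem IsW2.not_startsBlock (h : IsW2 u) (h0 : u ≠ []) : ¬ StartsBlock u := by
  cases u with
  | nil => exact absurd rfl h0
  | cons x u => have := h.of_cons.1; simp; omega

theorem Rrev_replicate_append (d : ℕ) {q : List ℕ} {y : ℕ} (h : IsW2 u) (h0 : u ≠ [])
    (hq : Rrev u = y :: q) : Rrev (List.replicate d 2 ++ u) = (y + d) :: q := by
  rw [← openR_of_isW2 ((isW2_replicate d).append h) (by simp [h0])]
  exact openR_replicate_append d (by rw [openR_of_isW2 h h0, hq])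

theorem Rrev_replicate (d : ℕ) : Rrev (List.replicate (d + 1) 2) = [d + 2] := by
  rw [← openR_of_isW2 (isW2_replicate (d + 1)) (by simp)]
  have := openR_replicate_append (d + 1) openR_nil
  simpa [Nat.add_comm, Nat.add_left_comm] using this

theorem Rrev_two_cons' (h : IsW2 u) (h0 : u ≠ []) : Rrev (2 :: u) = alphaRight (Rrev u) :=
  Rrev_two_cons (h.not_startsBlock h0)

theorem Rrev_alphaRight' (h : IsW2 u) (h0 : u ≠ []) : Rrev (alphaRight u) = 2 :: Rrev u :=
  Rrev_alphaRight h.isW (h.not_startsBlock h0)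

theorem Rrev_alphaLeft (h : IsW2 u) (h0 : u ≠ []) : Rrev (alphaLeft u) = Rrev u ++ [2] := by
  rw [alphaLeft, Rrev_reverse h.reverse.alphaRight.isW, Rrev_alphaRight' h.reverse (by simpa),
    Rrev_reverse h.isW]
  simp

theorem Rrev_append_replicate (d : ℕ) {p : List ℕ} {x : ℕ} (h : IsW2 u) (h0 : u ≠ [])
    (hp : Rrev u = p ++ [x]) : Rrev (u ++ List.replicate d 2) = p ++ [x + d] := by
  have := Rrev_replicate_append d (q := p.reverse) (y := x) h.reverse (by simpa)
    (by rw [Rrev_reverse h.isW, hp]; simp)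
  have h2 := congrArg List.reverse this
  rw [← Rrev_reverse ((isW2_replicate d).append h.reverse).isW] at h2
  simpa using h2

theorem Rrev_append (h : IsW2 u) (h0 : u ≠ []) (hv : IsW2 v) (hv0 : v ≠ []) :
    Rrev (u ++ v) = merge (Rrev u) (Rrev v) := by
  rw [← openR_of_isW2 (h.append hv) (by simp [h0]), openR_append h h0 v hv.isW,
    openR_of_isW2 hv hv0]

end

namespace Tr

/-- Under `Rrev`, an entry `2` put at an end raises the label at that end: this is the root triangle
as seen from the first or last vertex. The `d` entries `2` in the middle raise the apex label by its
defect. If a side of the root triangle is a single edge, `alphaRight` or `alphaLeft` takes the place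
of the entry `2` and creates a new end vertex with label `2`. -/
theorem Rrev_chain {t : Tr} (h : t.Good) (h0 : t ≠ leaf) : Rrev t.chain = t.labels := by
  induction t with
  | leaf => exact absurd rfl h0
  | node l d r hl hr =>
    have two : ∀ {u : List ℕ} {p : List ℕ} {x : ℕ}, IsW2 u → u ≠ [] → Rrev u = p ++ [x] →
        Rrev (u ++ [2]) = p ++ [x + 1] := fun h h0 hp => Rrev_append_replicate 1 h h0 hp
    have w2 := isW2_replicate d
    have w2' : IsW2 [2] := isW2_replicate 1
    rcases eq_or_ne l leaf with rfl | hl0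
    · rcases eq_or_ne r leaf with rfl | hr0
      · obtain ⟨e, rfl⟩ := Nat.exists_eq_add_of_le' (h.2.2 rfl rfl)
        rw [chain, chain_leaf, if_pos rfl, attach, if_pos rfl, Rrev_alphaRight' w2.alphaLeft (by simp),
          Rrev_alphaLeft w2 (by simp), Rrev_replicate]
        simp [labels, first, mid, last]; omega
      · have hc := chain_ne_nil h.2.1 hr0
        have hw := chain_isW2 r
        have e1 := two hw hc (p := (r.first + 1) :: r.mid) (hr h.2.1 hr0)
        rw [chain, chain_leaf, if_pos rfl, attach, if_neg hc, List.append_assoc,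
          Rrev_alphaRight' (w2.append (hw.append w2')) (by simp),
          Rrev_replicate_append d (hw.append w2') (by simp) e1]
        simp [labels, first, mid, last]
    · have hc := chain_ne_nil h.1 hl0
      have hw := chain_isW2 l
      have e1 := Rrev_append_replicate d hw hc (p := (l.first + 1) :: l.mid) (hl h.1 hl0)
      have e2 : Rrev (2 :: (l.chain ++ List.replicate d 2)) =
          (l.first + 2) :: l.mid ++ [l.last + 1 + d] := by
        rw [Rrev_two_cons' (hw.append w2) (by simp [hc]), e1]
        simp
      have hw2 := IsW2.cons le_rfl (hw.append w2)
      rcases eq_or_ne r leaf with rfl | hr0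
      · rw [chain, if_neg hc, attach, chain_leaf, if_pos rfl, Rrev_alphaLeft hw2 (by simp), e2]
        simp [labels, first, mid, last]
      · have hcr := chain_ne_nil h.2.1 hr0
        have hwr := chain_isW2 r
        have e3 := two hwr hcr (p := (r.first + 1) :: r.mid) (hr h.2.1 hr0)
        -- Merging the two sides gives the apex the label `(l.last + 1 + d) + (r.first + 1) - 1`, as
        -- required by `mid`.
        rw [chain, if_neg hc, attach, if_neg hcr, List.append_assoc,
          Rrev_append hw2 (by simp) (hwr.append w2') (by simp), e2, e3, List.cons_append (as := r.mid),
          merge_concat]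
        simp [labels, first, mid, last]; omega

theorem chain_mirror {t : Tr} (h : t.Good) : t.mirror.chain = t.chain.reverse := by
  induction t with
  | leaf => rfl
  | node l d r hl hr =>
    have hl' := hl h.1
    have hr' := hr h.2.1
    have e1 := chain_eq_nil h.1
    have e2 := chain_eq_nil h.2.1
    rw [mirror, chain, chain, hl', hr']
    simp only [attach, List.reverse_eq_nil_iff]
    rcases eq_or_ne l.chain [] with h1 | h1 <;> rcases eq_or_ne r.chain [] with h2 | h2
    · simp [h1, h2, reverse_alphaRight, reverse_alphaLeft, alphaRight_alphaLeft]
    · simp [h1, h2, reverse_alphaRight]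
    · simp [h1, h2, reverse_alphaLeft]
    · simp [h1, h2]

end Tr

/-! ### Sequences of nodes and polygons -/

/-- A node of a chain, or a polygon (which stands for a part of the chain). -/
inductive Item where
  | num (x : ℕ) : Item
  | tr (t : Tr) : Item

namespace Item

def chain : Item → List ℕ
  | num x => [x]
  | tr t => t.chain

/-- The polygons over the edges opposite to `v₀`. -/
def shapes : Item → List Tr
  | num x => if x = 1 then [Tr.leaf, Tr.leaf] else List.replicate (x - 2) Tr.leaf
  | tr t => [t.strip]

def mirror : Item → Item
  | num x => num x
  | tr t => tr t.mirror

end Item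

open Item

/-- The chain of a sequence of items. -/
def chain (X : List Item) : List ℕ := X.flatMap Item.chain

/-- The polygons over the edges opposite to `v₀`. -/
def shapes (X : List Item) : List Tr := X.flatMap Item.shapes

/-- The labels of the vertices. -/
def lab : List Item → List ℕ
  | [] => [1]
  | num x :: X => if x = 1 then 1 :: 1 :: lab X else List.replicate (x - 2) 2 ++ alphaRight (lab X)
  | tr t :: X => merge t.labels (lab X)

/-- Polygons are not adjacent, and an entry `1` occurs only between two polygons (or at the
beginning). -/
def Valid : List Item → Prop
  | [] => True
  | num x :: X => Valid X ∧ 1 ≤ x ∧ (x = 1 → ∃ t X', X = tr t :: X') ∧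
      ∀ X', X ≠ num 1 :: X'
  | tr t :: X => Valid X ∧ t.Good ∧ t ≠ Tr.leaf ∧ ∀ t' X', X ≠ tr t' :: X'

@[simp] theorem chain_nil : chain [] = [] := rfl
@[simp] theorem chain_num (x : ℕ) (X : List Item) : chain (num x :: X) = x :: chain X := rfl
@[simp] theorem chain_tr (t : Tr) (X : List Item) : chain (tr t :: X) = t.chain ++ chain X := rfl
@[simp] theorem chain_append (X Y : List Item) : chain (X ++ Y) = chain X ++ chain Y := by
  simp [chain]
@[simp] theorem shapes_nil : shapes [] = [] := rfl
@[simp] theorem shapes_one (X : List Item) :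
    shapes (num 1 :: X) = Tr.leaf :: Tr.leaf :: shapes X := rfl
@[simp] theorem shapes_add_two (x : ℕ) (X : List Item) :
    shapes (num (x + 2) :: X) = List.replicate x Tr.leaf ++ shapes X := rfl
@[simp] theorem shapes_tr (t : Tr) (X : List Item) : shapes (tr t :: X) = t.strip :: shapes X := rfl
@[simp] theorem shapes_append (X Y : List Item) : shapes (X ++ Y) = shapes X ++ shapes Y := by
  simp [shapes]
@[simp] theorem lab_nil : lab [] = [1] := rfl
@[simp] theorem lab_one (X : List Item) : lab (num 1 :: X) = 1 :: 1 :: lab X := rfl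
@[simp] theorem lab_add_two (x : ℕ) (X : List Item) :
    lab (num (x + 2) :: X) = List.replicate x 2 ++ alphaRight (lab X) := rfl
theorem lab_tr {t : Tr} {X : List Item} {y : ℕ} {q : List ℕ} (h : lab X = y :: q) :
    lab (tr t :: X) = (t.first + 1) :: t.mid ++ (t.last + y) :: q := by
  rw [lab, Tr.labels, h, merge_concat]
  congr 2; omega

theorem Valid.of_cons {i : Item} {X : List Item} (h : Valid (i :: X)) : Valid X := by
  cases i <;> exact h.1

theorem Valid.isW {X : List Item} (h : Valid X) : IsW (chain X) := by
  match X, h with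
  | [], h => intro x hx; simp at hx
  | num x :: X, h =>
    intro y hy
    rcases List.mem_cons.1 hy with rfl | hy
    · exact h.2.1
    · exact h.of_cons.isW y hy
  | tr t :: X, h => exact (t.chain_isW2.isW).append h.of_cons.isW

theorem Valid.not_startsBlock {X : List Item} (h : Valid X) (h0 : X ≠ [])
    (h1 : ∀ X', X ≠ num 1 :: X') : ¬ StartsBlock (chain X) := by
  match X, h with
  | [], h => exact absurd rfl h0
  | num x :: X, h => simp; rintro rfl; exact h1 X rfl
  | tr t :: X, h =>
    have := t.chain_isW2.not_startsBlock (Tr.chain_ne_nil h.2.1 h.2.2.1)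
    rw [chain_tr]
    obtain ⟨y, q, hy⟩ := List.exists_cons_of_ne_nil (Tr.chain_ne_nil h.2.1 h.2.2.1)
    rw [hy] at this ⊢
    simpa using this

/-- `lab` repeats the recursion of `openR` item by item, with `openR_append` and `Tr.Rrev_chain` at
a polygon. After an entry `1` a polygon follows, so there `Rrev` and `openR` of the remaining chain
agree. -/
theorem Valid.openR_chain {X : List Item} (h : Valid X) : openR (chain X) = lab X := by
  match X, h with
  | [], h => simp
  | num 0 :: X, h => exact absurd h.2.1 (by omega)
  | num 1 :: X, h =>
    obtain ⟨t, X', rfl⟩ := h.2.2.1 rfl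
    rw [chain_num, openR_one, lab_one, ← h.of_cons.openR_chain,
      openR_eq_Rrev (h.of_cons.not_startsBlock (by simp) (by simp))]
  | num (x + 2) :: X, h => rw [chain_num, openR_add_two, lab_add_two, h.of_cons.openR_chain]
  | tr t :: X, h =>
    rw [chain_tr, openR_append t.chain_isW2 (Tr.chain_ne_nil h.2.1 h.2.2.1) _ h.of_cons.isW,
      h.of_cons.openR_chain, lab, Tr.Rrev_chain h.2.1 h.2.2.1]

theorem Valid.R_chain {X : List Item} (h : Valid X) (h0 : X ≠ [])
    (h1 : ∀ X', X ≠ num 1 :: X') : R (chain X) = lab X := by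
  rw [← h.openR_chain, R_eq_Rrev h.isW, openR_eq_Rrev (h.not_startsBlock h0 h1)]

theorem Valid.lab_ne_nil {X : List Item} (h : Valid X) : lab X ≠ [] := by
  rw [← h.openR_chain]; exact openR_ne_nil h.isW

theorem Valid.isW_lab {X : List Item} (h : Valid X) : IsW (lab X) := by
  rw [← h.openR_chain]
  have := isW_Rrev h.isW
  unfold openR
  split_ifs
  · intro x hx
    rcases List.mem_cons.1 hx with rfl | hx
    exacts [le_rfl, this x hx]
  · exact this

/-- The sum of the sizes. -/
def total (s : List Tr) : ℕ := (s.map Tr.size).sum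

@[simp] theorem total_nil : total [] = 0 := rfl
@[simp] theorem total_cons (t : Tr) (s : List Tr) : total (t :: s) = t.size + total s := rfl
@[simp] theorem total_append (s s' : List Tr) : total (s ++ s') = total s + total s' := by
  simp [total]
@[simp] theorem total_replicate_leaf (n : ℕ) : total (List.replicate n Tr.leaf) = n := by
  simp [total, Tr.size]

theorem Valid.length_lab {X : List Item} (h : Valid X) :
    (lab X).length = total (shapes X) + 1 := by
  match X, h with
  | [], h => simp
  | num 0 :: X, h => exact absurd h.2.1 (by omega)
  | num 1 :: X, h => simp [h.of_cons.length_lab, Tr.size]; omega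
  | num (x + 2) :: X, h => simp [h.of_cons.length_lab]; omega
  | tr t :: X, h =>
    obtain ⟨y, q, hy⟩ := List.exists_cons_of_ne_nil h.of_cons.lab_ne_nil
    have := h.of_cons.length_lab
    have h2 := t.length_mid
    rw [lab_tr hy]
    rw [hy] at this
    simp at this ⊢
    omega

end PRes

namespace PRes
open Item

/-! ### Polygons with one interior vertex of positive defect -/

/-- The polygon whose triangles lead from the base edge to a vertex with defect `d`; a letter of the
word tells whether this vertex lies to the left (`false`) or to the right (`true`) of the apex. -/
def path : List Bool → ℕ → Tr
  | [], d => Tr.node Tr.leaf d Tr.leaf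
  | false :: w, d => Tr.node (path w d) 0 Tr.leaf
  | true :: w, d => Tr.node Tr.leaf 0 (path w d)

theorem path_ne_leaf (w : List Bool) (d : ℕ) : path w d ≠ Tr.leaf := by
  rcases w with _ | ⟨_ | _, w⟩ <;> simp [path]

theorem path_good (w : List Bool) {d : ℕ} (hd : 1 ≤ d) : (path w d).Good := by
  induction w with
  | nil => exact ⟨trivial, trivial, fun _ _ => hd⟩
  | cons b w ih =>
    cases b
    · exact ⟨ih, trivial, fun h => absurd h (path_ne_leaf w d)⟩
    · exact ⟨trivial, ih, fun _ h => absurd h (path_ne_leaf w d)⟩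

theorem path_injective {w w' : List Bool} {d d' : ℕ} (h : path w d = path w' d') :
    w = w' ∧ d = d' := by
  induction w generalizing w' with
  | nil =>
    rcases w' with _ | ⟨_ | _, w'⟩
    · simpa [path] using h
    · have := path_ne_leaf w' d'
      simp only [path, Tr.node.injEq] at h
      exact absurd h.1.symm this
    · have := path_ne_leaf w' d'
      simp only [path, Tr.node.injEq] at h
      exact absurd h.2.2.symm this
  | cons b w ih =>
    have h1 := path_ne_leaf w d
    rcases w' with _ | ⟨_ | _, w'⟩ <;> cases b <;> simp only [path, Tr.node.injEq] at h
    · exact absurd h.1 h1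
    · exact absurd h.2.2 h1
    · obtain ⟨rfl, rfl⟩ := ih h.1; exact ⟨rfl, rfl⟩
    · exact absurd h.2.2 h1
    · exact absurd h.1 h1
    · obtain ⟨rfl, rfl⟩ := ih h.2.2; exact ⟨rfl, rfl⟩

theorem path_chain_nil (d : ℕ) :
    (path [] d).chain = alphaRight (alphaLeft (List.replicate d 2)) := by
  simp [path, Tr.chain, Tr.attach]

/-- One letter of the word is one step in the construction of graphs of type T; this is why words
parametrize them. -/
theorem path_chain_false (w : List Bool) {d : ℕ} (hd : 1 ≤ d) :
    (path (false :: w) d).chain = 2 :: alphaLeft (path w d).chain := by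
  have := Tr.chain_ne_nil (path_good w hd) (path_ne_leaf w d)
  simp [path, Tr.chain, this, Tr.attach, alphaLeft_cons]

theorem path_chain_true (w : List Bool) {d : ℕ} (hd : 1 ≤ d) :
    (path (true :: w) d).chain = alphaRight (path w d).chain ++ [2] := by
  have := Tr.chain_ne_nil (path_good w hd) (path_ne_leaf w d)
  simp [path, Tr.chain, this, Tr.attach, alphaRight_append]

/-- The order of the vertices in the plane tree of all words. -/
def wlt : List Bool → List Bool → Prop
  | false :: u, false :: v => wlt u v
  | true :: u, true :: v => wlt u v
  | false :: _, [] => True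
  | false :: _, true :: _ => True
  | [], true :: _ => True
  | _, _ => False

/-- The pair of coprime numbers that belongs to a word in the Stern–Brocot tree. -/
def farey : List Bool → ℕ × ℕ
  | [] => (1, 1)
  | false :: w => ((farey w).1 + (farey w).2, (farey w).2)
  | true :: w => ((farey w).1, (farey w).1 + (farey w).2)

theorem farey_pos (w : List Bool) : 0 < (farey w).1 ∧ 0 < (farey w).2 := by
  induction w with
  | nil => simp [farey]
  | cons b w ih => cases b <;> simp only [farey] <;> omega

/-- The order of the tree is the decreasing order of the quotients q of the two numbers in `farey`.
The letter `false` acts by q ↦ q + 1 and `true` by q ↦ q/(q + 1). Both maps are increasing; the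
first has values > 1, the second values < 1, and the empty word has q = 1. -/
theorem wlt_iff (u v : List Bool) :
    wlt u v ↔ (farey v).1 * (farey u).2 < (farey u).1 * (farey v).2 := by
  induction u generalizing v with
  | nil =>
    have := farey_pos v.tail
    rcases v with _ | ⟨_ | _, v⟩ <;> simp_all [wlt, farey]
  | cons b u ih =>
    have h1 := farey_pos v.tail
    have h2 := farey_pos u
    rcases v with _ | ⟨_ | _, v⟩ <;> cases b <;> simp only [wlt, farey, ih, List.tail_cons] at h1 ⊢
    · simp; omega
    · simp
    · constructor <;> intro h <;> nlinarith
    · simp only [false_iff, not_lt]; nlinarith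
    · simp only [true_iff]; nlinarith
    · constructor <;> intro h <;> nlinarith

theorem wlt_trans {u v w : List Bool} (h1 : wlt u v) (h2 : wlt v w) : wlt u w := by
  rw [wlt_iff] at *
  have hv := farey_pos v
  have hu := farey_pos u
  have hw := farey_pos w
  have e1 := Nat.mul_lt_mul_of_pos_right h1 hw.2
  have e2 := Nat.mul_lt_mul_of_pos_right h2 hu.2
  refine Nat.lt_of_mul_lt_mul_right (a := (farey v).2) ?_
  nlinarith

/-- A sequence of words with positive defects, in increasing order. -/
structure IsRun (q : List (List Bool × ℕ)) : Prop where
  pos : ∀ x ∈ q, 1 ≤ x.2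
  sorted : q.Pairwise (fun x y => wlt x.1 y.1)

namespace Tr

/-- Put a letter in front of each word. -/
def shift (b : Bool) (q : List (List Bool × ℕ)) : List (List Bool × ℕ) :=
  q.map (fun x => (b :: x.1, x.2))

/-- The interior vertices with positive defect, with the words that describe their positions. -/
def flat : Tr → List (List Bool × ℕ)
  | leaf => []
  | node l d r => shift false l.flat ++ (if d = 0 then [] else [([], d)]) ++ shift true r.flat

/-- Descending into the tree one reaches a triangle with two single edges as its sides, and `Good`
gives its apex a positive defect. -/
theorem flat_ne_nil {t : Tr} (h : t.Good) (h0 : t ≠ leaf) : t.flat ≠ [] := by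
  induction t with
  | leaf => exact absurd rfl h0
  | node l d r hl hr =>
    by_cases h1 : l = leaf
    · by_cases h2 : r = leaf
      · have := h.2.2 h1 h2
        simp [flat, show d ≠ 0 by omega]
      · have := hr h.2.1 h2
        simp [flat, shift, this]
    · have := hl h.1 h1
      simp [flat, shift, this]

theorem flat_isRun (t : Tr) : IsRun t.flat := by
  induction t with
  | leaf => exact ⟨by simp [flat], by simp [flat]⟩
  | node l d r hl hr =>
    constructor
    · intro x hx
      simp only [flat, shift, List.mem_append, List.mem_map] at hx
      rcases hx with (⟨y, hy, rfl⟩ | hx) | ⟨y, hy, rfl⟩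
      · exact hl.pos y hy
      · split_ifs at hx
        · simp at hx
        · simp only [List.mem_singleton] at hx
          subst hx
          exact Nat.one_le_iff_ne_zero.2 ‹_›
      · exact hr.pos y hy
    · simp only [flat, shift, List.pairwise_append, List.pairwise_map, List.mem_append,
        List.mem_map]
      refine ⟨⟨?_, ?_, ?_⟩, ?_, ?_⟩
      · simpa [wlt] using hl.sorted
      · split_ifs <;> simp
      · rintro _ ⟨x, -, rfl⟩ y hy
        split_ifs at hy
        · simp at hy
        · simp only [List.mem_singleton] at hy
          subst hy
          trivial
      · simpa [wlt] using hr.sorted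
      · rintro x (⟨x, -, rfl⟩ | hx) _ ⟨y, -, rfl⟩
        · trivial
        · split_ifs at hx
          · simp at hx
          · simp only [List.mem_singleton] at hx
            subst hx
            trivial

/-- The words that begin with the given letter, with this letter removed. -/
def part (b : Bool) (q : List (List Bool × ℕ)) : List (List Bool × ℕ) :=
  q.filterMap (fun x => if x.1.head? = some b then some (x.1.tail, x.2) else none)

theorem part_shift (b : Bool) (q : List (List Bool × ℕ)) : part b (shift b q) = q := by
  simp [part, shift, List.filterMap_map]

theorem part_shift_ne {b c : Bool} (h : b ≠ c) (q : List (List Bool × ℕ)) :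
    part b (shift c q) = [] := by
  simp [part, shift, List.filterMap_map, h.symm]

/-- The sum of the defects at the empty word. -/
def rootPart (q : List (List Bool × ℕ)) : ℕ :=
  (q.map (fun x => if x.1 = [] then x.2 else 0)).sum

theorem rootPart_shift (b : Bool) (q : List (List Bool × ℕ)) : rootPart (shift b q) = 0 := by
  simp [rootPart, shift, Function.comp_def]

/-- The first letters sort the list into the lists of the left side, of the apex and of the right
side. A side without positive defects must be a single edge by `flat_ne_nil`. -/
theorem flat_injective {t t' : Tr} (h : t.Good) (h' : t'.Good) (he : t.flat = t'.flat) :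
    t = t' := by
  induction t generalizing t' with
  | leaf =>
    by_contra h0
    exact flat_ne_nil h' (Ne.symm h0) he.symm
  | node l d r hl hr =>
    cases t' with
    | leaf => exact absurd he (flat_ne_nil h (by simp))
    | node l' d' r' =>
      have append : ∀ b p q, part b (p ++ q) = part b p ++ part b q := by
        intro b p q; simp [part]
      have append' : ∀ p q, rootPart (p ++ q) = rootPart p + rootPart q := by
        intro p q; simp [rootPart]
      have e0 : ∀ b d, part b (if d = 0 then [] else [([], d)]) = [] := by
        intro b d; split_ifs <;> simp [part]
      have e1 : ∀ d, rootPart (if d = 0 then [] else [([], d)]) = d := by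
        intro d; split_ifs <;> simp_all [rootPart]
      have f1 := congrArg (part false) he
      have f2 := congrArg (part true) he
      have f3 := congrArg rootPart he
      simp only [flat, append, append', part_shift, e0, e1, rootPart_shift,
        part_shift_ne (show false ≠ true by simp), part_shift_ne (show true ≠ false by simp),
        List.append_nil, List.nil_append, Nat.add_zero, Nat.zero_add] at f1 f2 f3
      rw [hl h.1 h'.1 f1, hr h.2.1 h'.2.1 f2, f3]

end Tr

open Tr

/-! ### Increasing lists of words come from polygons -/

theorem IsRun.of_cons {x : List Bool × ℕ} {q : List (List Bool × ℕ)} (h : IsRun (x :: q)) :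
    IsRun q :=
  ⟨fun y hy => h.pos y (by simp [hy]), (List.pairwise_cons.1 h.sorted).2⟩

/-- In the order of the tree, words beginning with `false` precede the empty word, which precedes
the words beginning with `true`; the empty word occurs at most once. The value `d = 0` stands for
its absence. -/
theorem IsRun.split {q : List (List Bool × ℕ)} (h : IsRun q) : ∃ q₁ d q₂, IsRun q₁ ∧ IsRun q₂ ∧
    q = shift false q₁ ++ (if d = 0 then [] else [([], d)]) ++ shift true q₂ := by
  induction q with
  | nil => exact ⟨[], 0, [], h, h, by simp [shift]⟩
  | cons x q ih =>
    obtain ⟨q₁, d, q₂, h1, h2, rfl⟩ := ih h.of_cons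
    obtain ⟨hx, -⟩ := List.pairwise_cons.1 h.sorted
    have hpos := h.pos x (by simp)
    -- The new word `x` precedes all others, so any group in which no word can follow `x` is empty.
    have nil : ∀ c, (∀ y ∈ q₁, ¬ wlt c (false :: y.1)) →
        (∀ y ∈ shift false q₁, wlt c y.1) → q₁ = [] := by
      intro c hc hq
      cases q₁ with
      | nil => rfl
      | cons y q₁ => exact absurd (hq (false :: y.1, y.2) (by simp [shift])) (hc y (by simp))
    have nil' : ∀ c, ¬ wlt c [] →
        (∀ y ∈ (if d = 0 then [] else [(([] : List Bool), d)]), wlt c y.1) → d = 0 := by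
      intro c hc hq
      by_contra hd
      exact hc (hq ([], d) (by simp [hd]))
    have hx1 : ∀ y ∈ shift false q₁, wlt x.1 y.1 := fun y hy => hx y (by simp [hy])
    have hx2 : ∀ y ∈ (if d = 0 then [] else [(([] : List Bool), d)]), wlt x.1 y.1 :=
      fun y hy => hx y (by simp only [List.mem_append]; exact Or.inl (Or.inr hy))
    have hx3 : ∀ y ∈ shift true q₂, wlt x.1 y.1 := fun y hy => hx y (by simp [hy])
    obtain ⟨w, e⟩ := x
    rcases w with _ | ⟨_ | _, w⟩
    · obtain rfl := nil _ (by simp [wlt]) hx1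
      obtain rfl := nil' _ (by simp [wlt]) hx2
      refine ⟨[], e, q₂, h1, h2, ?_⟩
      simp at hpos
      simp [shift, show e ≠ 0 by omega]
    · refine ⟨(w, e) :: q₁, d, q₂, ⟨?_, ?_⟩, h2, by simp [shift]⟩
      · intro y hy
        rcases List.mem_cons.1 hy with rfl | hy
        exacts [hpos, h1.pos y hy]
      · refine List.pairwise_cons.2 ⟨fun y hy => ?_, h1.sorted⟩
        exact hx1 (false :: y.1, y.2) (List.mem_map.2 ⟨y, hy, rfl⟩)
    · obtain rfl := nil _ (by simp [wlt]) hx1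
      obtain rfl := nil' _ (by simp [wlt]) hx2
      refine ⟨[], 0, (w, e) :: q₂, h1, ⟨?_, ?_⟩, by simp [shift]⟩
      · intro y hy
        rcases List.mem_cons.1 hy with rfl | hy
        exacts [hpos, h2.pos y hy]
      · refine List.pairwise_cons.2 ⟨fun y hy => ?_, h2.sorted⟩
        exact hx3 (true :: y.1, y.2) (List.mem_map.2 ⟨y, hy, rfl⟩)

theorem IsRun.exists_tr {q : List (List Bool × ℕ)} (h : IsRun q) : ∃ t : Tr, t.Good ∧ t.flat = q := by
  suffices H : ∀ n, ∀ q : List (List Bool × ℕ), IsRun q → (∀ x ∈ q, x.1.length < n) →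
      ∃ t : Tr, t.Good ∧ t.flat = q by
    refine H ((q.map (fun x => x.1.length)).sum + 1) q h fun x hx => ?_
    exact Nat.lt_succ_of_le (List.le_sum_of_mem (List.mem_map.2 ⟨x, hx, rfl⟩))
  intro n
  induction n with
  | zero =>
    intro q _ hq
    cases q with
    | nil => exact ⟨leaf, trivial, rfl⟩
    | cons x q => exact absurd (hq x (by simp)) (by omega)
  | succ n ih =>
    intro q h hq
    obtain ⟨q₁, d, q₂, h1, h2, rfl⟩ := h.split
    obtain ⟨l, hl, rfl⟩ := ih q₁ h1 fun x hx => by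
      have := hq (false :: x.1, x.2) (List.mem_append_left _ (List.mem_append_left _
        (List.mem_map.2 ⟨x, hx, rfl⟩)))
      simpa using this
    obtain ⟨r, hr, rfl⟩ := ih q₂ h2 fun x hx => by
      have := hq (true :: x.1, x.2) (List.mem_append_right _ (List.mem_map.2 ⟨x, hx, rfl⟩))
      simpa using this
    -- An empty list has to give a single edge: a triangle without any positive defect would not be
    -- `Good`.
    by_cases h0 : l = leaf ∧ r = leaf ∧ d = 0
    · obtain ⟨rfl, rfl, rfl⟩ := h0
      exact ⟨leaf, trivial, by simp [flat, shift]⟩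
    · exact ⟨node l d r, ⟨hl, hr, fun e1 e2 => Nat.one_le_iff_ne_zero.2 fun e3 => h0 ⟨e1, e2, e3⟩⟩,
        rfl⟩

/-! ### Blowing down chains -/

/-- Blowing down a `-1`-node between two other nodes of a chain. -/
inductive Blow : List ℕ → List ℕ → Prop
  | mk (u v : List ℕ) (x y : ℕ) : Blow (u ++ (x + 1) :: 1 :: (y + 1) :: v) (u ++ x :: y :: v)

/-- Successive blowing down. -/
abbrev BlowStar : List ℕ → List ℕ → Prop := Relation.ReflTransGen Blow

theorem Blow.append_left (p : List ℕ) {a b : List ℕ} (h : Blow a b) : Blow (p ++ a) (p ++ b) := by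
  obtain ⟨u, v, x, y⟩ := h
  rw [← List.append_assoc, ← List.append_assoc]
  exact Blow.mk (p ++ u) v x y

theorem Blow.append_right (p : List ℕ) {a b : List ℕ} (h : Blow a b) : Blow (a ++ p) (b ++ p) := by
  obtain ⟨u, v, x, y⟩ := h
  simpa using Blow.mk u (v ++ p) x y

theorem Blow.alphaLeft {a b : List ℕ} (h : Blow a b) : Blow (alphaLeft a) (alphaLeft b) := by
  obtain ⟨u, v, x, y⟩ := h
  rw [alphaLeft_append _ (by simp), alphaLeft_append _ (by simp), alphaLeft_cons _ (by simp),
    alphaLeft_cons _ (by simp), alphaLeft_cons x (by simp)]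
  rcases eq_or_ne v [] with rfl | hv
  · exact Blow.mk u [] x (y + 1)
  · rw [alphaLeft_cons _ hv, alphaLeft_cons _ hv]
    exact Blow.mk u (PRes.alphaLeft v) x y

theorem Blow.alphaRight {a b : List ℕ} (h : Blow a b) : Blow (alphaRight a) (alphaRight b) := by
  obtain ⟨u, v, x, y⟩ := h
  cases u with
  | nil => exact Blow.mk [] v (x + 1) y
  | cons z u => exact Blow.mk ((z + 1) :: u) v x y

theorem BlowStar.append_left (p : List ℕ) {a b : List ℕ} (h : BlowStar a b) :
    BlowStar (p ++ a) (p ++ b) :=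
  Relation.ReflTransGen.lift (p ++ ·) (fun _ _ => Blow.append_left p) _ _ h

theorem BlowStar.append_right (p : List ℕ) {a b : List ℕ} (h : BlowStar a b) :
    BlowStar (a ++ p) (b ++ p) :=
  Relation.ReflTransGen.lift (· ++ p) (fun _ _ => Blow.append_right p) _ _ h

theorem BlowStar.append {a b c d : List ℕ} (h : BlowStar a b) (h' : BlowStar c d) :
    BlowStar (a ++ c) (b ++ d) := (h.append_right c).trans (h'.append_left b)

theorem BlowStar.cons (x : ℕ) {a b : List ℕ} (h : BlowStar a b) : BlowStar (x :: a) (x :: b) :=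
  h.append_left [x]

theorem BlowStar.alphaLeft {a b : List ℕ} (h : BlowStar a b) :
    BlowStar (alphaLeft a) (alphaLeft b) :=
  Relation.ReflTransGen.lift PRes.alphaLeft (fun _ _ => Blow.alphaLeft) _ _ h

theorem BlowStar.alphaRight {a b : List ℕ} (h : BlowStar a b) :
    BlowStar (alphaRight a) (alphaRight b) :=
  Relation.ReflTransGen.lift PRes.alphaRight (fun _ _ => Blow.alphaRight) _ _ h

theorem blowStar_alpha {u v : List ℕ} (hu : u ≠ []) (hv : v ≠ []) :
    BlowStar (alphaLeft u ++ 1 :: alphaRight v) (u ++ v) := by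
  obtain ⟨u, x, rfl⟩ := (List.eq_nil_or_concat u).resolve_left hu
  obtain ⟨y, v, rfl⟩ := List.exists_cons_of_ne_nil hv
  rw [List.concat_eq_append, alphaLeft_concat, alphaRight_cons, List.append_assoc,
    List.append_assoc]
  exact .single (Blow.mk u v x y)

/-- The chain of type T graphs for the given words, separated by `-1`-nodes. -/
def run : List (List Bool × ℕ) → List ℕ
  | [] => []
  | [x] => (path x.1 x.2).chain
  | x :: y :: q => (path x.1 x.2).chain ++ 1 :: run (y :: q)

theorem run_cons (x : List Bool × ℕ) {q : List (List Bool × ℕ)} (h : q ≠ []) :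
    run (x :: q) = (path x.1 x.2).chain ++ 1 :: run q := by
  cases q with
  | nil => exact absurd rfl h
  | cons y q => rfl

theorem run_append {p q : List (List Bool × ℕ)} (hp : p ≠ []) (hq : q ≠ []) :
    run (p ++ q) = run p ++ 1 :: run q := by
  induction p with
  | nil => exact absurd rfl hp
  | cons x p ih =>
    rcases eq_or_ne p [] with rfl | h
    · exact run_cons x hq
    · rw [List.cons_append, run_cons x (by simp [h]), run_cons x h, ih h]; simp

theorem run_ne_nil {q : List (List Bool × ℕ)} (hq : IsRun q) (h : q ≠ []) : run q ≠ [] := by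
  obtain ⟨x, q, rfl⟩ := List.exists_cons_of_ne_nil h
  have := Tr.chain_ne_nil (path_good x.1 (hq.pos x (by simp))) (path_ne_leaf x.1 x.2)
  cases q with
  | nil => exact this
  | cons y q => simp [run]

/-- The letter `false` changes each chain `c` into `2 :: alphaLeft c`. Blowing down the -1-node
between two of them cancels the increase on its left and turns the `2` on its right into a new
-1-node. Only the first `2` and the last increase survive. -/
theorem run_shift_false {q : List (List Bool × ℕ)} (hq : IsRun q) (h : q ≠ []) :
    BlowStar (run (shift false q)) (2 :: alphaLeft (run q)) := by
  induction q with
  | nil => exact absurd rfl h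
  | cons x q ih =>
    have hx := hq.pos x (by simp)
    have hc := Tr.chain_ne_nil (path_good x.1 hx) (path_ne_leaf x.1 x.2)
    rcases eq_or_ne q [] with rfl | h0
    · rw [show run (shift false [x]) = 2 :: alphaLeft (run [x]) from path_chain_false x.1 hx]
    · have ih := ih hq.of_cons h0
      have e : run (shift false (x :: q)) =
          (2 :: alphaLeft (path x.1 x.2).chain) ++ 1 :: run (shift false q) := by
        rw [← path_chain_false x.1 hx]
        exact run_cons (false :: x.1, x.2) (by simpa [shift] using h0)
      rw [e, run_cons x h0, alphaLeft_append _ (by simp),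
        alphaLeft_cons _ (run_ne_nil hq.of_cons h0)]
      refine ((ih.cons 1).append_left _).trans ?_
      have := blowStar_alpha hc (v := 1 :: alphaLeft (run q)) (by simp)
      exact this.cons 2

theorem run_shift_true {q : List (List Bool × ℕ)} (hq : IsRun q) (h : q ≠ []) :
    BlowStar (run (shift true q)) (alphaRight (run q) ++ [2]) := by
  induction q with
  | nil => exact absurd rfl h
  | cons x q ih =>
    have hx := hq.pos x (by simp)
    have hc := Tr.chain_ne_nil (path_good x.1 hx) (path_ne_leaf x.1 x.2)
    rcases eq_or_ne q [] with rfl | h0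
    · rw [show run (shift true [x]) = alphaRight (run [x]) ++ [2] from path_chain_true x.1 hx]
    · have ih := ih hq.of_cons h0
      have e : run (shift true (x :: q)) =
          (alphaRight (path x.1 x.2).chain ++ [2]) ++ 1 :: run (shift true q) := by
        rw [← path_chain_true x.1 hx]
        exact run_cons (true :: x.1, x.2) (by simpa [shift] using h0)
      rw [e, run_cons x h0, alphaRight_append hc]
      refine ((ih.cons 1).append_left _).trans ?_
      have := blowStar_alpha (u := alphaRight (path x.1 x.2).chain ++ [1]) (by simp)
        (run_ne_nil hq.of_cons h0)
      rw [alphaLeft_concat] at this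
      simpa using this.append_right [2]

/-- The vertices left and right of the apex of the root triangle form the runs of the two sides with
one more letter, so by induction they blow down to `2 :: alphaLeft l.chain` and `alphaRight (r.chain
++ [2])`. An apex with `d > 0` contributes `2, …, 2` increased at both ends. The -1-nodes between
these up to three pieces then cancel the increases next to them (`blowStar_alpha`). -/
theorem run_flat {t : Tr} (h : t.Good) (h0 : t ≠ leaf) : BlowStar (run t.flat) t.chain := by
  induction t with
  | leaf => exact absurd rfl h0
  | node l d r hl hr =>
    have hL : l ≠ leaf → BlowStar (run (shift false l.flat)) (2 :: alphaLeft l.chain) := fun h1 =>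
      (run_shift_false l.flat_isRun (flat_ne_nil h.1 h1)).trans (((hl h.1 h1).alphaLeft).cons 2)
    have hR : r ≠ leaf → BlowStar (run (shift true r.flat)) (alphaRight (r.chain ++ [2])) := by
      intro h1
      rw [alphaRight_append (chain_ne_nil h.2.1 h1)]
      exact (run_shift_true r.flat_isRun (flat_ne_nil h.2.1 h1)).trans
        (((hr h.2.1 h1).alphaRight).append_right [2])
    have nL : l ≠ leaf → shift false l.flat ≠ [] := fun h1 => by
      simpa [shift] using flat_ne_nil h.1 h1
    have nR : r ≠ leaf → shift true r.flat ≠ [] := fun h1 => by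
      simpa [shift] using flat_ne_nil h.2.1 h1
    have root : run [([], d)] = alphaRight (alphaLeft (List.replicate d 2)) := path_chain_nil d
    rw [flat, Tr.chain]
    rcases eq_or_ne l leaf with rfl | h1 <;> rcases eq_or_ne r leaf with rfl | h2
    · have hd := h.2.2 rfl rfl
      rw [if_neg (show d ≠ 0 by omega)]
      simp only [flat, shift, List.map_nil, List.nil_append, List.append_nil, chain_leaf, if_true,
        attach, root]
      rfl
    · have hc := chain_ne_nil h.2.1 h2
      simp only [flat, chain_leaf, if_true, attach, if_neg hc]
      rw [show shift false [] = [] from rfl, List.nil_append]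
      rcases Nat.eq_zero_or_pos d with rfl | hd
      · simpa using hR h2
      · rw [if_neg (show d ≠ 0 by omega), run_append (by simp) (nR h2), root, alphaRight_alphaLeft,
          List.append_assoc, alphaRight_append (a := List.replicate d 2) (by simp; omega)]
        exact (((hR h2).cons 1).append_left _).trans (blowStar_alpha (by simp; omega) (by simp))
    · have hc := chain_ne_nil h.1 h1
      simp only [flat, chain_leaf, if_true, attach, if_neg hc]
      rw [show shift true [] = [] from rfl, List.append_nil]
      rcases Nat.eq_zero_or_pos d with rfl | hd
      · simpa [alphaLeft_cons _ hc] using hL h1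
      · rw [if_neg (show d ≠ 0 by omega), run_append (nL h1) (by simp), root,
          alphaLeft_cons _ (by simp [hc]), alphaLeft_append _ (by simp; omega)]
        have := (blowStar_alpha hc (v := alphaLeft (List.replicate d 2))
          (by simp; omega)).cons 2
        exact ((hL h1).append_right _).trans this
    · have hc := chain_ne_nil h.1 h1
      have hc' := chain_ne_nil h.2.1 h2
      simp only [attach, if_neg hc, if_neg hc']
      rcases Nat.eq_zero_or_pos d with rfl | hd
      · rw [if_pos rfl, List.append_nil, run_append (nL h1) (nR h2)]
        refine ((hL h1).append ((hR h2).cons 1)).trans ?_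
        simpa using (blowStar_alpha hc (v := r.chain ++ [2]) (by simp)).cons 2
      · rw [if_neg (show d ≠ 0 by omega), run_append (by simp) (nR h2),
          run_append (nL h1) (by simp), root, List.append_assoc]
        refine ((hL h1).append ((((hR h2).cons 1).append_left _).cons 1)).trans ?_
        rw [alphaRight_alphaLeft]
        have e1 := blowStar_alpha (u := alphaRight (List.replicate d 2)) (v := r.chain ++ [2])
          (by simp; omega) (by simp)
        refine ((e1.cons 1).append_left _).trans ?_
        rw [← alphaRight_append (by simp; omega)]
        simpa using (blowStar_alpha hc (v := List.replicate d 2 ++ (r.chain ++ [2]))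
          (by simp)).cons 2

end PRes

namespace PRes
open Item Tr

/-! ### Replacing polygons by sequences of polygons with one interior vertex of positive defect -/

/-- The polygons for the given words, separated by entries `1`. -/
def interl : List (List Bool × ℕ) → List Item
  | [] => []
  | [x] => [tr (path x.1 x.2)]
  | x :: y :: q => tr (path x.1 x.2) :: num 1 :: interl (y :: q)

theorem interl_cons (x : List Bool × ℕ) {q : List (List Bool × ℕ)} (h : q ≠ []) :
    interl (x :: q) = tr (path x.1 x.2) :: num 1 :: interl q := by
  cases q with
  | nil => exact absurd rfl h
  | cons y q => rfl

theorem exists_interl_cons (x : List Bool × ℕ) (q : List (List Bool × ℕ)) :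
    ∃ Z, interl (x :: q) = tr (path x.1 x.2) :: Z := by
  cases q with
  | nil => exact ⟨_, rfl⟩
  | cons y q => exact ⟨_, rfl⟩

theorem chain_interl (q : List (List Bool × ℕ)) : chain (interl q) = run q := by
  induction q with
  | nil => rfl
  | cons x q ih =>
    rcases eq_or_ne q [] with rfl | h
    · simp [interl, run]
    · rw [interl_cons x h, run_cons x h, chain_tr, chain_num, ih]

theorem interl_append {p q : List (List Bool × ℕ)} (hp : p ≠ []) (hq : q ≠ []) :
    interl (p ++ q) = interl p ++ num 1 :: interl q := by
  induction p with
  | nil => exact absurd rfl hp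
  | cons x p ih =>
    rcases eq_or_ne p [] with rfl | h
    · exact interl_cons x hq
    · rw [List.cons_append, interl_cons x (by simp [h]), interl_cons x h, ih h]; simp

/-- Replace each polygon by polygons with one interior vertex of positive defect. -/
def expand (X : List Item) : List Item :=
  X.flatMap fun i => match i with
    | num x => [num x]
    | tr t => interl t.flat

@[simp] theorem expand_nil : expand [] = [] := rfl
@[simp] theorem expand_num (x : ℕ) (X : List Item) : expand (num x :: X) = num x :: expand X := rfl
@[simp] theorem expand_tr (t : Tr) (X : List Item) :
    expand (tr t :: X) = interl t.flat ++ expand X := rfl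
@[simp] theorem expand_append (X Y : List Item) : expand (X ++ Y) = expand X ++ expand Y := by
  simp [expand]

/-- The item is a polygon. -/
def Item.IsTr : Item → Prop
  | num _ => False
  | tr _ => True

/-- The item is an entry at least two, or a polygon with at least one triangle. -/
def Item.Ok : Item → Prop
  | num x => 2 ≤ x
  | tr t => t.Good ∧ t ≠ leaf

/-- The sequences of items that describe labelled subdivisions with labels at least two. -/
structure IsCode (X : List Item) : Prop where
  ok : ∀ i ∈ X, i.Ok
  compat : X.IsChain fun i j => ¬ (i.IsTr ∧ j.IsTr)

theorem IsCode.of_cons {i : Item} {X : List Item} (h : IsCode (i :: X)) : IsCode X :=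
  ⟨fun j hj => h.ok j (by simp [hj]), h.compat.tail⟩

theorem isCode_nil : IsCode [] := ⟨by simp, by simp⟩

theorem IsCode.cons_num {x : ℕ} {X : List Item} (hx : 2 ≤ x) (h : IsCode X) :
    IsCode (num x :: X) := by
  refine ⟨fun j hj => ?_, List.isChain_cons.2 ⟨fun y _ h => h.1, h.compat⟩⟩
  rcases List.mem_cons.1 hj with rfl | hj
  exacts [hx, h.ok j hj]

theorem IsCode.cons_tr {t : Tr} {X : List Item} (ht : t.Good) (h0 : t ≠ leaf) (h : IsCode X)
    (hX : ∀ t' X', X ≠ tr t' :: X') : IsCode (tr t :: X) := by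
  refine ⟨fun j hj => ?_, List.isChain_cons.2 ⟨?_, h.compat⟩⟩
  · rcases List.mem_cons.1 hj with rfl | hj
    exacts [⟨ht, h0⟩, h.ok j hj]
  · rintro y hy ⟨-, h2⟩
    obtain ⟨X', rfl⟩ := List.head?_eq_some_iff.1 hy
    cases y with
    | num x => exact h2
    | tr t' => exact hX t' X' rfl

theorem IsCode.ne_tr {t : Tr} {X : List Item} (h : IsCode (tr t :: X)) : ∀ t' X', X ≠ tr t' :: X' := by
  rintro t' X' rfl
  exact (List.isChain_cons.1 h.compat).1 (tr t') (by simp) ⟨trivial, trivial⟩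

theorem IsCode.ne_one {X : List Item} (h : IsCode X) : ∀ X', X ≠ num 1 :: X' := by
  rintro X' rfl
  exact absurd (h.ok (num 1) (by simp)) (by simp [Item.Ok])

theorem IsCode.valid {X : List Item} (h : IsCode X) : Valid X := by
  induction X with
  | nil => trivial
  | cons i X ih =>
    have hX := ih h.of_cons
    cases i with
    | num x =>
      have hx : 2 ≤ x := h.ok (num x) (by simp)
      exact ⟨hX, by omega, by omega, h.of_cons.ne_one⟩
    | tr t =>
      have ht := h.ok (tr t) (by simp)
      exact ⟨hX, ht.1, ht.2, h.ne_tr⟩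

theorem IsCode.isW2_chain {X : List Item} (h : IsCode X) : IsW2 (chain X) := by
  induction X with
  | nil => intro x hx; simp at hx
  | cons i X ih =>
    cases i with
    | num x => exact IsW2.cons (h.ok (num x) (by simp)) (ih h.of_cons)
    | tr t => exact t.chain_isW2.append (ih h.of_cons)

theorem Valid.chain_ne_nil {X : List Item} (h : Valid X) (h0 : X ≠ []) : chain X ≠ [] := by
  match X, h with
  | [], h => exact absurd rfl h0
  | num x :: X, h => simp
  | tr t :: X, h => simp [Tr.chain_ne_nil h.2.1 h.2.2.1]

theorem IsCode.expand_head {X : List Item} (h : IsCode X) :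
    (∀ X', expand X ≠ num 1 :: X') ∧
      ((∀ t' X', X ≠ tr t' :: X') → ∀ t' X', expand X ≠ tr t' :: X') := by
  cases X with
  | nil => simp
  | cons i X =>
    cases i with
    | num x =>
      have := h.ok (num x) (by simp)
      simp only [Item.Ok] at this
      constructor
      · intro X' he
        simp at he; omega
      · intro _ t' X' he
        simp at he
    | tr t =>
      have ht := h.ok (tr t) (by simp)
      obtain ⟨x, q, hq⟩ := List.exists_cons_of_ne_nil (flat_ne_nil ht.1 ht.2)
      obtain ⟨Z, hZ⟩ := exists_interl_cons x q
      rw [expand_tr, hq, hZ]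
      exact ⟨by simp, fun h => absurd rfl (h t X)⟩

theorem valid_interl_append {q : List (List Bool × ℕ)} (hq : ∀ x ∈ q, 1 ≤ x.2) {Z : List Item}
    (hZ : Valid Z) (h1 : ∀ t' X', Z ≠ tr t' :: X') : Valid (interl q ++ Z) := by
  induction q with
  | nil => exact hZ
  | cons x q ih =>
    have hx := path_good x.1 (hq x (by simp))
    have ih := ih fun y hy => hq y (by simp [hy])
    rcases eq_or_ne q [] with rfl | h
    · exact ⟨hZ, hx, path_ne_leaf _ _, h1⟩
    · obtain ⟨y, q, rfl⟩ := List.exists_cons_of_ne_nil h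
      obtain ⟨Z', hZ'⟩ := exists_interl_cons y q
      rw [interl_cons x h]
      refine ⟨⟨ih, le_rfl, fun _ => ?_, fun X' => ?_⟩, hx, path_ne_leaf _ _, by simp⟩
      · rw [hZ']; exact ⟨_, _, rfl⟩
      · rw [hZ']; simp

theorem IsCode.valid_expand {X : List Item} (h : IsCode X) : Valid (expand X) := by
  induction X with
  | nil => trivial
  | cons i X ih =>
    have hX := ih h.of_cons
    have hh := h.of_cons.expand_head
    cases i with
    | num x =>
      have hx : 2 ≤ x := h.ok (num x) (by simp)
      exact ⟨hX, by omega, by omega, hh.1⟩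
    | tr t => exact valid_interl_append t.flat_isRun.pos hX (hh.2 h.ne_tr)

theorem IsCode.blowStar {X : List Item} (h : IsCode X) : BlowStar (chain (expand X)) (chain X) := by
  induction X with
  | nil => exact .refl
  | cons i X ih =>
    have hX := ih h.of_cons
    cases i with
    | num x => exact hX.cons x
    | tr t =>
      have ht := h.ok (tr t) (by simp)
      rw [expand_tr, chain_append, chain_interl, chain_tr]
      exact (run_flat ht.1 ht.2).append hX

/-- The end of a run is visible: within the run an entry `1` follows each polygon, after the run
none does. -/
theorem interl_append_injective {q q' : List (List Bool × ℕ)} {Z Z' : List Item}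
    (h : q ≠ []) (h' : q' ≠ []) (hZ : ∀ X', Z ≠ num 1 :: X') (hZ' : ∀ X', Z' ≠ num 1 :: X')
    (he : interl q ++ Z = interl q' ++ Z') : q = q' ∧ Z = Z' := by
  induction q generalizing q' with
  | nil => exact absurd rfl h
  | cons x q ih =>
    obtain ⟨x', q', rfl⟩ := List.exists_cons_of_ne_nil h'
    have hx : x = x' := by
      obtain ⟨W, hW⟩ := exists_interl_cons x q
      obtain ⟨W', hW'⟩ := exists_interl_cons x' q'
      rw [hW, hW'] at he
      simp only [List.cons_append, List.cons.injEq, Item.tr.injEq] at he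
      obtain ⟨h1, h2⟩ := path_injective he.1
      exact Prod.ext h1 h2
    subst hx
    rcases eq_or_ne q [] with rfl | h0 <;> rcases eq_or_ne q' [] with rfl | h0'
    · simpa [interl] using he
    · rw [interl_cons x h0'] at he
      simp only [interl, List.cons_append, List.nil_append, List.cons.injEq, true_and] at he
      exact absurd he (hZ _)
    · rw [interl_cons x h0] at he
      simp only [interl, List.cons_append, List.nil_append, List.cons.injEq, true_and] at he
      exact absurd he.symm (hZ' _)
    · rw [interl_cons x h0, interl_cons x h0'] at he
      simp only [List.cons_append, List.cons.injEq, true_and] at he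
      obtain ⟨rfl, rfl⟩ := ih h0 h0' he
      exact ⟨rfl, rfl⟩

theorem IsCode.expand_injective {X Y : List Item} (hX : IsCode X) (hY : IsCode Y)
    (h : expand X = expand Y) : X = Y := by
  induction X generalizing Y with
  | nil =>
    cases Y with
    | nil => rfl
    | cons i Y =>
      cases i with
      | num x => simp at h
      | tr t =>
        have ht := hY.ok (tr t) (by simp)
        obtain ⟨x, q, hq⟩ := List.exists_cons_of_ne_nil (flat_ne_nil ht.1 ht.2)
        obtain ⟨Z, hZ⟩ := exists_interl_cons x q
        rw [expand_tr, hq, hZ] at h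
        simp at h
  | cons i X ih =>
    have tree : ∀ {t : Tr} {X : List Item}, IsCode (tr t :: X) →
        ∃ t' Z, expand (tr t :: X) = tr t' :: Z := by
      intro t X h
      have ht := h.ok (tr t) (by simp)
      obtain ⟨x, q, hq⟩ := List.exists_cons_of_ne_nil (flat_ne_nil ht.1 ht.2)
      obtain ⟨Z, hZ⟩ := exists_interl_cons x q
      rw [expand_tr, hq, hZ]
      exact ⟨_, _, rfl⟩
    cases i with
    | num x =>
      match Y, hY with
      | [], _ => simp at h
      | num y :: Y, hY =>
        simp only [expand_num, List.cons.injEq, Item.num.injEq] at h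
        rw [h.1, ih hX.of_cons hY.of_cons h.2]
      | tr t :: Y, hY =>
        obtain ⟨t', Z, hZ⟩ := tree hY
        rw [hZ] at h
        simp at h
    | tr t =>
      match Y, hY with
      | [], _ =>
        obtain ⟨t', Z, hZ⟩ := tree hX
        rw [hZ] at h
        simp at h
      | num y :: Y, hY =>
        obtain ⟨t', Z, hZ⟩ := tree hX
        rw [hZ] at h
        simp at h
      | tr t' :: Y, hY =>
        have ht := hX.ok (tr t) (by simp)
        have ht' := hY.ok (tr t') (by simp)
        obtain ⟨h1, h2⟩ := interl_append_injective (flat_ne_nil ht.1 ht.2)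
          (flat_ne_nil ht'.1 ht'.2) hX.of_cons.expand_head.1 hY.of_cons.expand_head.1 h
        rw [flat_injective ht.1 ht'.1 h1, ih hX.of_cons hY.of_cons h2]

/-- All polygons have one interior vertex of positive defect, and polygons that are separated by
an entry `1` are in increasing order. -/
def PItems : List Item → Prop
  | [] => True
  | num _ :: X => PItems X
  | tr t :: X => PItems X ∧ ∃ w d, 1 ≤ d ∧ t = path w d ∧
      ∀ w' d' X', X = num 1 :: tr (path w' d') :: X' → wlt w w'

theorem PItems.of_cons {i : Item} {X : List Item} (h : PItems (i :: X)) : PItems X := by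
  cases i with
  | num x => exact h
  | tr t => exact h.1

theorem IsRun.pItems {q : List (List Bool × ℕ)} (hq : IsRun q) {Z : List Item} (hZ : PItems Z)
    (h1 : ∀ X', Z ≠ num 1 :: X') : PItems (interl q ++ Z) := by
  induction q with
  | nil => exact hZ
  | cons x q ih =>
    rcases eq_or_ne q [] with rfl | h
    · exact ⟨hZ, x.1, x.2, hq.pos x (by simp), rfl, fun _ _ _ h => absurd h (h1 _)⟩
    · obtain ⟨y, q, rfl⟩ := List.exists_cons_of_ne_nil h
      obtain ⟨Z', hZ'⟩ := exists_interl_cons y q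
      rw [interl_cons x h]
      refine ⟨ih hq.of_cons, x.1, x.2, hq.pos x (by simp), rfl, ?_⟩
      intro w' d' X' he
      change num 1 :: (interl (y :: q) ++ Z) = _ at he
      rw [hZ'] at he
      simp only [List.cons_append, List.cons.injEq, Item.tr.injEq, true_and] at he
      rw [← (path_injective he.1).1]
      exact (List.pairwise_cons.1 hq.sorted).1 y (by simp)

theorem IsCode.pItems_expand {X : List Item} (h : IsCode X) : PItems (expand X) := by
  induction X with
  | nil => trivial
  | cons i X ih =>
    cases i with
    | num x => exact ih h.of_cons
    | tr t => exact t.flat_isRun.pItems (ih h.of_cons) h.of_cons.expand_head.1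

theorem isRun_singleton (w : List Bool) {d : ℕ} (hd : 1 ≤ d) : IsRun [(w, d)] :=
  ⟨by simpa using hd, by simp⟩

theorem IsRun.cons {w : List Bool} {d : ℕ} (hd : 1 ≤ d) {y : List Bool × ℕ}
    {q : List (List Bool × ℕ)} (h : IsRun (y :: q)) (hw : wlt w y.1) : IsRun ((w, d) :: y :: q) := by
  refine ⟨fun x hx => ?_, List.pairwise_cons.2 ⟨fun x hx => ?_, h.sorted⟩⟩
  · rcases List.mem_cons.1 hx with rfl | hx
    exacts [hd, h.pos x hx]
  · rcases List.mem_cons.1 hx with rfl | hx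
    exacts [hw, wlt_trans hw ((List.pairwise_cons.1 h.sorted).1 x hx)]

theorem IsRun.exists_tr' {q : List (List Bool × ℕ)} (h : IsRun q) (h0 : q ≠ []) :
    ∃ t : Tr, t.Good ∧ t ≠ leaf ∧ t.flat = q := by
  obtain ⟨t, ht, rfl⟩ := h.exists_tr
  exact ⟨t, ht, by rintro rfl; exact h0 rfl, rfl⟩

/-- A maximal sequence of polygons separated by entries `1` has increasing neighbouring words. By
transitivity of `wlt` it is an `IsRun`, hence the list of one polygon, which takes its place in the
code. -/
theorem exists_code : ∀ {Z : List Item}, Valid Z → PItems Z → (∀ X', Z ≠ num 1 :: X') →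
    ∃ X, IsCode X ∧ expand X = Z
  | [], _, _, _ => ⟨[], isCode_nil, rfl⟩
  | num x :: Z, hv, hp, h1 => by
    obtain ⟨X, hX, rfl⟩ := exists_code hv.of_cons hp.of_cons hv.2.2.2
    have : x ≠ 1 := by rintro rfl; exact h1 _ rfl
    exact ⟨num x :: X, hX.cons_num (by have := hv.2.1; omega), rfl⟩
  | tr t :: [], hv, hp, _ => by
    obtain ⟨w, d, hd, rfl, -⟩ := hp.2
    obtain ⟨s, hs, hs0, he⟩ := (isRun_singleton w hd).exists_tr' (by simp)
    exact ⟨[tr s], isCode_nil.cons_tr hs hs0 (by simp), by simp [he, interl]⟩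
  | tr t :: tr t' :: Z, hv, _, _ => absurd rfl (hv.2.2.2 t' Z)
  | tr t :: num x :: Z, hv, hp, _ => by
    obtain ⟨w, d, hd, rfl, hlt⟩ := hp.2
    by_cases hx : x = 1
    · subst hx
      obtain ⟨t', Z', rfl⟩ := hv.1.2.2.1 rfl
      -- What follows the entry `1` comes from a code that begins with a polygon `s`. The new word
      -- precedes the first word of `s`, so it is put in front of the list of `s`.
      obtain ⟨X, hX, he⟩ := exists_code hv.1.1 hp.1.of_cons (by simp)
      match X, hX with
      | [], _ => simp at he
      | num x :: X, _ => simp at he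
      | tr s :: X, hX =>
        have hs := hX.ok (tr s) (by simp)
        obtain ⟨y, q, hq⟩ := List.exists_cons_of_ne_nil (flat_ne_nil hs.1 hs.2)
        obtain ⟨W, hW⟩ := exists_interl_cons y q
        have hr := s.flat_isRun
        rw [hq] at hr
        rw [← he, expand_tr, hq, hW] at hlt
        obtain ⟨s', hs', hs0', he'⟩ := (hr.cons hd (hlt y.1 y.2 _ rfl)).exists_tr' (by simp)
        refine ⟨tr s' :: X, hX.of_cons.cons_tr hs' hs0' hX.ne_tr, ?_⟩
        rw [← he, expand_tr, expand_tr, he', hq]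
        rfl
    · obtain ⟨X, hX, he⟩ := exists_code hv.1 hp.1 (by simpa using hx)
      obtain ⟨s, hs, hs0, he'⟩ := (isRun_singleton w hd).exists_tr' (by simp)
      refine ⟨tr s :: X, hX.cons_tr hs hs0 ?_, by simp [he, he', interl]⟩
      rintro t' X' rfl
      have ht' := hX.ok (tr t') (by simp)
      obtain ⟨y, q, hq⟩ := List.exists_cons_of_ne_nil (flat_ne_nil ht'.1 ht'.2)
      obtain ⟨W, hW⟩ := exists_interl_cons y q
      rw [expand_tr, hq, hW] at he
      simp at he

/-! ### Reflection -/

/-- The sequence of items for the reflected chain. -/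
def mirror (X : List Item) : List Item := (X.map Item.mirror).reverse

@[simp] theorem mirror_nil : mirror [] = [] := rfl
theorem mirror_cons (i : Item) (X : List Item) : mirror (i :: X) = mirror X ++ [i.mirror] := by
  simp [mirror]
theorem mirror_append (X Y : List Item) : mirror (X ++ Y) = mirror Y ++ mirror X := by
  simp [mirror]

theorem IsCode.mirror {X : List Item} (h : IsCode X) : IsCode (mirror X) := by
  constructor
  · intro i hi
    simp only [PRes.mirror, List.mem_reverse, List.mem_map] at hi
    obtain ⟨j, hj, rfl⟩ := hi
    have := h.ok j hj
    cases j with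
    | num x => exact this
    | tr t => exact ⟨this.1.mirror, fun h => this.2 (mirror_eq_leaf.1 h)⟩
  · rw [PRes.mirror, List.isChain_reverse, List.isChain_map]
    refine h.compat.imp ?_
    intro i j hij
    cases i <;> cases j <;> simp_all [Item.IsTr, Item.mirror]

theorem Valid.chain_mirror {X : List Item} (h : Valid X) :
    chain (mirror X) = (chain X).reverse := by
  induction X with
  | nil => rfl
  | cons i X ih =>
    rw [mirror_cons, chain_append, ih h.of_cons]
    cases i with
    | num x => simp [Item.mirror]
    | tr t => simp [Item.mirror, Tr.chain_mirror h.2.1]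

theorem shapes_mirror (X : List Item) :
    shapes (mirror X) = ((shapes X).map Tr.mirror).reverse := by
  induction X with
  | nil => rfl
  | cons i X ih =>
    rw [mirror_cons, shapes_append, ih]
    match i with
    | num 0 => simp [Item.mirror, shapes, Item.shapes]
    | num 1 => simp [Item.mirror, shapes, Item.shapes, Tr.mirror]
    | num (x + 2) => simp [Item.mirror, shapes, Item.shapes, Tr.mirror]
    | tr t => simp [Item.mirror, mirror_strip]

/-- The word of the reflected vertex. -/
def flip (x : List Bool × ℕ) : List Bool × ℕ := (x.1.map not, x.2)

theorem path_mirror (w : List Bool) (d : ℕ) : (path w d).mirror = path (w.map not) d := by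
  induction w with
  | nil => rfl
  | cons b w ih => cases b <;> simp [path, Tr.mirror, ih]

theorem flat_mirror (t : Tr) : t.mirror.flat = (t.flat.map flip).reverse := by
  induction t with
  | leaf => rfl
  | node l d r hl hr =>
    simp only [Tr.mirror, flat, hl, hr, shift]
    split_ifs <;> simp [flip, Function.comp_def]

theorem interl_flip (q : List (List Bool × ℕ)) :
    interl (q.map flip).reverse = mirror (interl q) := by
  induction q with
  | nil => rfl
  | cons x q ih =>
    rcases eq_or_ne q [] with rfl | h
    · simp [interl, mirror, Item.mirror, path_mirror, flip]
    · rw [List.map_cons, List.reverse_cons, interl_append (by simpa using h) (by simp), ih,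
        interl_cons x h, mirror_cons, mirror_cons]
      simp [interl, Item.mirror, path_mirror, flip]

theorem expand_mirror (X : List Item) : expand (mirror X) = mirror (expand X) := by
  induction X with
  | nil => rfl
  | cons i X ih =>
    rw [mirror_cons, expand_append, ih]
    cases i with
    | num x => simp [Item.mirror, mirror_cons]
    | tr t => simp [Item.mirror, flat_mirror, interl_flip, mirror_append]

theorem IsCode.R_chain {X : List Item} (h : IsCode X) (h0 : X ≠ []) : R (chain X) = lab X :=
  h.valid.R_chain h0 h.ne_one

theorem IsCode.expand_ne_nil {X : List Item} (h : IsCode X) (h0 : X ≠ []) : expand X ≠ [] :=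
  fun he => h0 (h.expand_injective isCode_nil he)

theorem IsCode.R_chain_expand {X : List Item} (h : IsCode X) (h0 : X ≠ []) :
    R (chain (expand X)) = lab (expand X) :=
  h.valid_expand.R_chain (h.expand_ne_nil h0) h.expand_head.1

/-- `lab` is built from one end and its symmetry is hidden; it is inherited from that of `R` through
`R_chain`. -/
theorem IsCode.lab_mirror {X : List Item} (h : IsCode X) (h0 : X ≠ []) :
    lab (PRes.mirror X) = (lab X).reverse := by
  rw [← h.R_chain h0, ← h.mirror.R_chain (by simpa [PRes.mirror] using h0), h.valid.chain_mirror,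
    R_reverse h.valid.isW]

theorem IsCode.lab_expand_mirror {X : List Item} (h : IsCode X) (h0 : X ≠ []) :
    lab (expand (PRes.mirror X)) = (lab (expand X)).reverse := by
  rw [← h.R_chain_expand h0, ← h.mirror.R_chain_expand (by simpa [PRes.mirror] using h0),
    expand_mirror, h.valid_expand.chain_mirror, R_reverse h.valid_expand.isW]

/-! ### Blowing down graphs -/

theorem WGraph.Iso.refl (G : WGraph) : G.Iso G := ⟨SimpleGraph.Iso.refl, fun _ => rfl⟩

theorem WGraph.Iso.trans {G H K : WGraph} (h : G.Iso H) (h' : H.Iso K) : G.Iso K := by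
  obtain ⟨e, he⟩ := h
  obtain ⟨f, hf⟩ := h'
  exact ⟨e.trans f, fun x => (hf (e x)).trans (he x)⟩

theorem WGraph.BlowsDownTo.trans_iso {G H K : WGraph} (h : G.BlowsDownTo H) (h' : H.Iso K) :
    G.BlowsDownTo K := by
  obtain ⟨L, hL, hi⟩ := h
  exact ⟨L, hL, hi.trans h'⟩

theorem gam_iso {a b : List ℕ} (e : Fin a.length ≃ Fin b.length)
    (h : ∀ i j, (SimpleGraph.pathGraph b.length).Adj (e i) (e j) ↔
      (SimpleGraph.pathGraph a.length).Adj i j)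
    (hw : ∀ i, b.get (e i) = a.get i) : (Gam a).Iso (Gam b) :=
  ⟨⟨e, h _ _⟩, fun i => congrArg (fun n : ℕ => -(n : ℤ)) (hw i)⟩

theorem gam_reverse (a : List ℕ) : (Gam a).Iso (Gam a.reverse) := by
  have hl : a.reverse.length = a.length := by simp
  refine gam_iso (Fin.revPerm.trans (finCongr hl.symm)) ?_ ?_
  · intro i j
    rw [SimpleGraph.pathGraph_adj, SimpleGraph.pathGraph_adj]
    simp [Fin.rev]
    omega
  · intro i
    simp [Fin.rev]
    congr 1
    omega

open Classical in
theorem gam_step (u v : List ℕ) (x y : ℕ) :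
    WGraph.Step (Gam (u ++ (x + 1) :: 1 :: (y + 1) :: v)) (Gam (u ++ x :: y :: v)) := by
  set a := u ++ (x + 1) :: 1 :: (y + 1) :: v with ha
  set b := u ++ x :: y :: v with hb
  have hla : a.length = u.length + v.length + 3 := by simp [ha]; omega
  have hlb : b.length = u.length + v.length + 2 := by simp [hb]; omega
  let p : Fin a.length := ⟨u.length + 1, by omega⟩
  have hp : a.get p = 1 := by simp [p, ha]
  -- Positions before the removed node are kept, those after it move down by one.
  let e : {i : Fin a.length // i ≠ p} ≃ Fin b.length :=
    { toFun := fun i => if h : i.1.1 < u.length + 1 then ⟨i.1.1, by omega⟩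
        else ⟨i.1.1 - 1, by have := i.1.2; omega⟩
      invFun := fun j => if h : j.1 < u.length + 1 then ⟨⟨j.1, by omega⟩, by
          intro h'; rw [Fin.ext_iff] at h'; simp [p] at h'; omega⟩
        else ⟨⟨j.1 + 1, by have := j.2; omega⟩, by
          intro h'; rw [Fin.ext_iff] at h'; simp [p] at h'; omega⟩
      left_inv := by
        intro i
        have hi : i.1.1 ≠ u.length + 1 := fun h => i.2 (Fin.ext h)
        apply Subtype.ext
        apply Fin.ext
        by_cases h : i.1.1 < u.length + 1
        · simp [h]
        · simp [h, show ¬ i.1.1 - 1 < u.length + 1 by omega]; omega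
      right_inv := by
        intro j
        apply Fin.ext
        by_cases h : j.1 < u.length + 1
        · simp [h]
        · simp [h, show ¬ j.1 + 1 < u.length + 1 by omega] }
  have e1 : ∀ i, i.1.1 < u.length + 1 → (e i).1 = i.1.1 := by
    intro i h; exact congrArg Fin.val (dif_pos h)
  have e2 : ∀ i, ¬ i.1.1 < u.length + 1 → (e i).1 = i.1.1 - 1 := by
    intro i h; exact congrArg Fin.val (dif_neg h)
  have hadj : ∀ i j : {i : Fin a.length // i ≠ p},
      (SimpleGraph.pathGraph b.length).Adj (e i) (e j) ↔ i ≠ j ∧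
      ((SimpleGraph.pathGraph a.length).Adj i.1 j.1 ∨
        ((SimpleGraph.pathGraph a.length).Adj i.1 p ∧
          (SimpleGraph.pathGraph a.length).Adj j.1 p)) := by
    intro i j
    have hi : i.1.1 ≠ u.length + 1 := fun h => i.2 (Fin.ext h)
    have hj : j.1.1 ≠ u.length + 1 := fun h => j.2 (Fin.ext h)
    simp only [SimpleGraph.pathGraph_adj]
    have hij : i ≠ j ↔ i.1.1 ≠ j.1.1 := by
      rw [Ne, Subtype.ext_iff, Fin.ext_iff]
    rw [hij]
    have hpv : p.1 = u.length + 1 := rfl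
    rw [hpv]
    by_cases h1 : i.1.1 < u.length + 1 <;> by_cases h2 : j.1.1 < u.length + 1 <;>
      simp only [e1, e2, h1, h2, not_false_eq_true] <;> omega
  have hwt : ∀ i : {i : Fin a.length // i ≠ p}, -((b.get (e i) : ℕ) : ℤ) =
      -((a.get i.1 : ℕ) : ℤ) + if (SimpleGraph.pathGraph a.length).Adj i.1 p then 1 else 0 := by
    intro i
    have hi : i.1.1 ≠ u.length + 1 := fun h => i.2 (Fin.ext h)
    simp only [SimpleGraph.pathGraph_adj, List.get_eq_getElem]
    have hpv : p.1 = u.length + 1 := rfl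
    rw [hpv]
    have hi2 := i.1.2
    rcases lt_trichotomy i.1.1 u.length with h | h | h
    · simp only [e1 i (by omega)]
      rw [if_neg (by omega)]
      simp [ha, hb, List.getElem_append_left h]
    · simp only [e1 i (by omega)]
      rw [if_pos (by omega)]
      simp [ha, hb, h]
    · simp only [e2 i (by omega)]
      obtain ⟨k, hk⟩ := Nat.exists_eq_add_of_lt h
      -- The value `k = 0` would be the removed node itself. The right neighbour `y + 1` is at `m =
      -- 0`.
      obtain ⟨m, rfl⟩ : ∃ m, k = m + 1 := ⟨k - 1, by omega⟩
      have ha' : a[i.1.1] = ((x + 1) :: 1 :: (y + 1) :: v)[i.1.1 - u.length]'(by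
          simp; omega) := by
        simp only [ha]
        rw [List.getElem_append_right (by omega)]
      have hm : i.1.1 - u.length = m + 2 := by omega
      simp only [hm] at ha'
      rw [ha']
      cases m with
      | zero =>
        rw [if_pos (by omega)]
        simp [hb, hk]
      | succ m =>
        rw [if_neg (by omega)]
        simp [hb, hk]
  exact ⟨p, by change -((a.get p : ℕ) : ℤ) = -1; rw [hp]; rfl, ⟨e, hadj _ _⟩, hwt⟩

theorem BlowStar.blowsDownTo {a b : List ℕ} (h : BlowStar a b) :
    (Gam a).BlowsDownTo (Gam b) := by
  refine ⟨Gam b, ?_, WGraph.Iso.refl _⟩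
  refine Relation.ReflTransGen.lift Gam ?_ _ _ h
  rintro _ _ ⟨u, v, x, y⟩
  exact gam_step u v x y

/-- Excludes the empty chain as a P-resolution. All other information about P-resolutions comes from
the singularities and from ampleness. -/
theorem eq_nil_of_blowsDownTo {c : List ℕ} (h : (Gam []).BlowsDownTo (Gam c)) : c = [] := by
  obtain ⟨K, hK, e, -⟩ := h
  have hK' : K = Gam [] := by
    clear e
    induction hK with
    | refl => rfl
    | tail _ hs ih =>
      subst ih
      obtain ⟨v, -⟩ := hs
      exact Fin.elim0 v
  subst hK'
  by_contra hc
  exact Fin.elim0 (e.symm ⟨0, List.length_pos_iff.2 hc⟩)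

end PRes

namespace PRes
open Item Tr

/-! ### The triangles of a triangulated polygon -/

/-- The triangles of a polygon with vertices `i, i + 1, …`. -/
def Tr.tri : Tr → ℕ → Finset (Finset ℕ)
  | leaf, _ => ∅
  | node l _ r, i => insert {i, i + l.size, i + (l.size + r.size)} (l.tri i ∪ r.tri (i + l.size))

/-- The triangles of a polygon with vertices `0, p, p + 1, …` that is cut by the diagonals from `0`
into polygons over the edges opposite to `0`. -/
def fan : ℕ → List Tr → Finset (Finset ℕ)
  | _, [] => ∅
  | p, t :: s => insert {0, p, p + t.size} (t.tri p ∪ fan (p + t.size) s)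

theorem tri_strip (t : Tr) (i : ℕ) : t.strip.tri i = t.tri i := by
  induction t generalizing i with
  | leaf => rfl
  | node l d r hl hr => simp [strip, tri, hl, hr]

theorem tri_bounds {t : Tr} {i : ℕ} {T : Finset ℕ} (h : T ∈ t.tri i) :
    ∃ a b c, i ≤ a ∧ a < b ∧ b < c ∧ c ≤ i + t.size ∧ T = {a, b, c} := by
  induction t generalizing i with
  | leaf => simp [tri] at h
  | node l d r hl hr =>
    have h1 := l.size_pos
    have h2 := r.size_pos
    simp only [tri, Finset.mem_insert, Finset.mem_union] at h
    simp only [size]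
    rcases h with rfl | h | h
    · exact ⟨_, _, _, le_rfl, by omega, by omega, le_rfl, rfl⟩
    · obtain ⟨a, b, c, h3, h4, h5, h6, rfl⟩ := hl h
      exact ⟨a, b, c, h3, h4, h5, by omega, rfl⟩
    · obtain ⟨a, b, c, h3, h4, h5, h6, rfl⟩ := hr h
      exact ⟨a, b, c, by omega, h4, h5, by omega, rfl⟩

theorem fan_bounds {s : List Tr} {p : ℕ} {T : Finset ℕ} (hp : 1 ≤ p) (h : T ∈ fan p s) :
    ∃ a b c, a < b ∧ b < c ∧ (a = 0 ∧ p ≤ b ∨ p ≤ a) ∧ c ≤ p + total s ∧ T = {a, b, c} := by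
  induction s generalizing p with
  | nil => simp [fan] at h
  | cons t s ih =>
    have h1 := t.size_pos
    simp only [fan, Finset.mem_insert, Finset.mem_union] at h
    simp only [total_cons]
    rcases h with rfl | h | h
    · exact ⟨_, _, _, by omega, by omega, by omega, by omega, rfl⟩
    · obtain ⟨a, b, c, h3, h4, h5, h6, rfl⟩ := tri_bounds h
      exact ⟨a, b, c, by omega, by omega, by omega, by omega, rfl⟩
    · obtain ⟨a, b, c, h3, h4, h5, h6, rfl⟩ := ih (by omega) h
      exact ⟨a, b, c, by omega, by omega, by omega, by omega, rfl⟩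

theorem tri_isSubdivision (t : Tr) (i : ℕ) :
    IsSubdivision (Finset.Icc i (i + t.size)) (t.tri i) := by
  induction t generalizing i with
  | leaf =>
    have : Finset.Icc i (i + 1) = {i, i + 1} := by ext x; simp; omega
    rw [size, this]
    exact .digon i (i + 1) (by omega)
  | node l d r hl hr =>
    have h1 := l.size_pos
    have h2 := r.size_pos
    have e : Finset.Icc i (i + (l.size + r.size)) =
        Finset.Icc i (i + l.size) ∪ Finset.Icc (i + l.size) (i + l.size + r.size) := by
      ext x; simp; omega
    rw [size, tri, e]
    refine .glue _ _ _ _ _ _ _ (hl i) (hr (i + l.size)) ?_ ?_ ?_ ?_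
    · simpa [IsLeast, lowerBounds] using fun _ h _ => h
    · simp [IsGreatest, upperBounds]
    · simpa [IsLeast, lowerBounds] using fun _ h _ => h
    · constructor
      · simp; omega
      · intro x; simp; omega

theorem IsSubdivision.lt {α : Type*} [LinearOrder α] {V : Finset α} {Δ : Finset (Finset α)}
    (h : IsSubdivision V Δ) {x z : α} (hx : IsLeast (V : Set α) x)
    (hz : IsGreatest (V : Set α) z) : x < z := by
  induction h generalizing x z with
  | digon a b hab =>
    have h1 := hx.2 (show a ∈ (({a, b} : Finset α) : Set α) by simp)
    have h2 := hz.2 (show b ∈ (({a, b} : Finset α) : Set α) by simp)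
    exact h1.trans_lt (hab.trans_le h2)
  | glue V₁ V₂ Δ₁ Δ₂ a b c h₁ h₂ ha hb₁ hb₂ hc ih₁ ih₂ =>
    have h1 := hx.2 (show a ∈ ((V₁ ∪ V₂ : Finset α) : Set α) by simp; exact Or.inl ha.1)
    have h2 := hz.2 (show c ∈ ((V₁ ∪ V₂ : Finset α) : Set α) by simp; exact Or.inr hc.1)
    exact (h1.trans_lt (ih₁ ha hb₁)).trans ((ih₂ hb₂ hc).trans_le h2)

/-- The middle vertex `y` of the triangle on the base edge cuts the interval of vertices into two
intervals, so both parts are again of the form required for the induction. -/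
theorem IsSubdivision.exists_tr {V : Finset ℕ} {Δ : Finset (Finset ℕ)} (h : IsSubdivision V Δ)
    {i j : ℕ} (hV : V = Finset.Icc i j) (hij : i ≤ j) :
    ∃ t : Tr, t.strip = t ∧ i + t.size = j ∧ Δ = t.tri i := by
  induction h generalizing i j with
  | digon x y h =>
    have e : ∀ z, z ∈ ({x, y} : Finset ℕ) ↔ z ∈ Finset.Icc i j := fun z => by rw [hV]
    simp only [Finset.mem_insert, Finset.mem_singleton, Finset.mem_Icc] at e
    have h1 := e x
    have h2 := e y
    have h3 := e i
    have h4 := e j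
    have h5 := e (i + 1)
    exact ⟨leaf, rfl, by rw [size]; omega, rfl⟩
  | glue V₁ V₂ Δ₁ Δ₂ x y z h₁ h₂ hx hy₁ hy₂ hz ih₁ ih₂ =>
    have e : ∀ w, w ∈ V₁ ∨ w ∈ V₂ ↔ i ≤ w ∧ w ≤ j := fun w => by
      rw [← Finset.mem_union, hV, Finset.mem_Icc]
    have b1 : ∀ w ∈ V₁, x ≤ w ∧ w ≤ y := fun w hw => ⟨hx.2 hw, hy₁.2 hw⟩
    have b2 : ∀ w ∈ V₂, y ≤ w ∧ w ≤ z := fun w hw => ⟨hy₂.2 hw, hz.2 hw⟩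
    have hxy := h₁.lt hx hy₁
    have hyz := h₂.lt hy₂ hz
    have ex := (e x).1 (Or.inl hx.1)
    have ez := (e z).1 (Or.inr hz.1)
    have ei : x = i := by
      rcases (e i).2 ⟨le_rfl, hij⟩ with h | h
      · have := b1 i h; omega
      · have := b2 i h; omega
    have ej : z = j := by
      rcases (e j).2 ⟨hij, le_rfl⟩ with h | h
      · have := b1 j h; omega
      · have := b2 j h; omega
    subst ei ej
    obtain ⟨l, hl, hl1, hl2⟩ := ih₁ (i := x) (j := y) (by
      ext w
      rw [Finset.mem_Icc]
      refine ⟨b1 w, fun hw => ?_⟩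
      rcases (e w).2 (by omega) with h | h
      · exact h
      · have := b2 w h
        rw [show w = y by omega]; exact hy₁.1) hxy.le
    obtain ⟨r, hr, hr1, hr2⟩ := ih₂ (i := y) (j := z) (by
      ext w
      rw [Finset.mem_Icc]
      refine ⟨b2 w, fun hw => ?_⟩
      rcases (e w).2 (by omega) with h | h
      · have := b1 w h
        rw [show w = y by omega]; exact hy₂.1
      · exact h) hyz.le
    refine ⟨node l 0 r, by rw [strip, hl, hr], by rw [size]; omega, ?_⟩
    rw [tri, hl2, hr2, hl1, show x + (l.size + r.size) = z by omega]

/-- The polygon with all vertices, from the polygons over the edges opposite to `0`. -/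
def whole (s : List Tr) : Tr := s.foldl (fun a t => node a 0 t) leaf

theorem whole_concat (s : List Tr) (t : Tr) : whole (s ++ [t]) = node (whole s) 0 t := by
  simp [whole]

theorem size_whole (s : List Tr) : (whole s).size = total s + 1 := by
  induction s using List.reverseRecOn with
  | nil => rfl
  | append_singleton s t ih => rw [whole_concat, size, ih]; simp; omega

theorem fan_append (p : ℕ) (s s' : List Tr) :
    fan p (s ++ s') = fan p s ∪ fan (p + total s) s' := by
  induction s generalizing p with
  | nil => simp [fan]
  | cons t s ih => simp [fan, ih, Nat.add_assoc]

/-- The base edge joins `0` to the last vertex. Its triangle cuts off the polygon over the last edge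
opposite to `0`; what remains has again a base edge at `0`. -/
theorem tri_whole (s : List Tr) : (whole s).tri 0 = fan 1 s := by
  induction s using List.reverseRecOn with
  | nil => rfl
  | append_singleton s t ih =>
    rw [whole_concat, tri, ih, fan_append, size_whole]
    simp only [Nat.zero_add, fan, Finset.union_empty, Nat.add_comm 1, Nat.add_assoc]
    rw [Finset.union_insert]

theorem strip_whole (s : List Tr) : (whole s).strip = whole (s.map strip) := by
  induction s using List.reverseRecOn with
  | nil => rfl
  | append_singleton s t ih =>
    rw [whole_concat, strip, ih, List.map_append, List.map_singleton, whole_concat]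

theorem whole_injective {s s' : List Tr} (h : whole s = whole s') : s = s' := by
  induction s using List.reverseRecOn generalizing s' with
  | nil =>
    rcases List.eq_nil_or_concat s' with rfl | ⟨s', t, rfl⟩
    · rfl
    · rw [List.concat_eq_append, whole_concat] at h
      simp [whole] at h
  | append_singleton s t ih =>
    rcases List.eq_nil_or_concat s' with rfl | ⟨s', t', rfl⟩
    · rw [whole_concat] at h
      simp [whole] at h
    · rw [List.concat_eq_append, whole_concat, whole_concat] at h
      simp only [node.injEq, true_and] at h
      rw [ih h.1, h.2, List.concat_eq_append]

theorem exists_whole (t : Tr) (h : t.strip = t) : ∃ s : List Tr, s.map strip = s ∧ whole s = t := by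
  induction t with
  | leaf => exact ⟨[], rfl, rfl⟩
  | node l d r hl hr =>
    simp only [strip, node.injEq] at h
    obtain ⟨s, hs, rfl⟩ := hl h.1
    exact ⟨s ++ [r], by simp [hs, h.2.2], by rw [whole_concat, ← h.2.1]⟩

theorem fan_isSubdivision (s : List Tr) :
    IsSubdivision (Finset.range (total s + 2)) (fan 1 s) := by
  have := tri_isSubdivision (whole s) 0
  rw [tri_whole, size_whole] at this
  convert this using 1
  ext x; simp; omega

theorem IsSubdivision.exists_fan {k : ℕ} {Δ : Finset (Finset ℕ)}
    (h : IsSubdivision (Finset.range (k + 2)) Δ) :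
    ∃ s : List Tr, s.map strip = s ∧ total s = k ∧ Δ = fan 1 s := by
  obtain ⟨t, h1, h2, rfl⟩ := h.exists_tr (i := 0) (j := k + 1) (by ext x; simp; omega) (by omega)
  obtain ⟨s, hs, rfl⟩ := exists_whole t h1
  rw [size_whole] at h2
  exact ⟨s, hs, by omega, tri_whole s⟩

/-- The root triangle is the only one that contains both ends of the base edge, which determines its
apex. The remaining triangles belong to the left or to the right side according to whether their
smallest vertex lies before the apex. -/
theorem tri_injective {t t' : Tr} {i : ℕ} (hs : t.size = t'.size) (h : t.tri i = t'.tri i) :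
    t.strip = t'.strip := by
  induction t generalizing t' i with
  | leaf =>
    cases t' with
    | leaf => rfl
    | node l d r => have := l.size_pos; have := r.size_pos; simp only [size] at hs; omega
  | node l d r hl hr =>
    cases t' with
    | leaf => have := l.size_pos; have := r.size_pos; simp only [size] at hs; omega
    | node l' d' r' =>
      have p1 := l.size_pos
      have p2 := r.size_pos
      have p3 := l'.size_pos
      have p4 := r'.size_pos
      simp only [size] at hs
      have e := fun T => Finset.ext_iff.1 h T
      simp only [tri, Finset.mem_insert, Finset.mem_union] at e
      have hsz : l.size = l'.size := by
        have h1 := (e _).1 (Or.inl rfl)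
        rcases h1 with h1 | h1 | h1
        · have h2 := Finset.ext_iff.1 h1 (i + l.size)
          simp at h2; omega
        · obtain ⟨a, b, c, g1, g2, g3, g4, g5⟩ := tri_bounds h1
          have h2 := Finset.ext_iff.1 g5 (i + (l.size + r.size))
          simp at h2; omega
        · obtain ⟨a, b, c, g1, g2, g3, g4, g5⟩ := tri_bounds h1
          have h2 := Finset.ext_iff.1 g5 i
          simp at h2; omega
      have sep : ∀ {q q' : Tr} {T : Finset ℕ}, q.size = l.size → T ∈ q.tri i →
          T ∉ q'.tri (i + l.size) := by
        intro q q' T h0 h1 h2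
        obtain ⟨a, b, c, g1, g2, g3, g4, rfl⟩ := tri_bounds h1
        obtain ⟨a', b', c', f1, f2, f3, f4, f5⟩ := tri_bounds h2
        have g6 := Finset.ext_iff.1 f5 a
        simp at g6
        omega
      have hroot : ∀ {q : Tr}, q.size = l.size →
          ({i, i + l.size, i + (l.size + r.size)} : Finset ℕ) ∉ q.tri i := by
        intro q hq h1
        obtain ⟨a, b, c, g1, g2, g3, g4, g5⟩ := tri_bounds h1
        have g7 := Finset.ext_iff.1 g5 (i + (l.size + r.size))
        simp at g7; omega
      have hroot' : ∀ {q : Tr},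
          ({i, i + l.size, i + (l.size + r.size)} : Finset ℕ) ∉ q.tri (i + l.size) := by
        intro q h1
        obtain ⟨a, b, c, g1, g2, g3, g4, g5⟩ := tri_bounds h1
        have g7 := Finset.ext_iff.1 g5 i
        simp at g7; omega
      rw [← hsz, show l.size + r'.size = l.size + r.size by omega] at e
      rw [strip, strip, hl (t' := l') (i := i) hsz, hr (t' := r') (i := i + l.size) (by omega)]
      · ext T
        constructor
        · intro hT
          rcases (e T).1 (Or.inr (Or.inr hT)) with rfl | h1 | h1
          · exact absurd hT hroot'
          · exact absurd hT (sep hsz.symm h1)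
          · exact h1
        · intro hT
          rcases (e T).2 (Or.inr (Or.inr hT)) with rfl | h1 | h1
          · exact absurd hT hroot'
          · exact absurd hT (sep rfl h1)
          · exact h1
      · ext T
        constructor
        · intro hT
          rcases (e T).1 (Or.inr (Or.inl hT)) with rfl | h1 | h1
          · exact absurd hT (hroot rfl)
          · exact h1
          · exact absurd h1 (sep rfl hT)
        · intro hT
          rcases (e T).2 (Or.inr (Or.inl hT)) with rfl | h1 | h1
          · exact absurd hT (hroot hsz.symm)
          · exact h1
          · exact absurd h1 (sep hsz.symm hT)

theorem fan_injective {s s' : List Tr} (hs : s.map strip = s) (hs' : s'.map strip = s')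
    (ht : total s = total s') (h : fan 1 s = fan 1 s') : s = s' := by
  rw [← tri_whole, ← tri_whole] at h
  have := tri_injective (by rw [size_whole, size_whole, ht]) h
  rw [strip_whole, strip_whole, hs, hs'] at this
  exact whole_injective this

/-! ### Counting triangles -/

theorem card_filter_tri_node (l r : Tr) (d i : ℕ) (P : Finset ℕ → Prop) [DecidablePred P] :
    (((node l d r).tri i).filter P).card =
      (if P {i, i + l.size, i + (l.size + r.size)} then 1 else 0) +
        (((l.tri i).filter P).card + ((r.tri (i + l.size)).filter P).card) := by
  have p1 := l.size_pos
  have p2 := r.size_pos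
  have hd : Disjoint (l.tri i) (r.tri (i + l.size)) := by
    rw [Finset.disjoint_left]
    intro T h1 h2
    obtain ⟨a, b, c, g1, g2, g3, g4, rfl⟩ := tri_bounds h1
    obtain ⟨a', b', c', f1, f2, f3, f4, f5⟩ := tri_bounds h2
    have g6 := Finset.ext_iff.1 f5 a
    simp at g6
    omega
  have h0 : ({i, i + l.size, i + (l.size + r.size)} : Finset ℕ) ∉ l.tri i ∪ r.tri (i + l.size) := by
    rw [Finset.mem_union]
    rintro (h | h)
    · obtain ⟨a, b, c, g1, g2, g3, g4, g5⟩ := tri_bounds h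
      have g7 := Finset.ext_iff.1 g5 (i + (l.size + r.size))
      simp at g7; omega
    · obtain ⟨a, b, c, g1, g2, g3, g4, g5⟩ := tri_bounds h
      have g7 := Finset.ext_iff.1 g5 i
      simp at g7; omega
  rw [tri, Finset.filter_insert, Finset.filter_union]
  have hc := Finset.card_union_of_disjoint (Finset.disjoint_filter_filter hd (p := P) (q := P))
  split_ifs with hP
  · rw [Finset.card_insert_of_notMem, hc]
    · omega
    · rw [← Finset.filter_union]
      exact fun h => h0 (Finset.mem_filter.1 h).1
  · rw [hc]; omega

theorem card_filter_fan_cons (p : ℕ) (hp : 1 ≤ p) (t : Tr) (s : List Tr) (P : Finset ℕ → Prop)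
    [DecidablePred P] :
    ((fan p (t :: s)).filter P).card = (if P {0, p, p + t.size} then 1 else 0) +
        (((t.tri p).filter P).card + ((fan (p + t.size) s).filter P).card) := by
  have p1 := t.size_pos
  have hd : Disjoint (t.tri p) (fan (p + t.size) s) := by
    rw [Finset.disjoint_left]
    intro T h1 h2
    obtain ⟨a, b, c, g1, g2, g3, g4, rfl⟩ := tri_bounds h1
    obtain ⟨a', b', c', f1, f2, f3, f4, f5⟩ := fan_bounds (by omega) h2
    have g6 := Finset.ext_iff.1 f5 a
    have g7 := Finset.ext_iff.1 f5 b
    simp at g6 g7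
    omega
  have h0 : ({0, p, p + t.size} : Finset ℕ) ∉ t.tri p ∪ fan (p + t.size) s := by
    rw [Finset.mem_union]
    rintro (h | h)
    · obtain ⟨a, b, c, g1, g2, g3, g4, g5⟩ := tri_bounds h
      have g7 := Finset.ext_iff.1 g5 0
      simp at g7; omega
    · obtain ⟨a, b, c, g1, g2, g3, g4, g5⟩ := fan_bounds (by omega) h
      have g7 := Finset.ext_iff.1 g5 p
      simp at g7; omega
  rw [fan, Finset.filter_insert, Finset.filter_union]
  have hc := Finset.card_union_of_disjoint (Finset.disjoint_filter_filter hd (p := P) (q := P))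
  split_ifs with hP
  · rw [Finset.card_insert_of_notMem, hc]
    · omega
    · rw [← Finset.filter_union]
      exact fun h => h0 (Finset.mem_filter.1 h).1
  · rw [hc]; omega

/-- The entry of a sequence at the position `v`, where positions start with `i`. -/
def entry (i : ℕ) (L : List ℕ) (v : ℕ) : ℕ := if i ≤ v then L.getD (v - i) 0 else 0

@[simp] theorem entry_nil (i v : ℕ) : entry i [] v = 0 := by simp [entry]

theorem entry_cons (i x : ℕ) (L : List ℕ) (v : ℕ) :
    entry i (x :: L) v = (if v = i then x else 0) + entry (i + 1) L v := by
  unfold entry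
  rcases lt_trichotomy v i with h | rfl | h
  · rw [if_neg (by omega), if_neg (by omega), if_neg (by omega)]
  · simp
  · obtain ⟨k, rfl⟩ := Nat.exists_eq_add_of_lt h
    rw [if_pos (by omega), if_neg (by omega), if_pos (by omega),
      show i + k + 1 - i = k + 1 by omega, show i + k + 1 - (i + 1) = k by omega]
    simp

theorem entry_append (i : ℕ) (L M : List ℕ) (v : ℕ) :
    entry i (L ++ M) v = entry i L v + entry (i + L.length) M v := by
  induction L generalizing i with
  | nil => simp
  | cons x L ih =>
    rw [List.cons_append, entry_cons, entry_cons, ih, List.length_cons, Nat.add_assoc,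
      Nat.add_assoc, Nat.add_comm 1]

theorem entry_of_lt {i v : ℕ} (L : List ℕ) (h : v < i) : entry i L v = 0 := if_neg (by omega)

theorem entry_of_ge {i v : ℕ} (L : List ℕ) (h : i + L.length ≤ v) : entry i L v = 0 := by
  unfold entry
  split_ifs with h1
  · exact List.getD_eq_default _ _ (by omega)
  · rfl

theorem entry_alphaRight (i : ℕ) {L : List ℕ} (h : L ≠ []) (v : ℕ) :
    entry i (alphaRight L) v = (if v = i then 1 else 0) + entry i L v := by
  obtain ⟨x, L, rfl⟩ := List.exists_cons_of_ne_nil h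
  rw [alphaRight_cons, entry_cons, entry_cons]
  split_ifs <;> omega

/-- The labels of all vertices. -/
def Tr.full (t : Tr) : List ℕ := t.first :: t.mid ++ [t.last]

theorem length_full (t : Tr) : t.full.length = t.size + 1 := by
  have := t.length_mid
  simp [full]; omega

theorem entry_full (t : Tr) (i v : ℕ) : entry i t.full v = (if v = i then t.first else 0) +
    entry (i + 1) t.mid v + (if v = i + t.size then t.last else 0) := by
  have := t.length_mid
  rw [full, List.cons_append, entry_cons, entry_append, entry_cons, entry_nil,
    show i + 1 + t.mid.length = i + t.size by omega]
  omega

/-- As `entry` vanishes outside its list, labels of glued polygons are sums: the root triangle adds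
one at each of its vertices, and the apex also receives its defect. -/
theorem entry_full_node (l r : Tr) (d i v : ℕ) : entry i (node l d r).full v =
    entry i l.full v + entry (i + l.size) r.full v + ((if v = i then 1 else 0) +
      (if v = i + l.size then 1 + d else 0) + if v = i + (l.size + r.size) then 1 else 0) := by
  have h1 := l.length_mid
  have p1 := l.size_pos
  have p2 := r.size_pos
  rw [entry_full, entry_full, entry_full, mid, entry_append, entry_cons, first, last, size,
    show i + 1 + l.mid.length = i + l.size by omega, ← Nat.add_assoc i l.size]
  split_ifs <;> omega

/-- With all defects removed, the label of a vertex is just the number of triangles at it. -/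
theorem card_filter_tri (t : Tr) (i v : ℕ) :
    ((t.tri i).filter (v ∈ ·)).card = entry i t.strip.full v := by
  induction t generalizing i with
  | leaf => simp [tri, strip, full, mid, first, last, entry_cons]
  | node l d r hl hr =>
    have p1 := l.size_pos
    have p2 := r.size_pos
    rw [card_filter_tri_node, strip, entry_full_node, hl, hr, size_strip, size_strip]
    simp only [Finset.mem_insert, Finset.mem_singleton]
    split_ifs <;> omega

theorem card_filter_fan_cons_mem (p : ℕ) (hp : 1 ≤ p) (t : Tr) (s : List Tr) (v : ℕ) (hv : 1 ≤ v) :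
    ((fan p (t :: s)).filter (v ∈ ·)).card = (if v = p then 1 else 0) +
      (if v = p + t.size then 1 else 0) + entry p t.strip.full v +
        ((fan (p + t.size) s).filter (v ∈ ·)).card := by
  have p1 := t.size_pos
  rw [card_filter_fan_cons p hp, card_filter_tri]
  simp only [Finset.mem_insert, Finset.mem_singleton]
  split_ifs <;> omega

end PRes

namespace PRes
open Item Tr

/-! ### Isomorphisms of triangulated polygons -/

/-- The number of triangles with vertices `x` and `y`. -/
def pairs {α : Type*} [DecidableEq α] (Δ : Finset (Finset α)) (x y : α) : ℕ :=
  (Δ.filter (fun T => x ∈ T ∧ y ∈ T)).card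

theorem pairs_comm {α : Type*} [DecidableEq α] (Δ : Finset (Finset α)) (x y : α) :
    pairs Δ x y = pairs Δ y x := by
  unfold pairs
  simp only [and_comm]

/-- Only the sides of a triangulated polygon belong to an odd number of triangles; for a polygon
with two vertices, the two sides coincide. -/
theorem even_pairs (t : Tr) (i : ℕ) {x y : ℕ} (hxy : x < y) : (pairs (t.tri i) x y +
    (if i ≤ x ∧ y = x + 1 ∧ y ≤ i + t.size then 1 else 0) +
      if x = i ∧ y = i + t.size then 1 else 0) % 2 = 0 := by
  unfold pairs
  induction t generalizing i with
  | leaf =>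
    rw [show leaf.size = 1 from rfl, tri, Finset.filter_empty, Finset.card_empty]
    split_ifs <;> omega
  | node l d r hl hr =>
    have p1 := l.size_pos
    have p2 := r.size_pos
    rw [card_filter_tri_node]
    have h1 := hl i
    have h2 := hr (i + l.size)
    rw [show (node l d r).size = l.size + r.size from rfl]
    simp only [Finset.mem_insert, Finset.mem_singleton]
    generalize (Finset.filter (fun T => x ∈ T ∧ y ∈ T) (l.tri i)).card = m at *
    generalize (Finset.filter (fun T => x ∈ T ∧ y ∈ T) (r.tri (i + l.size))).card = n at *
    -- The short sides of the two parts together are those of the whole polygon, while the base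
    -- edges of the parts occur once more in the root triangle and cancel modulo two.
    have e1 : (if i ≤ x ∧ y = x + 1 ∧ y ≤ i + l.size then 1 else 0) +
        (if i + l.size ≤ x ∧ y = x + 1 ∧ y ≤ i + l.size + r.size then 1 else 0) =
        if i ≤ x ∧ y = x + 1 ∧ y ≤ i + (l.size + r.size) then 1 else 0 := by
      split_ifs <;> omega
    have e2 : (if (x = i ∨ x = i + l.size ∨ x = i + (l.size + r.size)) ∧
        (y = i ∨ y = i + l.size ∨ y = i + (l.size + r.size)) then 1 else 0) =
        (if x = i ∧ y = i + l.size then 1 else 0) +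
        (if x = i + l.size ∧ y = i + l.size + r.size then 1 else 0) +
          if x = i ∧ y = i + (l.size + r.size) then 1 else 0 := by
      split_ifs <;> omega
    rw [← e1, e2]
    omega

theorem pairs_mod_two {t : Tr} {k x y : ℕ} (ht : t.size = k) (hk : 2 ≤ k) (hxy : x < y)
    (hy : y ≤ k) : pairs (t.tri 0) x y % 2 = 1 ↔ y = x + 1 ∨ (x = 0 ∧ y = k) := by
  have := even_pairs t 0 hxy
  rw [ht] at this
  split_ifs at this <;> omega

theorem injOn_image {α β : Type*} [DecidableEq β] {f : α → β} {V : Finset α}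
    (hf : Set.InjOn f V) : Set.InjOn (fun t : Finset α => t.image f) {t | t ⊆ V} := by
  intro s hs t ht hst
  change s.image f = t.image f at hst
  ext x
  constructor
  · intro hx
    have : f x ∈ t.image f := by
      have h : f x ∈ s.image f := Finset.mem_image_of_mem f hx
      exact hst ▸ h
    obtain ⟨y, hy, hxy⟩ := Finset.mem_image.1 this
    rwa [← hf (ht hy) (hs hx) hxy]
  · intro hx
    have : f x ∈ s.image f := by
      have h : f x ∈ t.image f := Finset.mem_image_of_mem f hx
      exact hst ▸ h
    obtain ⟨y, hy, hxy⟩ := Finset.mem_image.1 this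
    rwa [← hf (hs hy) (ht hx) hxy]

theorem mem_image_iff {α β : Type*} [DecidableEq β] {f : α → β} {V t : Finset α}
    (hf : Set.InjOn f V) (ht : t ⊆ V) {x : α} (hx : x ∈ V) : f x ∈ t.image f ↔ x ∈ t := by
  constructor
  · intro h
    obtain ⟨y, hy, hxy⟩ := Finset.mem_image.1 h
    rwa [← hf (ht hy) hx hxy]
  · exact Finset.mem_image_of_mem f

theorem card_filter_image {α β : Type*} [DecidableEq β] {f : α → β} {V : Finset α}
    {Δ : Finset (Finset α)} (hf : Set.InjOn f V) (hΔ : ∀ t ∈ Δ, t ⊆ V)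
    (P : Finset β → Prop) [DecidablePred P] (Q : Finset α → Prop) [DecidablePred Q]
    (h : ∀ t ∈ Δ, P (t.image f) ↔ Q t) :
    ((Δ.image (fun t => t.image f)).filter P).card = (Δ.filter Q).card := by
  rw [Finset.filter_image, Finset.card_image_of_injOn]
  · congr 1
    exact Finset.filter_congr h
  · intro s hs t ht hst
    exact injOn_image hf (hΔ s (Finset.mem_filter.1 hs).1) (hΔ t (Finset.mem_filter.1 ht).1) hst

theorem pairs_image {α β : Type*} [DecidableEq α] [DecidableEq β] {f : α → β} {V : Finset α}
    {Δ : Finset (Finset α)} (hf : Set.InjOn f V) (hΔ : ∀ t ∈ Δ, t ⊆ V) {x y : α} (hx : x ∈ V)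
    (hy : y ∈ V) : pairs (Δ.image (fun t => t.image f)) (f x) (f y) = pairs Δ x y :=
  card_filter_image hf hΔ _ _ fun t ht => by
    rw [mem_image_iff hf (hΔ t ht) hx, mem_image_iff hf (hΔ t ht) hy]

/-- The sides are the pairs in an odd number of triangles, and this number is preserved by `f`. So
`f` maps neighbours on the boundary to neighbours. As it fixes `0`, the vertex `1` goes to `1` or to
`k`, and by injectivity each further vertex has only one possible image. -/
theorem eq_id_or_reverse {k : ℕ} {t t' : Tr} (ht : t.size = k) (ht' : t'.size = k) {f : ℕ → ℕ}
    (hf : Set.InjOn f (Finset.range (k + 1) : Finset ℕ)) (hfm : ∀ i ≤ k, f i ≤ k) (h0 : f 0 = 0)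
    (h : t'.tri 0 = (t.tri 0).image (fun T => T.image f)) :
    (∀ i, 1 ≤ i → i ≤ k → f i = i) ∨ ∀ i, 1 ≤ i → i ≤ k → f i = k + 1 - i := by
  have inj : ∀ i j, i ≤ k → j ≤ k → f i = f j → i = j := fun i j hi hj e =>
    hf (by simp; omega) (by simp; omega) e
  -- For `k = 1` there are no triangles and the two sides coincide; here injectivity alone fixes `f
  -- 1`.
  rcases Nat.lt_or_ge k 2 with hk | hk
  · refine Or.inl fun i h1 h2 => ?_
    have := hfm i h2
    have := inj i 0 h2 (by omega)
    omega
  have hsub : ∀ T ∈ t.tri 0, T ⊆ Finset.range (k + 1) := by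
    intro T hT
    obtain ⟨a, b, c, h1, h2, h3, h4, rfl⟩ := tri_bounds hT
    intro x hx
    simp at hx ⊢
    omega
  have adj : ∀ i, i + 1 ≤ k → (f (i + 1) = f i + 1 ∨ f i = f (i + 1) + 1 ∨
      (f i = 0 ∧ f (i + 1) = k) ∨ (f i = k ∧ f (i + 1) = 0)) := by
    intro i hi
    have h1 := (pairs_mod_two ht hk (Nat.lt_succ_self i) hi).2 (Or.inl rfl)
    rw [← pairs_image hf hsub (by simp; omega) (by simp; omega), ← h] at h1
    have m1 := hfm i (by omega)
    have m2 := hfm (i + 1) hi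
    rcases lt_trichotomy (f i) (f (i + 1)) with h2 | h2 | h2
    · have := (pairs_mod_two ht' hk h2 m2).1 h1
      omega
    · have := inj _ _ (by omega) hi h2
      omega
    · rw [pairs_comm] at h1
      have := (pairs_mod_two ht' hk h2 m1).1 h1
      omega
  have a0 := adj 0 (by omega)
  simp only [h0, Nat.zero_add] at a0
  have nz : ∀ i, 1 ≤ i → i ≤ k → f i ≠ 0 := fun i h1 h2 h3 => by
    have := inj i 0 h2 (by omega) (by omega)
    omega
  have b1 : f 1 = 1 ∨ f 1 = k := by
    have := nz 1 le_rfl (by omega)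
    omega
  rcases b1 with b1 | b1
  · left
    suffices H : ∀ i, i + 1 ≤ k → f (i + 1) = i + 1 ∧ f i = i by
      intro i h1 h2
      have := (H (i - 1) (by omega)).1
      rwa [show i - 1 + 1 = i by omega] at this
    intro i
    induction i with
    | zero => intro _; exact ⟨b1, h0⟩
    | succ i ih =>
      intro hi
      obtain ⟨h1, h2⟩ := ih (by omega)
      have h3 := adj (i + 1) hi
      have h4 := nz (i + 2) (by omega) hi
      have h5 := inj (i + 2) i hi (by omega)
      refine ⟨?_, h1⟩
      rw [show i + 1 + 1 = i + 2 by rfl] at h3 ⊢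
      omega
  · right
    suffices H : ∀ i, 1 ≤ i → i + 1 ≤ k → f (i + 1) = k - i ∧ f i = k + 1 - i by
      intro i h1 h2
      rcases h1.eq_or_lt with rfl | h3
      · omega
      · have := (H (i - 1) (by omega) (by omega)).1
        rw [show i - 1 + 1 = i by omega] at this
        omega
    intro i hi
    induction i, hi using Nat.le_induction with
    | base =>
      intro h2
      refine ⟨?_, by omega⟩
      have h3 := adj 1 h2
      have h4 := nz 2 (by omega) h2
      have h6 := hfm 2 h2
      rw [show 1 + 1 = 2 by rfl] at h3 ⊢
      omega
    | succ i hi ih =>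
      intro h2
      obtain ⟨h1, h3⟩ := ih (by omega)
      have h4 := adj (i + 1) h2
      have h5 := nz (i + 2) (by omega) h2
      have h6 := inj (i + 2) i h2 (by omega)
      have h7 := hfm (i + 2) h2
      rw [show i + 1 + 1 = i + 2 by rfl] at h4 ⊢
      omega

/-! ### Reflection of triangulated polygons -/

/-- The reflection that exchanges the vertices `i` and `k + 1 - i`, for `1 ≤ i ≤ k`. -/
def refl (k i : ℕ) : ℕ := if i = 0 then 0 else k + 1 - i

theorem image_tri_mirror (t : Tr) (i j n : ℕ) (hi : 1 ≤ i) (hn : i + j + t.size = n) :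
    (t.tri i).image (fun T => T.image (fun x => n - x)) = t.mirror.tri j := by
  induction t generalizing i j with
  | leaf => rfl
  | node l d r hl hr =>
    have p1 := l.size_pos
    have p2 := r.size_pos
    simp only [size] at hn
    rw [tri, Finset.image_insert, Finset.image_union, hl i (j + r.size) hi (by omega),
      hr (i + l.size) j (by omega) (by omega), Tr.mirror, tri, size_mirror, size_mirror,
      Finset.union_comm]
    congr 1
    ext x
    simp
    omega

theorem image_refl_of_pos {k : ℕ} {T : Finset ℕ} (h : ∀ x ∈ T, 1 ≤ x) :
    T.image (refl k) = T.image (fun x => k + 1 - x) := by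
  apply Finset.image_congr
  intro x hx
  have := h x hx
  simp [refl]; omega

theorem image_fan_mirror (s : List Tr) (p k : ℕ) (hp : 1 ≤ p) (hk : p + total s ≤ k) :
    (fan p s).image (fun T => T.image (refl k)) =
      fan (k + 1 - (p + total s)) (s.map Tr.mirror).reverse := by
  have htot : ∀ s : List Tr, total (s.map Tr.mirror).reverse = total s := by
    intro s
    simp [total, Function.comp_def]
  induction s generalizing p with
  | nil => rfl
  | cons t s ih =>
    have p1 := t.size_pos
    rw [total_cons] at hk
    rw [fan, Finset.image_insert, Finset.image_union, ih (p + t.size) (by omega) (by omega),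
      total_cons, List.map_cons, List.reverse_cons, fan_append, htot]
    have e1 : (t.tri p).image (fun T => T.image (refl k)) =
        t.mirror.tri (k + 1 - (p + t.size)) := by
      rw [← image_tri_mirror t p _ (k + 1) hp (by omega)]
      apply Finset.image_congr
      intro T hT
      obtain ⟨a, b, c, h1, h2, h3, h4, rfl⟩ := tri_bounds hT
      apply image_refl_of_pos
      intro x hx
      simp at hx
      omega
    rw [e1]
    simp only [fan, Finset.union_empty, size_mirror]
    rw [show k + 1 - (p + (t.size + total s)) + total s = k + 1 - (p + t.size) by omega,
      show p + t.size + total s = p + (t.size + total s) by omega]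
    have e2 : ({0, p, p + t.size} : Finset ℕ).image (refl k) =
        {0, k + 1 - (p + t.size), k + 1 - (p + t.size) + t.size} := by
      ext x
      simp [refl, show p ≠ 0 by omega]
      omega
    rw [e2, Finset.union_comm, Finset.union_insert]

theorem image_fan_refl (s : List Tr) :
    (fan 1 s).image (fun T => T.image (refl (total s + 1))) = fan 1 (s.map Tr.mirror).reverse := by
  rw [image_fan_mirror s 1 _ le_rfl (by omega)]
  congr 1
  omega

end PRes

namespace PRes
open Item Tr

/-! ### Normalizing the vertex set -/

section Model

variable {α : Type*} [LinearOrder α]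

theorem idx_strictMonoOn (V : Finset α) : StrictMonoOn (idx V) V := by
  intro v hv w hw hvw
  apply Finset.card_lt_card
  rw [Finset.ssubset_iff_of_subset]
  · exact ⟨v, Finset.mem_filter.2 ⟨hv, hvw⟩, by simp⟩
  · intro u hu
    rw [Finset.mem_filter] at hu ⊢
    exact ⟨hu.1, hu.2.trans hvw⟩

theorem idx_lt {V : Finset α} {v : α} (hv : v ∈ V) : idx V v < V.card := by
  apply Finset.card_lt_card
  rw [Finset.ssubset_iff_of_subset (Finset.filter_subset _ _)]
  exact ⟨v, hv, by simp⟩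

theorem image_idx (V : Finset α) : V.image (idx V) = Finset.range V.card := by
  apply Finset.eq_of_subset_of_card_le
  · intro i hi
    obtain ⟨v, hv, rfl⟩ := Finset.mem_image.1 hi
    exact Finset.mem_range.2 (idx_lt hv)
  · rw [Finset.card_image_of_injOn (idx_strictMonoOn V).injOn, Finset.card_range]

theorem IsSubdivision.image {β : Type*} [LinearOrder β] {V : Finset α} {Δ : Finset (Finset α)}
    (h : IsSubdivision V Δ) {f : α → β} (hf : StrictMonoOn f V) :
    IsSubdivision (V.image f) (Δ.image (fun t => t.image f)) := by
  induction h with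
  | digon x y hxy =>
    rw [Finset.image_insert, Finset.image_singleton, Finset.image_empty]
    exact .digon _ _ (hf (by simp) (by simp) hxy)
  | glue V₁ V₂ Δ₁ Δ₂ x y z h₁ h₂ hx hy₁ hy₂ hz ih₁ ih₂ =>
    have hf₁ : StrictMonoOn f V₁ := hf.mono (by simp)
    have hf₂ : StrictMonoOn f V₂ := hf.mono (by simp)
    rw [Finset.image_union, Finset.image_insert, Finset.image_union, Finset.image_insert,
      Finset.image_insert, Finset.image_singleton]
    refine .glue _ _ _ _ _ _ _ (ih₁ hf₁) (ih₂ hf₂) ?_ ?_ ?_ ?_ <;> rw [Finset.coe_image]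
    · exact hf₁.monotoneOn.map_isLeast hx
    · exact hf₁.monotoneOn.map_isGreatest hy₁
    · exact hf₂.monotoneOn.map_isLeast hy₂
    · exact hf₂.monotoneOn.map_isGreatest hz

/-- The triangles after each vertex is replaced by its index. -/
def model (V : Finset α) (Δ : Finset (Finset α)) : Finset (Finset ℕ) :=
  Δ.image (fun t => t.image (idx V))

theorem IsSubdivision.model {V : Finset α} {Δ : Finset (Finset α)} (h : IsSubdivision V Δ) :
    IsSubdivision (Finset.range V.card) (PRes.model V Δ) := by
  rw [← image_idx]
  exact h.image (idx_strictMonoOn V)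

theorem label_eq_entry (V : Finset α) (a : List ℕ) (v : α) : label V a v = entry 1 a (idx V v) := by
  unfold label entry
  rcases h : idx V v with _ | i <;> simp

/-! ### Degrees -/

theorem degree_le (V : Finset α) (Δ : Finset (Finset α)) (a : List ℕ) (v : α) :
    degree V Δ a v ≤ (Δ.filter (v ∈ ·)).card := by
  classical
  have : {c : Quotient (triangleSetoid V Δ a) |
      ∃ t : {t : Finset α // t ∈ Δ}, v ∈ t.1 ∧ Quotient.mk (triangleSetoid V Δ a) t = c} =
      ((Δ.attach.filter (fun t => v ∈ t.1)).image (Quotient.mk (triangleSetoid V Δ a)) :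
        Finset (Quotient (triangleSetoid V Δ a))) := by
    ext c
    simp
  rw [degree, this, Set.ncard_coe_finset]
  refine Finset.card_image_le.trans ?_
  rw [← Finset.card_map ⟨Subtype.val, Subtype.val_injective⟩]
  apply Finset.card_le_card
  intro t ht
  simp at ht ⊢
  exact ⟨ht.2, ht.1⟩

/-- Two different triangles at `v` in the same class: one of them can be left out when the classes
at `v` are counted. -/
theorem degree_lt {V : Finset α} {Δ : Finset (Finset α)} {a : List ℕ} {v : α} {s t : Finset α}
    (hs : s ∈ Δ) (ht : t ∈ Δ) (hvs : v ∈ s) (hvt : v ∈ t) (hst : s ≠ t) (h : Linked V a s t) :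
    degree V Δ a v + 1 ≤ (Δ.filter (v ∈ ·)).card := by
  classical
  have : {c : Quotient (triangleSetoid V Δ a) |
      ∃ t : {t : Finset α // t ∈ Δ}, v ∈ t.1 ∧ Quotient.mk (triangleSetoid V Δ a) t = c} =
      (((Δ.attach.filter (fun t => v ∈ t.1)).erase ⟨s, hs⟩).image
        (Quotient.mk (triangleSetoid V Δ a)) : Finset (Quotient (triangleSetoid V Δ a))) := by
    ext c
    simp only [Finset.coe_image, Set.mem_image, Set.mem_ofPred_eq, Finset.mem_coe, Finset.mem_erase,
      Finset.mem_filter, Finset.mem_attach, true_and]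
    constructor
    · rintro ⟨u, hu, rfl⟩
      by_cases hus : u = ⟨s, hs⟩
      · refine ⟨⟨t, ht⟩, ⟨fun h => hst (congrArg Subtype.val h).symm, hvt⟩, ?_⟩
        rw [hus]
        exact (Quotient.sound (s := triangleSetoid V Δ a) (Relation.EqvGen.rel _ _ h)).symm
      · exact ⟨u, ⟨hus, hu⟩, rfl⟩
    · rintro ⟨u, ⟨-, hu⟩, rfl⟩
      exact ⟨u, hu, rfl⟩
  rw [degree, this, Set.ncard_coe_finset]
  have hmem : (⟨s, hs⟩ : {t // t ∈ Δ}) ∈ Δ.attach.filter (fun t => v ∈ t.1) := by simp [hvs]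
  have h1 := Finset.card_erase_add_one hmem
  have h2 := Finset.card_image_le (s := (Δ.attach.filter (fun t => v ∈ t.1)).erase ⟨s, hs⟩)
    (f := Quotient.mk (triangleSetoid V Δ a))
  have h3 : (Δ.attach.filter (fun t => v ∈ t.1)).card ≤ (Δ.filter (v ∈ ·)).card := by
    rw [← Finset.card_map ⟨Subtype.val, Subtype.val_injective⟩]
    apply Finset.card_le_card
    intro t ht
    simp at ht ⊢
    exact ⟨ht.2, ht.1⟩
  omega

/-- Without a label `1` the relation `Linked` is empty on the triangles, so every class has one
element. -/
theorem degree_eq {V : Finset α} {Δ : Finset (Finset α)} {a : List ℕ} (v : α)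
    (h : ∀ s ∈ Δ, ∀ w ∈ s, label V a w ≠ 1) :
    degree V Δ a v = (Δ.filter (v ∈ ·)).card := by
  classical
  have : {c : Quotient (triangleSetoid V Δ a) |
      ∃ t : {t : Finset α // t ∈ Δ}, v ∈ t.1 ∧ Quotient.mk (triangleSetoid V Δ a) t = c} =
      ((Δ.attach.filter (fun t => v ∈ t.1)).image (Quotient.mk (triangleSetoid V Δ a)) :
        Finset (Quotient (triangleSetoid V Δ a))) := by
    ext c
    simp
  have inj : Function.Injective (Quotient.mk (triangleSetoid V Δ a)) := by
    intro s t hst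
    have := Quotient.exact (s := triangleSetoid V Δ a) hst
    change Relation.EqvGen _ s t at this
    induction this with
    | rel s t hl =>
      obtain ⟨-, w, hw, h1⟩ := hl
      rcases Finset.mem_union.1 hw with hw | hw
      · exact absurd h1 (h _ s.2 w hw)
      · exact absurd h1 (h _ t.2 w hw)
    | refl s => rfl
    | symm s t _ ih => exact (ih hst.symm).symm
    | trans s t u h1 h2 ih1 ih2 =>
      exact (ih1 (Quotient.sound h1)).trans (ih2 (Quotient.sound h2))
  rw [degree, this, Set.ncard_coe_finset, Finset.card_image_of_injective _ inj,
    ← Finset.card_map ⟨Subtype.val, Subtype.val_injective⟩]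
  congr 1
  ext t
  simp [and_comm]

theorem card_filter_model {V : Finset α} {Δ : Finset (Finset α)} (h : IsSubdivision V Δ) {v : α}
    (hv : v ∈ V) : ((model V Δ).filter (idx V v ∈ ·)).card = (Δ.filter (v ∈ ·)).card :=
  card_filter_image (idx_strictMonoOn V).injOn h.subset _ _ fun t ht =>
    mem_image_iff (idx_strictMonoOn V).injOn (h.subset t ht) hv

/-- Two triangles that realize a link between triangles with the same vertex. -/
def LinkedAt (Δ : Finset (Finset ℕ)) (a : List ℕ) (i : ℕ) : Prop :=
  ∃ S ∈ Δ, ∃ T ∈ Δ, i ∈ S ∧ i ∈ T ∧ S ≠ T ∧ (S ∩ T).card = 2 ∧ ∃ j ∈ S ∪ T, entry 1 a j = 1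

theorem degree_lt_of_linkedAt {V : Finset α} {Δ : Finset (Finset α)} {a : List ℕ} {v : α}
    (h : IsSubdivision V Δ) (hv : v ∈ V) (hl : LinkedAt (model V Δ) a (idx V v)) :
    degree V Δ a v + 1 ≤ ((model V Δ).filter (idx V v ∈ ·)).card := by
  obtain ⟨S, hS, T, hT, hiS, hiT, hne, hc, j, hj, h1⟩ := hl
  obtain ⟨s, hs, rfl⟩ := Finset.mem_image.1 hS
  obtain ⟨t, ht, rfl⟩ := Finset.mem_image.1 hT
  have inj := (idx_strictMonoOn V).injOn
  have hsV := h.subset s hs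
  have htV := h.subset t ht
  rw [card_filter_model h hv]
  refine degree_lt hs ht ((mem_image_iff inj hsV hv).1 hiS) ((mem_image_iff inj htV hv).1 hiT)
    (fun e => hne (by rw [e])) ⟨?_, ?_⟩
  · rw [← hc, ← Finset.image_inter_of_injOn, Finset.card_image_of_injOn]
    · exact inj.mono fun x hx => hsV (Finset.mem_inter.1 hx).1
    · refine inj.mono fun x hx => ?_
      rcases hx with hx | hx
      exacts [hsV hx, htV hx]
  · rw [← Finset.image_union] at hj
    obtain ⟨w, hw, rfl⟩ := Finset.mem_image.1 hj
    exact ⟨w, hw, by rw [label_eq_entry, h1]⟩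

/-- Admissibility asks only for an upper bound of the degree. So the classes need not be computed:
if there is one triangle too many, a single link at the vertex is enough. -/
theorem isLabelled_of_model {V : Finset α} {Δ : Finset (Finset α)} {a : List ℕ}
    (h : IsSubdivision V Δ) (hl : a.length + 1 = V.card) (ha : IsW a)
    (hd : ∀ i, 1 ≤ i → ((model V Δ).filter (i ∈ ·)).card ≤ entry 1 a i ∨
      ((model V Δ).filter (i ∈ ·)).card ≤ entry 1 a i + 1 ∧ LinkedAt (model V Δ) a i) :
    IsLabelled V Δ a := by
  refine ⟨h, hl, ha, fun v hv h0 => ?_⟩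
  rw [label_eq_entry]
  rcases hd (idx V v) (by omega) with h1 | ⟨h1, h2⟩
  · refine (degree_le V Δ a v).trans ?_
    rwa [← card_filter_model h hv]
  · have := degree_lt_of_linkedAt h hv h2
    omega

theorem label_ne_one {V : Finset α} {a : List ℕ} (ha : IsW2 a) (v : α) : label V a v ≠ 1 := by
  rw [label_eq_entry, entry]
  split_ifs
  · rcases Nat.lt_or_ge (idx V v - 1) a.length with h | h
    · rw [List.getD_eq_getElem _ _ h]
      have := ha _ (List.getElem_mem h)
      omega
    · rw [List.getD_eq_default _ _ h]; omega
  · omega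

theorem IsLabelled.le_entry {V : Finset α} {Δ : Finset (Finset α)} {a : List ℕ}
    (h : IsLabelled V Δ a) (ha : IsW2 a) (i : ℕ) (hi : 1 ≤ i) (hi' : i ≤ a.length) :
    ((model V Δ).filter (i ∈ ·)).card ≤ entry 1 a i := by
  have : i ∈ V.image (idx V) := by
    rw [image_idx, Finset.mem_range, ← h.length]
    omega
  obtain ⟨v, hv, rfl⟩ := Finset.mem_image.1 this
  have := h.admissible v hv (by omega)
  rw [label_eq_entry, degree_eq v (fun s _ w _ => label_ne_one ha w)] at this
  rwa [card_filter_model h.subdivision hv]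

theorem exists_strictMonoOn [Infinite α] (n : ℕ) :
    ∃ f : ℕ → α, StrictMonoOn f (Finset.range n : Finset ℕ) := by
  obtain ⟨V, hV⟩ := Infinite.exists_subset_card_eq α n
  have : Nonempty α := inferInstance
  refine ⟨fun i => if h : i < n then V.orderEmbOfFin hV ⟨i, h⟩ else Classical.arbitrary α, ?_⟩
  intro i hi j hj hij
  simp only [Finset.coe_range, Set.mem_Iio] at hi hj
  simp only [hi, hj, dif_pos]
  exact (V.orderEmbOfFin hV).strictMono hij

theorem idx_image {n : ℕ} {f : ℕ → α} (hf : StrictMonoOn f (Finset.range n : Finset ℕ)) {i : ℕ}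
    (hi : i < n) : idx ((Finset.range n).image f) (f i) = i := by
  have : ((Finset.range n).image f).filter (· < f i) = (Finset.range i).image f := by
    ext v
    simp only [Finset.mem_filter, Finset.mem_image, Finset.mem_range]
    constructor
    · rintro ⟨⟨j, hj, rfl⟩, h⟩
      exact ⟨j, (hf.lt_iff_lt (by simpa using hj) (by simpa using hi)).1 h, rfl⟩
    · rintro ⟨j, hj, rfl⟩
      exact ⟨⟨j, hj.trans hi, rfl⟩, hf (by simpa using hj.trans hi) (by simpa using hi) hj⟩
  rw [idx, this, Finset.card_image_of_injOn, Finset.card_range]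
  exact hf.injOn.mono fun j hj => by simp at hj ⊢; omega

theorem model_image {n : ℕ} {f : ℕ → α} (hf : StrictMonoOn f (Finset.range n : Finset ℕ))
    {Δ : Finset (Finset ℕ)} (hΔ : ∀ T ∈ Δ, T ⊆ Finset.range n) :
    model ((Finset.range n).image f) (Δ.image (fun T => T.image f)) = Δ := by
  rw [model, Finset.image_image]
  conv_rhs => rw [← Finset.image_id (s := Δ)]
  apply Finset.image_congr
  intro T hT
  simp only [Function.comp_apply, id_eq, Finset.image_image]
  conv_rhs => rw [← Finset.image_id (s := T)]
  apply Finset.image_congr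
  intro i hi
  exact idx_image hf (Finset.mem_range.1 (hΔ T hT hi))

/-- Labelled subdivisions with given labels and triangles. -/
theorem exists_labelledSubdivision [Infinite α] {s : List Tr} {a : List ℕ}
    (hl : a.length = total s + 1) (ha : IsW a)
    (hd : ∀ i, 1 ≤ i → ((fan 1 s).filter (i ∈ ·)).card ≤ entry 1 a i ∨
      ((fan 1 s).filter (i ∈ ·)).card ≤ entry 1 a i + 1 ∧ LinkedAt (fan 1 s) a i) :
    ∃ S : LabelledSubdivision α, S.a = a ∧ model S.V S.Δ = fan 1 s := by
  obtain ⟨f, hf⟩ := exists_strictMonoOn (α := α) (total s + 2)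
  have hs := fan_isSubdivision s
  have hm := model_image hf hs.subset
  have hS := hs.image hf
  refine ⟨⟨(Finset.range (total s + 2)).image f, (fan 1 s).image (fun T => T.image f), a,
    isLabelled_of_model hS ?_ ha ?_⟩, rfl, hm⟩
  · rw [Finset.card_image_of_injOn hf.injOn, Finset.card_range, hl]
  · rw [hm]; exact hd

end Model

/-! ### Isomorphism classes -/

section Iso

variable {α : Type*} [LinearOrder α]

theorem LabelledSubdivision.exists_fan (S : LabelledSubdivision α) :
    ∃ s : List Tr, s.map strip = s ∧ total s + 1 = S.a.length ∧ model S.V S.Δ = fan 1 s := by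
  have h1 := S.isLabelled.subdivision.model
  have h2 := S.isLabelled.length
  have h3 : 1 ≤ S.a.length := by
    by_contra h
    have h4 : S.V.card = 1 := by omega
    obtain ⟨v, hv⟩ := Finset.card_eq_one.1 h4
    have h5 := S.isLabelled.subdivision.lt (x := v) (z := v) (by rw [hv]; simp) (by rw [hv]; simp)
    exact lt_irrefl _ h5
  rw [← h2, show S.a.length + 1 = (S.a.length - 1) + 2 by omega] at h1
  obtain ⟨s, hs, ht, hΔ⟩ := h1.exists_fan
  exact ⟨s, hs, by omega, hΔ⟩

theorem image_idx_injOn {V : Finset α} {Δ Δ' : Finset (Finset α)} (h : ∀ t ∈ Δ, t ⊆ V)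
    (h' : ∀ t ∈ Δ', t ⊆ V) (he : model V Δ = model V Δ') : Δ = Δ' := by
  have inj := injOn_image (idx_strictMonoOn V).injOn
  have key : ∀ {Δ Δ' : Finset (Finset α)}, (∀ t ∈ Δ, t ⊆ V) → (∀ t ∈ Δ', t ⊆ V) →
      model V Δ = model V Δ' → Δ ⊆ Δ' := by
    intro Δ Δ' h h' he t ht
    have h1 : t.image (idx V) ∈ model V Δ' := he ▸ Finset.mem_image_of_mem _ ht
    obtain ⟨t', ht', h2⟩ := Finset.mem_image.1 h1
    rwa [← inj (h' t' ht') (h t ht) h2]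
  exact (key h h' he).antisymm (key h' h he.symm)

theorem LabelledSubdivision.label_eq_zero (S : LabelledSubdivision α) {v : α} (hv : v ∈ S.V) :
    label S.V S.a v = 0 ↔ idx S.V v = 0 := by
  rw [label_eq_entry, entry]
  have h1 := idx_lt hv
  have h2 := S.isLabelled.length
  constructor
  · intro h
    by_contra h0
    rw [if_pos (by omega), List.getD_eq_getElem _ _ (by omega)] at h
    have := S.isLabelled.entries _ (List.getElem_mem (l := S.a) (n := idx S.V v - 1) (by omega))
    omega
  · intro h
    rw [if_neg (by omega)]

theorem exists_of_lt_card {V : Finset α} {i : ℕ} (hi : i < V.card) : ∃ v ∈ V, idx V v = i := by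
  have : i ∈ V.image (idx V) := by rw [image_idx]; simpa using hi
  obtain ⟨v, hv, h⟩ := Finset.mem_image.1 this
  exact ⟨v, hv, h⟩

/-- A bijection of the indices induces an isomorphism. -/
theorem iso_of_index {S S' : LabelledSubdivision α} (hl : S.a.length = S'.a.length) {g : ℕ → ℕ}
    (hg : Set.InjOn g (Finset.range S.V.card : Finset ℕ)) (hgm : ∀ i < S.V.card, g i < S.V.card)
    (hΔ : model S'.V S'.Δ = (model S.V S.Δ).image (fun T => T.image g))
    (hlab : ∀ i < S.V.card, entry 1 S'.a (g i) = entry 1 S.a i) : S ≈ S' := by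
  classical
  have hc : S.V.card = S'.V.card := by rw [← S.isLabelled.length, ← S'.isLabelled.length, hl]
  have ex : ∀ v : α, ∃ w : α, v ∈ S.V → w ∈ S'.V ∧ idx S'.V w = g (idx S.V v) := by
    intro v
    by_cases hv : v ∈ S.V
    · obtain ⟨w, hw, h⟩ := exists_of_lt_card (V := S'.V) (hc ▸ hgm _ (idx_lt hv))
      exact ⟨w, fun _ => ⟨hw, h⟩⟩
    · exact ⟨v, fun h => absurd h hv⟩
  choose f hf using ex
  have inj : Set.InjOn f S.V := by
    intro v hv w hw h
    have h1 := (hf v hv).2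
    rw [h, (hf w hw).2] at h1
    exact (idx_strictMonoOn S.V).injOn hv hw
      (hg (by simpa using idx_lt hv) (by simpa using idx_lt hw) h1.symm)
  have maps : Set.MapsTo f S.V S'.V := fun v hv => (hf v hv).1
  have img : S.V.image f = S'.V := by
    apply Finset.eq_of_subset_of_card_le
    · intro w hw
      obtain ⟨v, hv, rfl⟩ := Finset.mem_image.1 hw
      exact maps hv
    · rw [Finset.card_image_of_injOn inj, hc]
  have sub := S.isLabelled.subdivision.subset
  refine ⟨f, ⟨maps, inj, ?_⟩, ?_, ?_⟩
  · intro w hw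
    rw [← img] at hw
    simpa using hw
  · apply image_idx_injOn (V := S'.V) S'.isLabelled.subdivision.subset
    · intro t ht
      obtain ⟨s, hs, rfl⟩ := Finset.mem_image.1 ht
      intro w hw
      obtain ⟨v, hv, rfl⟩ := Finset.mem_image.1 hw
      exact maps (sub s hs hv)
    · rw [hΔ, model, model, Finset.image_image, Finset.image_image]
      apply Finset.image_congr
      intro s hs
      simp only [Function.comp_apply, Finset.image_image]
      apply Finset.image_congr
      intro v hv
      exact (hf v (sub s hs hv)).2.symm
  · intro v hv
    rw [label_eq_entry, label_eq_entry, (hf v hv).2, hlab _ (idx_lt hv)]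

theorem list_ext_entry {a b : List ℕ} (hl : a.length = b.length)
    (h : ∀ i, 1 ≤ i → i ≤ a.length → entry 1 a i = entry 1 b i) : a = b := by
  apply List.ext_getElem hl
  intro n h1 h2
  have := h (n + 1) (by omega) (by omega)
  unfold entry at this
  rw [if_pos (by omega), if_pos (by omega), Nat.add_sub_cancel, List.getD_eq_getElem _ _ h1,
    List.getD_eq_getElem _ _ h2] at this
  exact this

theorem entry_reverse (a : List ℕ) {i : ℕ} (h1 : 1 ≤ i) (h2 : i ≤ a.length) :
    entry 1 a.reverse i = entry 1 a (a.length + 1 - i) := by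
  unfold entry
  rw [if_pos h1, if_pos (by omega), List.getD_eq_getElem _ _ (by simp; omega),
    List.getD_eq_getElem _ _ (by omega), List.getElem_reverse]
  congr 1
  omega

/-- An isomorphism induces a map of the indices that fixes `0` and preserves triangles, so
`eq_id_or_reverse` applies. The triangles then determine the lists of polygons by `fan_injective`.
-/
theorem equiv_iff {S S' : LabelledSubdivision α} {s s' : List Tr} (hs : s.map strip = s)
    (hs' : s'.map strip = s') (hS : model S.V S.Δ = fan 1 s) (hS' : model S'.V S'.Δ = fan 1 s')
    (ht : total s + 1 = S.a.length) (ht' : total s' + 1 = S'.a.length) :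
    S ≈ S' ↔ (S'.a = S.a ∧ s' = s) ∨ (S'.a = S.a.reverse ∧ s' = (s.map Tr.mirror).reverse) := by
  have hlen := S.isLabelled.length
  have hlen' := S'.isLabelled.length
  have smirror : ((s.map Tr.mirror).reverse).map strip = (s.map Tr.mirror).reverse := by
    rw [List.map_reverse, List.map_map]
    conv_rhs => rw [← hs, List.map_map]
    congr 1
    apply List.map_congr_left
    intro t _
    simp [mirror_strip]
  have tmirror : total (s.map Tr.mirror).reverse = total s := by
    simp [total, Function.comp_def]
  constructor
  · rintro ⟨f, hf, hΔ, hl⟩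
    have hc : S.V.card = S'.V.card := by
      rw [← Finset.card_image_of_injOn hf.injOn]
      congr 1
      apply Finset.coe_injective
      rw [Finset.coe_image, hf.image_eq]
    have hV : ∀ i, i < S.V.card → ∃ v ∈ S.V, idx S.V v = i := fun i hi => exists_of_lt_card hi
    have ex : ∀ i : ℕ, ∃ j : ℕ, ∀ v ∈ S.V, idx S.V v = i → idx S'.V (f v) = j := by
      intro i
      by_cases hi : i < S.V.card
      · obtain ⟨v, hv, rfl⟩ := hV i hi
        refine ⟨idx S'.V (f v), fun w hw h => ?_⟩
        rw [(idx_strictMonoOn S.V).injOn hw hv h]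
      · exact ⟨0, fun v hv h => absurd (idx_lt hv) (by omega)⟩
    choose g hg' using ex
    have hg : ∀ v ∈ S.V, idx S'.V (f v) = g (idx S.V v) := fun v hv => hg' _ v hv rfl
    have ginj : Set.InjOn g (Finset.range S.V.card : Finset ℕ) := by
      intro i hi j hj hij
      obtain ⟨v, hv, rfl⟩ := hV i (by simpa using hi)
      obtain ⟨w, hw, rfl⟩ := hV j (by simpa using hj)
      rw [← hg v hv, ← hg w hw] at hij
      rw [hf.injOn hv hw ((idx_strictMonoOn S'.V).injOn (hf.mapsTo hv) (hf.mapsTo hw) hij)]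
    have gmaps : ∀ i < S.V.card, g i < S.V.card := by
      intro i hi
      obtain ⟨v, hv, rfl⟩ := hV i hi
      rw [← hg v hv, hc]
      exact idx_lt (hf.mapsTo hv)
    have glab : ∀ i < S.V.card, entry 1 S'.a (g i) = entry 1 S.a i := by
      intro i hi
      obtain ⟨v, hv, rfl⟩ := hV i hi
      rw [← hg v hv, ← label_eq_entry, ← label_eq_entry, hl v hv]
    have gΔ : fan 1 s' = (fan 1 s).image (fun T => T.image g) := by
      rw [← hS, ← hS', model, model, hΔ, Finset.image_image, Finset.image_image]
      apply Finset.image_congr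
      intro t ht
      simp only [Function.comp_apply, Finset.image_image]
      apply Finset.image_congr
      intro v hv
      exact hg v (S.isLabelled.subdivision.subset t ht hv)
    -- The index `0` is recognized by its label: the value `0` stands for no label, and all true
    -- labels are positive.
    have g0 : g 0 = 0 := by
      obtain ⟨v, hv, h0⟩ := hV 0 (by omega)
      have h1 := (S.label_eq_zero hv).2 h0
      rw [← hl v hv, S'.label_eq_zero (hf.mapsTo hv), hg v hv, h0] at h1
      exact h1
    have gΔ' := gΔ
    rw [← tri_whole, ← tri_whole] at gΔ'
    have hk : total s' = total s := by omega
    have key := eq_id_or_reverse (size_whole s) (by rw [size_whole, hk])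
      (by rwa [show total s + 1 + 1 = S.V.card by omega])
      (fun i hi => by have := gmaps i (by omega); omega) g0 gΔ'
    have sub : ∀ T ∈ fan 1 s, T ⊆ Finset.range (total s + 2) := (fan_isSubdivision s).subset
    rcases key with key | key
    · left
      constructor
      · apply list_ext_entry (by omega)
        intro i h1 h2
        have := glab i (by omega)
        rwa [key i h1 (by omega)] at this
      · apply fan_injective hs' hs hk
        rw [gΔ]
        conv_rhs => rw [← Finset.image_id (s := fan 1 s)]
        apply Finset.image_congr
        intro T hT
        simp only [id_eq]
        conv_rhs => rw [← Finset.image_id (s := T)]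
        apply Finset.image_congr
        intro i hi
        have := Finset.mem_range.1 (sub T hT hi)
        rcases Nat.eq_zero_or_pos i with rfl | h
        · exact g0
        · exact key i h (by omega)
    · right
      constructor
      · apply list_ext_entry (by simp; omega)
        intro i h1 h2
        rw [entry_reverse _ h1 (by omega)]
        have := glab (S.a.length + 1 - i) (by omega)
        rwa [key _ (by omega) (by omega),
          show total s + 1 + 1 - (S.a.length + 1 - i) = i by omega] at this
      · apply fan_injective hs' smirror (by omega)
        rw [gΔ, ← image_fan_refl]
        apply Finset.image_congr
        intro T hT
        apply Finset.image_congr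
        intro i hi
        have := Finset.mem_range.1 (sub T hT hi)
        rcases Nat.eq_zero_or_pos i with rfl | h
        · exact g0
        · rw [key i h (by omega), refl, if_neg (by omega)]
  · rintro (⟨ha, rfl⟩ | ⟨ha, rfl⟩)
    · apply iso_of_index (g := id) (by rw [ha]) (Set.injOn_id _) (fun i hi => hi)
      · rw [hS, hS']
        simp
      · intro i hi
        rw [ha]; rfl
    · apply iso_of_index (g := refl (total s + 1)) (by rw [ha]; simp)
      · intro i hi j hj hij
        simp only [Finset.coe_range, Set.mem_Iio] at hi hj
        simp only [refl] at hij
        split_ifs at hij <;> omega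
      · intro i hi
        simp only [refl]
        split_ifs <;> omega
      · rw [hS, hS', image_fan_refl]
      · intro i hi
        simp only [refl]
        split_ifs with h
        · rw [h, entry_of_lt _ (by omega), entry_of_lt _ (by omega)]
        · rw [ha, entry_reverse _ (by omega) (by omega)]
          congr 1
          omega

end Iso

end PRes

namespace PRes
open Item Tr

/-! ### Labels and degrees -/

theorem map_strip_shapes (X : List Item) : (shapes X).map strip = shapes X := by
  induction X with
  | nil => rfl
  | cons i X ih =>
    match i with
    | num 0 => simpa [shapes, Item.shapes] using ih
    | num 1 => simpa [strip] using ih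
    | num (x + 2) => simpa [strip] using ih
    | tr t => simpa using ih

/-- The number of entries `1` in the sequence of items for which the vertex `v` lies in one of the two
corresponding triangles. The first vertex is `p`. -/
def excess : ℕ → List Item → ℕ → ℕ
  | _, [], _ => 0
  | p, num x :: X, v => (if x = 1 ∧ p ≤ v ∧ v ≤ p + 2 then 1 else 0) +
      excess (p + total (Item.shapes (num x))) X v
  | p, tr t :: X, v => excess (p + t.size) X v

@[simp] theorem excess_nil (p v : ℕ) : excess p [] v = 0 := rfl
theorem excess_one (p v : ℕ) (X : List Item) : excess p (num 1 :: X) v =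
    (if p ≤ v ∧ v ≤ p + 2 then 1 else 0) + excess (p + 2) X v := by
  simp [excess, Item.shapes, total, Tr.size]
theorem excess_add_two (p v x : ℕ) (X : List Item) :
    excess p (num (x + 2) :: X) v = excess (p + x) X v := by
  simp [excess, Item.shapes]
theorem excess_tr (p v : ℕ) (t : Tr) (X : List Item) :
    excess p (tr t :: X) v = excess (p + t.size) X v := rfl

theorem card_filter_fan_leaf (p : ℕ) (hp : 1 ≤ p) (s : List Tr) (v : ℕ) (hv : 1 ≤ v) :
    ((fan p (leaf :: s)).filter (v ∈ ·)).card = (if v = p then 1 else 0) +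
      (if v = p + 1 then 1 else 0) + ((fan (p + 1) s).filter (v ∈ ·)).card := by
  rw [card_filter_fan_cons_mem p hp _ _ v hv, show leaf.size = 1 from rfl]
  simp [strip, full, mid, first, last, entry_cons]

theorem entry_lab_tr (p : ℕ) (t : Tr) {X : List Item} (h : lab X ≠ []) (v : ℕ) :
    entry p (lab (tr t :: X)) v =
      entry p t.full v + (if v = p then 1 else 0) + entry (p + t.size) (lab X) v := by
  obtain ⟨y, q, hy⟩ := List.exists_cons_of_ne_nil h
  have := t.length_mid
  rw [lab_tr hy, hy, entry_full, List.cons_append, entry_cons, entry_append, entry_cons, entry_cons,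
    show p + 1 + t.mid.length = p + t.size by omega]
  split_ifs <;> omega

theorem entry_strip_full_le (t : Tr) (p v : ℕ) : entry p t.strip.full v ≤ entry p t.full v := by
  induction t generalizing p with
  | leaf => exact le_rfl
  | node l d r hl hr =>
    rw [strip, entry_full_node, entry_full_node, size_strip, size_strip]
    have h1 := hl p
    have h2 := hr (p + l.size)
    split_ifs <;> omega

theorem Valid.cons_num_sub {x : ℕ} {X : List Item} (h : Valid (num (x + 3) :: X)) :
    Valid (num (x + 2) :: X) :=
  ⟨h.1, by omega, by omega, h.2.2.2⟩

open Classical in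
-- The extra term is a spare unit at the first vertex, present unless a polygon comes first. A
-- polygon needs it at its last vertex for the triangle that joins its base edge to `0`; it is there
-- because polygons are not adjacent. An entry `1` gives the labels `1, 1` to vertices of two fan
-- triangles, and `excess` covers the deficit on the three vertices concerned.
theorem Valid.card_filter_le : ∀ {X : List Item}, Valid X → ∀ (p v : ℕ), 1 ≤ p → 1 ≤ v →
    ((fan p (shapes X)).filter (v ∈ ·)).card +
      (if v = p ∧ (∀ t X', X ≠ tr t :: X') then 1 else 0) ≤ entry p (lab X) v + excess p X v
  | [], _, p, v, _, _ => by
    simp [fan, entry_cons]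
  | num 0 :: X, h, _, _, _, _ => absurd h.2.1 (by omega)
  | num 1 :: X, h, p, v, hp, hv => by
    have ih := h.of_cons.card_filter_le (p + 2) v (by omega) hv
    rw [shapes_one, card_filter_fan_leaf p hp _ v hv, card_filter_fan_leaf _ (by omega) _ v hv,
      lab_one, entry_cons, entry_cons, excess_one, show p + 1 + 1 = p + 2 from rfl]
    split_ifs at * <;> omega
  | num (x + 2) :: X, h, p, v, hp, hv => by
    induction x generalizing p with
    | zero =>
      have ih := h.of_cons.card_filter_le p v hp hv
      rw [shapes_add_two, lab_add_two, excess_add_two]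
      simp only [List.replicate_zero, List.nil_append, Nat.add_zero]
      rw [entry_alphaRight _ h.of_cons.lab_ne_nil]
      split_ifs at * <;> omega
    | succ x ihx =>
      have ih := ihx h.cons_num_sub (p + 1) (by omega)
      rw [shapes_add_two, lab_add_two, excess_add_two] at ih ⊢
      rw [List.replicate_succ, List.replicate_succ, List.cons_append, List.cons_append,
        card_filter_fan_leaf p hp _ v hv, entry_cons, show p + (x + 1) = p + 1 + x by omega]
      simp only [reduceCtorEq, List.cons.injEq, false_and, ne_eq, not_false_eq_true, implies_true,
        and_true] at *
      split_ifs at * <;> omega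
  | tr t :: X, h, p, v, hp, hv => by
    have ih := h.of_cons.card_filter_le (p + t.size) v (by omega) hv
    rw [shapes_tr, card_filter_fan_cons_mem p hp _ _ v hv, strip_strip, size_strip, excess_tr,
      entry_lab_tr p t h.of_cons.lab_ne_nil]
    have h1 := entry_strip_full_le t p v
    have h0 : ¬ (v = p ∧ ∀ t' X', tr t :: X ≠ tr t' :: X') := fun h => h.2 t X rfl
    rw [if_neg h0]
    have h2 := h.2.2.2
    split_ifs at * <;> first | omega | simp_all

theorem excess_of_lt (X : List Item) {p v : ℕ} (h : v < p) : excess p X v = 0 := by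
  induction X generalizing p with
  | nil => rfl
  | cons i X ih =>
    cases i with
    | num x => rw [excess, ih (by omega), if_neg (by omega)]
    | tr t => rw [excess_tr, ih (by omega)]

theorem Tr.two_le_size {t : Tr} (h : t ≠ leaf) : 2 ≤ t.size := by
  cases t with
  | leaf => exact absurd rfl h
  | node l d r =>
    have := l.size_pos
    have := r.size_pos
    simp only [Tr.size]; omega

/-- Each entry `1` is followed by a polygon, so the ranges of three vertices for different entries
`1` do not meet. -/
theorem Valid.excess_le : ∀ {X : List Item}, Valid X → ∀ p v, excess p X v ≤ 1
  | [], _, _, _ => by simp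
  | num 0 :: X, h, _, _ => absurd h.2.1 (by omega)
  | num 1 :: X, h, p, v => by
    obtain ⟨t, X', rfl⟩ := h.2.2.1 rfl
    have h1 := two_le_size h.1.2.2.1
    have h2 := h.1.of_cons.excess_le (p + 2 + t.size) v
    have h3 := excess_of_lt X' (p := p + 2 + t.size) (v := v)
    rw [excess_one, excess_tr]
    split_ifs <;> omega
  | num (x + 2) :: X, h, p, v => by
    rw [excess_add_two]
    exact h.of_cons.excess_le _ _
  | tr t :: X, h, p, v => by
    rw [excess_tr]
    exact h.of_cons.excess_le _ _

/-- Two triangles that realize a link between triangles with the vertex `v`; the position of the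
label `1` is greater than `p`. -/
def LinkedFrom (p : ℕ) (X : List Item) (v : ℕ) : Prop :=
  ∃ S ∈ fan p (shapes X), ∃ T ∈ fan p (shapes X), v ∈ S ∧ v ∈ T ∧ S ≠ T ∧ (S ∩ T).card = 2 ∧
    ∃ j ∈ S ∪ T, p < j ∧ entry p (lab X) j = 1

theorem LinkedFrom.append {p q v : ℕ} {X Y : List Item} (h : LinkedFrom q Y v) (hpq : p ≤ q)
    (hs : fan q (shapes Y) ⊆ fan p (shapes X))
    (hl : ∀ j, q < j → entry p (lab X) j = entry q (lab Y) j) : LinkedFrom p X v := by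
  obtain ⟨S, hS, T, hT, h1, h2, h3, h4, j, hj, hqj, h5⟩ := h
  exact ⟨S, hs hS, T, hs hT, h1, h2, h3, h4, j, hj, by omega, by rw [hl j hqj, h5]⟩

theorem fan_subset_cons (p : ℕ) (t : Tr) (s : List Tr) : fan (p + t.size) s ⊆ fan p (t :: s) := by
  intro T hT
  simp [fan, hT]

theorem entry_lab_tr_of_lt {p j : ℕ} {t : Tr} {X : List Item} (h : lab X ≠ [])
    (hj : p + t.size < j) : entry p (lab (tr t :: X)) j = entry (p + t.size) (lab X) j := by
  rw [entry_lab_tr p t h, if_neg (by omega), entry_of_ge _ (by rw [length_full]; omega)]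
  omega

theorem Valid.linkedFrom_num {x : ℕ} {X : List Item} (h : Valid (num (x + 2) :: X)) {p v : ℕ}
    (hl : LinkedFrom (p + x) X v) : LinkedFrom p (num (x + 2) :: X) v := by
  refine hl.append (by omega) ?_ ?_
  · rw [shapes_add_two, fan_append, total_replicate_leaf]
    exact Finset.subset_union_right
  · intro j hj
    rw [lab_add_two, entry_append, List.length_replicate, entry_of_ge _ (by simp; omega),
      entry_alphaRight _ h.of_cons.lab_ne_nil, if_neg (by omega)]
    omega

theorem Valid.linkedFrom_tr {t : Tr} {X : List Item} (h : Valid (tr t :: X)) {p v : ℕ}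
    (hl : LinkedFrom (p + t.size) X v) : LinkedFrom p (tr t :: X) v := by
  refine hl.append (by omega) ?_ fun j hj => entry_lab_tr_of_lt h.of_cons.lab_ne_nil hj
  rw [shapes_tr, ← size_strip]
  exact fan_subset_cons p t.strip (shapes X)

/-- The vertex `q + 1` has label `1`, and the four consecutive triangles at `0` with the vertices p,
q, q + 1, q + 2, q + 2 + t'.size provide the links: each of q, q + 1, q + 2 lies on the edge from
`0` common to two of them, one of which contains `q + 1`. The outer two triangles exist since there
are polygons on both sides of the entry `1`. -/
theorem Valid.linkedFrom_one {t : Tr} {X : List Item} (h : Valid (tr t :: num 1 :: X)) {p v : ℕ}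
    (hp : 1 ≤ p) (h1 : p + t.size ≤ v) (h2 : v ≤ p + t.size + 2) :
    LinkedFrom p (tr t :: num 1 :: X) v := by
  obtain ⟨t', X', rfl⟩ := h.of_cons.2.2.1 rfl
  have p1 := t.size_pos
  have p2 := t'.size_pos
  set q := p + t.size with hq
  have e : entry p (lab (tr t :: num 1 :: tr t' :: X')) (q + 1) = 1 := by
    rw [entry_lab_tr_of_lt h.of_cons.lab_ne_nil (by omega), lab_one, entry_cons, entry_cons,
      entry_of_lt _ (by omega), if_neg (by omega), if_pos (by omega)]
  have m1 : ({0, p, q} : Finset ℕ) ∈ fan p (shapes (tr t :: num 1 :: tr t' :: X')) := by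
    simp [fan, hq]
  have m2 : ({0, q, q + 1} : Finset ℕ) ∈ fan p (shapes (tr t :: num 1 :: tr t' :: X')) := by
    simp [fan, hq, Tr.size]
  have m3 : ({0, q + 1, q + 2} : Finset ℕ) ∈ fan p (shapes (tr t :: num 1 :: tr t' :: X')) := by
    simp [fan, hq, Tr.size, Nat.add_assoc]
  have m4 : ({0, q + 2, q + 2 + t'.size} : Finset ℕ) ∈
      fan p (shapes (tr t :: num 1 :: tr t' :: X')) := by
    simp [fan, hq, Tr.size, Nat.add_assoc]
  have key : ∀ a b c : ℕ, 0 < a → a < b → b < c → (({0, a, b} : Finset ℕ) ∩ {0, b, c}).card = 2 ∧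
      ({0, a, b} : Finset ℕ) ≠ {0, b, c} := by
    intro a b c ha hb hc
    constructor
    · rw [show (({0, a, b} : Finset ℕ) ∩ {0, b, c}) = {0, b} by ext x; simp; omega,
        Finset.card_pair (by omega)]
    · intro h
      have := Finset.ext_iff.1 h a
      simp at this
      omega
  have hv : v = q ∨ v = q + 1 ∨ v = q + 2 := by omega
  rcases hv with rfl | rfl | rfl
  · have k := key p q (q + 1) (by omega) (by omega) (by omega)
    exact ⟨_, m1, _, m2, by simp, by simp, k.2, k.1, q + 1, by simp, by omega, e⟩
  · have k := key q (q + 1) (q + 2) (by omega) (by omega) (by omega)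
    exact ⟨_, m2, _, m3, by simp, by simp, k.2, k.1, q + 1, by simp, by omega, e⟩
  · have k := key (q + 1) (q + 2) (q + 2 + t'.size) (by omega) (by omega) (by omega)
    exact ⟨_, m3, _, m4, by simp, by simp, k.2, k.1, q + 1, by simp, by omega, e⟩

theorem Valid.linkedFrom : ∀ {X : List Item}, Valid X → (∀ X', X ≠ num 1 :: X') → ∀ {p v}, 1 ≤ p →
    excess p X v ≠ 0 → LinkedFrom p X v
  | [], _, _, _, _, _, h => absurd rfl h
  | num 0 :: X, h, _, _, _, _, _ => absurd h.2.1 (by omega)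
  | num 1 :: X, _, h1, _, _, _, _ => absurd rfl (h1 X)
  | num (x + 2) :: X, h, _, p, v, hp, he => by
    rw [excess_add_two] at he
    exact h.linkedFrom_num (h.of_cons.linkedFrom h.2.2.2 (by omega) he)
  | tr t :: [], _, _, _, _, _, he => absurd rfl he
  | tr t :: tr t' :: X, h, _, _, _, _, _ => absurd rfl (h.2.2.2 t' X)
  | tr t :: num 0 :: X, h, _, _, _, _, _ => absurd h.1.2.1 (by omega)
  | tr t :: num (x + 2) :: X, h, _, p, v, hp, he => by
    rw [excess_tr] at he
    exact h.linkedFrom_tr (h.of_cons.linkedFrom (by simp) (by omega) he)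
  | tr t :: num 1 :: X, h, _, p, v, hp, he => by
    by_cases hv : p + t.size ≤ v ∧ v ≤ p + t.size + 2
    · exact h.linkedFrom_one hp hv.1 hv.2
    · rw [excess_tr, excess_one, if_neg hv, Nat.zero_add] at he
      obtain ⟨t', X', hX⟩ := h.of_cons.2.2.1 rfl
      have := h.of_cons.of_cons.linkedFrom (p := p + t.size + 2) (v := v) (by simp [hX])
        (by omega) he
      refine h.linkedFrom_tr (this.append (by omega) ?_ ?_)
      · rw [shapes_one]
        exact (fan_subset_cons (p + t.size + 1) leaf _).trans (fan_subset_cons _ leaf _)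
      · intro j hj
        rw [lab_one, entry_cons, entry_cons, if_neg (by omega), if_neg (by omega), Nat.zero_add,
          Nat.zero_add]

theorem Valid.bound {X : List Item} (h : Valid X) (h1 : ∀ X', X ≠ num 1 :: X') (v : ℕ)
    (hv : 1 ≤ v) : ((fan 1 (shapes X)).filter (v ∈ ·)).card ≤ entry 1 (lab X) v ∨
      ((fan 1 (shapes X)).filter (v ∈ ·)).card ≤ entry 1 (lab X) v + 1 ∧
        LinkedAt (fan 1 (shapes X)) (lab X) v := by
  have h2 := h.card_filter_le 1 v le_rfl hv
  have h3 := h.excess_le 1 v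
  by_cases h0 : excess 1 X v = 0
  · left; omega
  · right
    refine ⟨by omega, ?_⟩
    obtain ⟨S, hS, T, hT, g1, g2, g3, g4, j, hj, -, g5⟩ := h.linkedFrom h1 le_rfl h0
    exact ⟨S, hS, T, hT, g1, g2, g3, g4, j, hj, g5⟩

end PRes

namespace PRes
open Item Tr

/-! ### Sequences of items are determined by labels and triangles -/

theorem Tr.eq_of_strip_of_mid {t t' : Tr} (hs : t.strip = t'.strip) (hm : t.mid = t'.mid) :
    t = t' := by
  induction t generalizing t' with
  | leaf => exact (strip_eq_leaf.1 hs.symm).symm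
  | node l d r hl hr =>
    cases t' with
    | leaf => simp [strip] at hs
    | node l' d' r' =>
      simp only [strip, node.injEq, true_and] at hs
      have h1 : l.size = l'.size := by rw [← size_strip, hs.1, size_strip]
      have h2 := l.length_mid
      have h3 := l'.length_mid
      obtain ⟨e1, e2⟩ := List.append_inj hm (by omega)
      simp only [List.cons.injEq] at e2
      have f1 : l.last = l'.last := by rw [← last_strip, hs.1, last_strip]
      have f2 : r.first = r'.first := by rw [← first_strip, hs.2, first_strip]
      rw [hl hs.1 e1, hr hs.2 e2.2, show d = d' by omega]

theorem Tr.first_pos {t : Tr} (h : t ≠ leaf) : 1 ≤ t.first := by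
  cases t with
  | leaf => exact absurd rfl h
  | node l d r => simp [first]

theorem alphaRight_injective' {a b : List ℕ} (h : alphaRight a = alphaRight b) : a = b := by
  cases a <;> cases b <;> simp_all [alphaRight]

theorem Valid.two_le_head : ∀ {X : List Item}, Valid X → X ≠ [] → (∀ X', X ≠ num 1 :: X') →
    ∃ y q, lab X = (y + 2) :: q
  | [], _, h, _ => absurd rfl h
  | num 0 :: X, h, _, _ => absurd h.2.1 (by omega)
  | num 1 :: X, _, _, h => absurd rfl (h X)
  | num 2 :: X, h, _, _ => by
    obtain ⟨y, q, hy⟩ := List.exists_cons_of_ne_nil h.of_cons.lab_ne_nil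
    have := h.of_cons.isW_lab y (by simp [hy])
    obtain ⟨z, rfl⟩ := Nat.exists_eq_add_of_le' this
    exact ⟨z, q, by rw [lab_add_two, hy]; rfl⟩
  | num (x + 3) :: X, h, _, _ => ⟨0, _, by rw [lab_add_two]; rfl⟩
  | tr t :: X, h, _, _ => by
    obtain ⟨y, q, hy⟩ := List.exists_cons_of_ne_nil h.of_cons.lab_ne_nil
    obtain ⟨z, hz⟩ := Nat.exists_eq_add_of_le' (first_pos h.2.2.1)
    exact ⟨z, _, by rw [lab_tr hy, hz]; rfl⟩

theorem Valid.first_lt_head : ∀ {X : List Item}, Valid X → ∀ {t s}, shapes X = t :: s → t ≠ leaf →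
    ∃ y q, lab X = (t.first + 1 + y) :: q
  | [], _, _, _, h, _ => by simp at h
  | num 0 :: X, h, _, _, _, _ => absurd h.2.1 (by omega)
  | num 1 :: X, _, _, _, h, h0 => by
    simp only [shapes_one, List.cons.injEq] at h
    exact absurd h.1.symm h0
  | num 2 :: X, h, _, _, hs, h0 => by
    obtain ⟨y, q, hy⟩ := h.of_cons.first_lt_head hs h0
    exact ⟨y + 1, q, by rw [lab_add_two, hy]; rfl⟩
  | num (x + 3) :: X, _, _, _, h, h0 => by
    rw [shapes_add_two, List.replicate_succ] at h
    simp only [List.cons_append, List.cons.injEq] at h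
    exact absurd h.1.symm h0
  | tr t :: X, h, _, _, hs, h0 => by
    obtain ⟨y, q, hy⟩ := List.exists_cons_of_ne_nil h.of_cons.lab_ne_nil
    simp only [shapes_tr, List.cons.injEq] at hs
    obtain ⟨rfl, -⟩ := hs
    exact ⟨0, _, by rw [lab_tr hy, first_strip]; rfl⟩

/-- The head of the sequence of labels shows whether the first polygon is preceded by an entry. -/
theorem Valid.num_ne_tr {x : ℕ} {t : Tr} {X X' : List Item} (h : Valid (num (x + 2) :: X))
    (h' : Valid (tr t :: X')) (hs : shapes (num (x + 2) :: X) = shapes (tr t :: X')) :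
    lab (num (x + 2) :: X) ≠ lab (tr t :: X') := by
  intro hl
  obtain ⟨y, q, hy⟩ := List.exists_cons_of_ne_nil h'.of_cons.lab_ne_nil
  rw [lab_tr hy] at hl
  cases x with
  | zero =>
    obtain ⟨z, q', hz⟩ := h.of_cons.first_lt_head hs (by simpa using h'.2.2.1)
    rw [lab_add_two, hz] at hl
    simp at hl
    omega
  | succ x =>
    rw [shapes_add_two, List.replicate_succ] at hs
    simp only [List.cons_append, shapes_tr, List.cons.injEq] at hs
    exact h'.2.2.1 (strip_eq_leaf.1 hs.1.symm)

theorem Valid.num_ne_nil {x : ℕ} {X : List Item} (h : Valid (num (x + 2) :: X)) :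
    lab (num (x + 2) :: X) ≠ lab [] := by
  obtain ⟨y, q, hy⟩ := h.two_le_head (by simp) (by simp)
  rw [hy]
  simp

theorem Valid.ext_num {x y : ℕ} {X Y : List Item} (hX : Valid (num (x + 2) :: X))
    (hY : Valid (num (y + 2) :: Y))
    (hs : shapes (num (x + 2) :: X) = shapes (num (y + 2) :: Y))
    (hl : lab (num (x + 2) :: X) = lab (num (y + 2) :: Y)) :
    x = y ∧ shapes X = shapes Y ∧ lab X = lab Y := by
  -- A leading entry `2` raises a head label that is already at least `2`, whereas a leading entry ≥
  -- 3 gives the head label exactly `2`.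
  have aux : ∀ {y : ℕ} {X Y : List Item}, Valid (num 2 :: X) → Valid (num (y + 3) :: Y) →
      shapes (num 2 :: X) = shapes (num (y + 3) :: Y) →
      lab (num 2 :: X) ≠ lab (num (y + 3) :: Y) := by
    intro y X Y hX hY hs hl
    rw [shapes_add_two 0, shapes_add_two, List.replicate_succ] at hs
    rw [lab_add_two 0, lab_add_two, List.replicate_succ] at hl
    simp only [List.replicate_zero, List.nil_append, List.cons_append] at hs hl
    obtain ⟨z, q, hz⟩ := hX.of_cons.two_le_head (by rintro rfl; simp at hs) hX.2.2.2
    rw [hz] at hl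
    simp at hl
  induction x generalizing y with
  | zero =>
    cases y with
    | zero => exact ⟨rfl, hs, alphaRight_injective' hl⟩
    | succ y => exact absurd hl (aux hX hY hs)
  | succ x ih =>
    cases y with
    | zero => exact absurd hl.symm (aux hY hX hs.symm)
    | succ y =>
      rw [shapes_add_two, shapes_add_two, List.replicate_succ, List.replicate_succ] at hs
      rw [lab_add_two, lab_add_two, List.replicate_succ, List.replicate_succ] at hl
      simp only [List.cons_append, List.cons.injEq, true_and] at hs hl
      obtain ⟨rfl, h1, h2⟩ := ih hX.cons_num_sub hY.cons_num_sub hs hl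
      exact ⟨rfl, h1, h2⟩

theorem Valid.ext_tr {t t' : Tr} {X Y : List Item} (hX : Valid (tr t :: X))
    (hY : Valid (tr t' :: Y)) (hs : shapes (tr t :: X) = shapes (tr t' :: Y))
    (hl : lab (tr t :: X) = lab (tr t' :: Y)) :
    t = t' ∧ shapes X = shapes Y ∧ lab X = lab Y := by
  obtain ⟨y, q, hy⟩ := List.exists_cons_of_ne_nil hX.of_cons.lab_ne_nil
  obtain ⟨y', q', hy'⟩ := List.exists_cons_of_ne_nil hY.of_cons.lab_ne_nil
  rw [lab_tr hy, lab_tr hy'] at hl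
  simp only [shapes_tr, List.cons.injEq] at hs
  have h1 : t.size = t'.size := by rw [← size_strip, hs.1, size_strip]
  have h2 := t.length_mid
  have h3 := t'.length_mid
  have h4 : t.last = t'.last := by rw [← last_strip, hs.1, last_strip]
  simp only [List.cons_append, List.cons.injEq] at hl
  obtain ⟨e1, e2⟩ := List.append_inj hl.2 (by omega)
  simp only [List.cons.injEq] at e2
  refine ⟨eq_of_strip_of_mid hs.1 e1, hs.2, ?_⟩
  rw [hy, hy', e2.2, show y = y' by omega]

/-- The list can be read from the left. The first polygon and the head label tell which kind of item
comes first; the labels inside a polygon give its defects, and its last label, less the part due to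
the polygon, is the head label of the rest. -/
theorem Valid.ext : ∀ {X Y : List Item}, Valid X → Valid Y → (∀ X', X ≠ num 1 :: X') →
    (∀ Y', Y ≠ num 1 :: Y') → shapes X = shapes Y → lab X = lab Y → X = Y
  | num 0 :: X, _, h, _, _, _, _, _ => absurd h.2.1 (by omega)
  | num 1 :: X, _, _, _, h, _, _, _ => absurd rfl (h X)
  | _, num 0 :: X, _, h, _, _, _, _ => absurd h.2.1 (by omega)
  | _, num 1 :: X, _, _, _, h, _, _ => absurd rfl (h X)
  | [], [], _, _, _, _, _, _ => rfl
  | [], tr t :: Y, _, _, _, _, hs, _ => by simp at hs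
  | tr t :: X, [], _, _, _, _, hs, _ => by simp at hs
  | [], num (x + 2) :: Y, _, hY, _, _, _, hl => absurd hl.symm hY.num_ne_nil
  | num (x + 2) :: X, [], hX, _, _, _, _, hl => absurd hl hX.num_ne_nil
  | num (x + 2) :: X, num (y + 2) :: Y, hX, hY, _, _, hs, hl => by
    obtain ⟨rfl, h1, h2⟩ := hX.ext_num hY hs hl
    rw [hX.of_cons.ext hY.of_cons hX.2.2.2 hY.2.2.2 h1 h2]
  | num (x + 2) :: X, tr t :: Y, hX, hY, _, _, hs, hl => absurd hl (hX.num_ne_tr hY hs)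
  | tr t :: X, num (y + 2) :: Y, hX, hY, _, _, hs, hl =>
    absurd hl.symm (hY.num_ne_tr hX hs.symm)
  | tr t :: X, tr t' :: Y, hX, hY, _, _, hs, hl => by
    obtain ⟨rfl, h1, h2⟩ := hX.ext_tr hY hs hl
    -- For nonempty lists the head label is `1` only if an entry `1` comes first.
    have aux : ∀ {W Z : List Item}, Valid (num 1 :: W) → Valid Z → shapes (num 1 :: W) = shapes Z →
        lab (num 1 :: W) = lab Z → ∃ Z', Z = num 1 :: Z' := by
      intro W Z hW hZ hs hl
      by_contra h
      push Not at h
      obtain ⟨y, q, hy⟩ := hZ.two_le_head (by rintro rfl; simp at hs) h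
      rw [lab_one, hy] at hl
      simp at hl
    by_cases hX1 : ∃ X', X = num 1 :: X'
    · obtain ⟨X', rfl⟩ := hX1
      obtain ⟨Y', rfl⟩ := aux hX.of_cons hY.of_cons h1 h2
      obtain ⟨t₁, W, e1⟩ := hX.of_cons.2.2.1 rfl
      obtain ⟨t₂, W', e2⟩ := hY.of_cons.2.2.1 rfl
      simp only [shapes_one, lab_one, List.cons.injEq, true_and] at h1 h2
      rw [hX.of_cons.of_cons.ext hY.of_cons.of_cons (by simp [e1]) (by simp [e2]) h1 h2]
    · by_cases hY1 : ∃ Y', Y = num 1 :: Y'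
      · obtain ⟨Y', rfl⟩ := hY1
        exact absurd (aux hY.of_cons hX.of_cons h1.symm h2.symm) hX1
      · push Not at hX1 hY1
        rw [hX.of_cons.ext hY.of_cons hX1 hY1 h1 h2]

/-! ### Existence of sequences of items with given labels and triangles -/

/-- The defects are the differences of the prescribed labels and the numbers of triangles; labels ≥
2 make the polygon `Good`. -/
theorem Tr.exists_mid {t : Tr} (ht : t.strip = t) {m : List ℕ} (hm : List.Forall₂ (· ≤ ·) t.mid m)
    (h2 : ∀ x ∈ m, 2 ≤ x) : ∃ t' : Tr, t'.strip = t ∧ t'.mid = m ∧ t'.Good := by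
  induction t generalizing m with
  | leaf =>
    cases hm
    exact ⟨leaf, rfl, rfl, trivial⟩
  | node l d r hl hr =>
    simp only [strip, node.injEq] at ht
    obtain ⟨hsl, rfl, hsr⟩ := ht
    rw [mid] at hm
    obtain ⟨m₁, m', h3, h4, rfl⟩ : ∃ m₁ m', List.Forall₂ (· ≤ ·) l.mid m₁ ∧
        List.Forall₂ (· ≤ ·) ((l.last + r.first + 1 + 0) :: r.mid) m' ∧ m = m₁ ++ m' :=
      ⟨_, _, (List.forall₂_take_append _ _ _ hm.flip).flip,
        (List.forall₂_drop_append _ _ _ hm.flip).flip, (List.take_append_drop _ _).symm⟩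
    cases h4 with
    | @cons _ x _ m₂ hx h4 =>
      obtain ⟨l', e1, e2, e3⟩ := hl hsl h3 fun x hx => h2 x (by simp [hx])
      obtain ⟨r', f1, f2, f3⟩ := hr hsr h4 fun x hx => h2 x (by simp [hx])
      have g1 : l'.last = l.last := by rw [← last_strip, e1]
      have g2 : r'.first = r.first := by rw [← first_strip, f1]
      have := h2 x (by simp)
      refine ⟨node l' (x - (l.last + r.first + 1)) r', by rw [strip, e1, f1], ?_, e3, f3, ?_⟩
      · rw [mid, e2, f2, g1, g2]
        congr 2
        omega
      · rintro rfl rfl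
        simp only [last, first] at g1 g2
        omega

theorem IsCode.replicate_two (n : ℕ) {X : List Item} (h : IsCode X) :
    IsCode (List.replicate n (num 2) ++ X) := by
  induction n with
  | zero => exact h
  | succ n ih => exact ih.cons_num le_rfl

theorem shapes_replicate_two (n : ℕ) (X : List Item) :
    shapes (List.replicate n (num 2) ++ X) = shapes X := by
  induction n with
  | zero => rfl
  | succ n ih => exact ih

theorem lab_replicate_two (n : ℕ) {X : List Item} {y : ℕ} {q : List ℕ} (h : lab X = y :: q) :
    lab (List.replicate n (num 2) ++ X) = (y + n) :: q := by
  induction n with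
  | zero => exact h
  | succ n ih =>
    rw [List.replicate_succ, List.cons_append, lab_add_two 0, ih]
    rfl

/-- Recursion along the edges opposite to `0`. A single edge increases the first entry of the
remaining code, a polygon becomes an item, and a surplus of the head label becomes a sequence of
entries `2`. The head label `y` may be `1` only after a polygon has used up its share of the label;
hence it is bounded separately from `q`. -/
theorem exists_code_of_bound : ∀ {s : List Tr}, s.map strip = s → ∀ {p y : ℕ} {q : List ℕ}, 1 ≤ p →
    (y :: q).length = total s + 1 → 1 ≤ y → (∀ x ∈ q, 2 ≤ x) →
    (∀ s', s = leaf :: s' → 2 ≤ y) →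
    (∀ v, p ≤ v → ((fan p s).filter (v ∈ ·)).card ≤ entry p (y :: q) v) →
    ∃ X, IsCode X ∧ lab X = y :: q ∧ shapes X = s
  | [], _, p, y, q, hp, hlen, hy, h2, hl, hb => by
    obtain rfl : q = [] := by simpa using hlen
    -- Only the vertex v_k is left. `lab []` gives it the label `1`, and `z` entries `2` add the
    -- rest.
    obtain ⟨z, rfl⟩ := Nat.exists_eq_add_of_le hy
    exact ⟨_, isCode_nil.replicate_two z, lab_replicate_two z lab_nil, shapes_replicate_two z []⟩
  | leaf :: s, hs, p, y, q, hp, hlen, hy, h2, hl, hb => by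
    have hs' : s.map strip = s := by simpa [strip] using hs
    cases q with
    | nil => simp [Tr.size] at hlen
    | cons z q =>
      have hz := h2 z (by simp)
      have hy := hl s rfl
      obtain ⟨Y, hY, hlY, hsY⟩ := exists_code_of_bound hs' (p := p + 1) (y := z) (q := q) (by omega)
        (by simp [Tr.size] at hlen ⊢; omega) (by omega) (fun x hx => h2 x (by simp [hx]))
        (fun _ _ => hz) (by
          intro v hv
          have := hb v (by omega)
          rw [card_filter_fan_leaf p hp _ v (by omega), entry_cons,
            if_neg (show ¬ v = p by omega), if_neg (show ¬ v = p by omega)] at this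
          omega)
      -- If the remaining code began with a polygon, its head label would be exhausted by the
      -- triangles of that polygon; the fan triangle of the single edge at the same vertex then
      -- violates the bound. So it begins with an entry, which can be increased.
      have hb1 := hb (p + 1) (by omega)
      rw [card_filter_fan_leaf p hp _ _ (by omega), entry_cons, entry_cons, entry_of_lt _ (by omega),
        if_neg (show ¬ p + 1 = p by omega), if_neg (show ¬ p + 1 = p by omega), if_pos rfl,
        if_pos rfl] at hb1
      match Y, hY with
      | [], _ => simp at hlY; omega
      | num 0 :: W, hY => exact absurd (hY.ok (num 0) (by simp)) (by simp [Item.Ok])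
      | num 1 :: W, hY => exact absurd (hY.ok (num 1) (by simp)) (by simp [Item.Ok])
      | num (x + 2) :: W, hY =>
        obtain ⟨k, rfl⟩ := Nat.exists_eq_add_of_le hy
        rw [shapes_add_two] at hsY
        rw [lab_add_two] at hlY
        have h3 : IsCode (num (x + 3) :: W) := hY.of_cons.cons_num (by omega)
        refine ⟨_, h3.replicate_two k, lab_replicate_two k ?_, ?_⟩
        · rw [lab_add_two, List.replicate_succ, List.cons_append, hlY]
        · rw [shapes_replicate_two, shapes_add_two, List.replicate_succ, List.cons_append, hsY]
      | tr t :: W, hY =>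
        exfalso
        obtain ⟨y', q', hy'⟩ := List.exists_cons_of_ne_nil hY.valid.of_cons.lab_ne_nil
        rw [lab_tr hy'] at hlY
        simp only [List.cons_append, List.cons.injEq] at hlY
        rw [← hsY, shapes_tr, card_filter_fan_cons_mem _ (by omega) _ _ _ (by omega), strip_strip,
          entry_full, if_pos rfl, first_strip, if_pos rfl] at hb1
        omega
  | node l d r :: s, hs, p, y, q, hp, hlen, hy, h2, hl, hb => by
    set t := node l d r with ht
    have hs' : t.strip = t ∧ s.map strip = s := by simpa using hs
    have p1 := t.size_pos
    have hml := t.length_mid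
    -- Here `m` labels the interior vertices of the polygon `t` and `z` its last vertex. The rest of
    -- the code receives `z - t.last` as head label.
    obtain ⟨m, z, q', rfl, hm⟩ : ∃ m z q', q = m ++ z :: q' ∧ m.length + 1 = t.size := by
      simp only [List.length_cons, total_cons] at hlen
      refine ⟨q.take (t.size - 1), q[t.size - 1]'(by omega), q.drop (t.size - 1 + 1), ?_, ?_⟩
      · rw [← List.drop_eq_getElem_cons (by omega), List.take_append_drop]
      · simp; omega
    have hc : ∀ v, p ≤ v → (if v = p then 1 else 0) + (if v = p + t.size then 1 else 0) +
        entry p t.full v + ((fan (p + t.size) s).filter (v ∈ ·)).card ≤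
        (if v = p then y else 0) + entry (p + 1) m v + entry (p + t.size) (z :: q') v := by
      intro v hv
      have := hb v hv
      rw [card_filter_fan_cons_mem p hp _ _ v (by omega), hs'.1, entry_cons, entry_append,
        show p + 1 + m.length = p + t.size by omega] at this
      omega
    have hmid : List.Forall₂ (· ≤ ·) t.mid m := by
      rw [List.forall₂_iff_get]
      refine ⟨by omega, fun i h1 h3 => ?_⟩
      have h4 := hc (p + 1 + i) (by omega)
      rw [entry_full, if_neg (by omega), if_neg (by omega), if_neg (by omega), if_neg (by omega),
        if_neg (by omega), entry_of_lt (z :: q') (by omega)] at h4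
      simp only [entry, show p + 1 ≤ p + 1 + i by omega, if_true,
        show p + 1 + i - (p + 1) = i by omega, List.getD_eq_getElem _ _ h1,
        List.getD_eq_getElem _ _ h3] at h4
      simp only [List.get_eq_getElem]
      omega
    obtain ⟨t', e1, e2, e3⟩ := exists_mid hs'.1 hmid fun x hx => h2 x (by simp [hx])
    have f1 : t'.first = t.first := by rw [← first_strip, e1]
    have f2 : t'.last = t.last := by rw [← last_strip, e1]
    have ht0 : t' ≠ leaf := by rintro rfl; rw [ht] at e1; simp [strip] at e1
    have hfirst : t.first + 1 ≤ y := by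
      have := hc p le_rfl
      rw [entry_full, if_pos rfl, if_pos rfl, if_pos rfl, entry_of_lt m (by omega),
        entry_of_lt (z :: q') (by omega)] at this
      omega
    have hz := hc (p + t.size) (by omega)
    rw [entry_full, if_pos rfl, if_neg (by omega), if_neg (by omega), if_pos rfl, if_neg (by omega),
      entry_of_ge m (by omega), entry_cons, if_pos rfl, entry_of_lt q' (by omega)] at hz
    have hleaf : ∀ s', s = leaf :: s' → 2 ≤ z - t.last := by
      rintro s' rfl
      rw [card_filter_fan_leaf _ (by omega) _ _ (by omega), if_pos rfl] at hz
      omega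
    obtain ⟨Y, hY, hlY, hsY⟩ := exists_code_of_bound hs'.2 (p := p + t.size) (y := z - t.last)
      (q := q') (by omega) (by simp at hlen ⊢; omega) (by omega)
      (fun x hx => h2 x (by simp [hx])) hleaf (by
        intro v hv
        have := hc v (by omega)
        rw [entry_full, entry_of_ge m (by omega), entry_cons, if_neg (show ¬ v = p by omega),
          if_neg (show ¬ v = p by omega), if_neg (show ¬ v = p by omega)] at this
        rw [entry_cons]
        split_ifs at * <;> omega)
    have hne : ∀ t' X', Y ≠ tr t' :: X' := by
      rintro t₁ W rfl
      obtain ⟨y', q'', hy'⟩ := List.exists_cons_of_ne_nil hY.valid.of_cons.lab_ne_nil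
      rw [lab_tr hy'] at hlY
      simp only [List.cons_append, List.cons.injEq] at hlY
      rw [← hsY, shapes_tr, card_filter_fan_cons_mem _ (by omega) _ _ _ (by omega), strip_strip,
        entry_full t₁.strip, if_pos rfl, first_strip, if_pos rfl] at hz
      omega
    obtain ⟨k, rfl⟩ := Nat.exists_eq_add_of_le hfirst
    refine ⟨_, (hY.cons_tr e3 ht0 hne).replicate_two k, lab_replicate_two k ?_, ?_⟩
    · rw [lab_tr hlY, f1, e2, f2, show t.last + (z - t.last) = z by omega]
      rfl
    · rw [shapes_replicate_two, shapes_tr, e1, hsY]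

end PRes

namespace PRes
open Item Tr

/-! ### Graphs of type T and their log discrepancies -/

/-- The graphs from which the graphs of type T are built belong to the empty word, with defect one
less than the middle entry. -/
theorem R_two_two (k : ℕ) : R [2, k + 2, 2] = (path [] (k + 1)).chain := by
  have h1 : Rrev [2] = [2] := by simp [Rrev]
  have h2 : Rrev [k + 2, 2] = List.replicate k 2 ++ [3] := by
    rw [Rrev_add_two, if_neg (by simp), h1]; rfl
  have h3 : Rrev [2, k + 2, 2] = alphaRight (List.replicate k 2 ++ [3]) := by
    rw [Rrev_add_two 0, if_neg (by simp), h2]; rfl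
  rw [R, path_chain_nil, show ([2, k + 2, 2] : List ℕ).reverse = [2, k + 2, 2] from rfl, h3,
    reverse_alphaRight, List.reverse_append, List.reverse_replicate]
  cases k with
  | zero => rfl
  | succ k =>
    rw [List.replicate_succ, List.replicate_succ]
    simp only [List.reverse_singleton, List.singleton_append]
    rw [alphaRight_alphaLeft]
    rfl

theorem isTypeT_path (w : List Bool) {d : ℕ} (hd : 1 ≤ d) : IsTypeT (path w d).chain := by
  induction w with
  | nil =>
    obtain ⟨k, rfl⟩ := Nat.exists_eq_add_of_le' hd
    rw [← R_two_two]
    exact .first _ (by omega)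
  | cons b w ih =>
    cases b
    · rw [path_chain_false w hd]; exact .second_left _ ih
    · rw [path_chain_true w hd]; exact .second_right _ ih

theorem IsTypeT.exists_path {c : List ℕ} (h : IsTypeT c) :
    ∃ w d, 1 ≤ d ∧ c = (path w d).chain := by
  induction h with
  | first a ha =>
    obtain ⟨k, rfl⟩ := Nat.exists_eq_add_of_le' ha
    exact ⟨[], k + 1, by omega, R_two_two k⟩
  | second_left b _ ih =>
    obtain ⟨w, d, hd, rfl⟩ := ih
    exact ⟨false :: w, d, hd, (path_chain_false w hd).symm⟩
  | second_right b _ ih =>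
    obtain ⟨w, d, hd, rfl⟩ := ih
    exact ⟨true :: w, d, hd, (path_chain_true w hd).symm⟩

theorem path_chain_ne_nil (w : List Bool) {d : ℕ} (hd : 1 ≤ d) : (path w d).chain ≠ [] :=
  Tr.chain_ne_nil (path_good w hd) (path_ne_leaf w d)

theorem exists_three_le_alphaRight {a : List ℕ} (h : ∃ x ∈ a, 3 ≤ x) : ∃ x ∈ alphaRight a, 3 ≤ x := by
  obtain ⟨x, hx, h3⟩ := h
  cases a with
  | nil => simp at hx
  | cons y a =>
    rcases List.mem_cons.1 hx with rfl | hx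
    · exact ⟨x + 1, by simp [alphaRight], by omega⟩
    · exact ⟨x, by simp [alphaRight, hx], h3⟩

theorem exists_three_le_alphaLeft {a : List ℕ} (h : ∃ x ∈ a, 3 ≤ x) : ∃ x ∈ alphaLeft a, 3 ≤ x := by
  obtain ⟨x, hx, h3⟩ := exists_three_le_alphaRight (a := a.reverse) (by simpa using h)
  exact ⟨x, by simpa [alphaLeft] using hx, h3⟩

/-- Separates graphs of type T from chains of -2-nodes, so an interval of contracted nodes is of one
type only. -/
theorem path_chain_not_two (w : List Bool) {d : ℕ} (hd : 1 ≤ d) : ∃ x ∈ (path w d).chain, 3 ≤ x := by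
  induction w with
  | nil =>
    rw [path_chain_nil, alphaRight_alphaLeft]
    obtain ⟨k, rfl⟩ := Nat.exists_eq_add_of_le' hd
    exact exists_three_le_alphaLeft ⟨3, by simp [List.replicate_succ], le_rfl⟩
  | cons b w ih =>
    cases b
    · rw [path_chain_false w hd]
      obtain ⟨x, hx, h⟩ := exists_three_le_alphaLeft ih
      exact ⟨x, by simp [hx], h⟩
    · rw [path_chain_true w hd]
      obtain ⟨x, hx, h⟩ := exists_three_le_alphaRight ih
      exact ⟨x, by simp [hx], h⟩

/-! ### Harmonic functions on chains of type T -/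

theorem entry_alphaLeft (i : ℕ) {L : List ℕ} (h : L ≠ []) (v : ℕ) :
    entry i (alphaLeft L) v = entry i L v + if v + 1 = i + L.length then 1 else 0 := by
  obtain ⟨L, x, rfl⟩ := (List.eq_nil_or_concat L).resolve_left h
  rw [List.concat_eq_append, alphaLeft_concat, entry_append, entry_append, entry_cons, entry_cons,
    List.length_append, List.length_singleton]
  split_ifs <;> simp_all <;> omega

/-- A function on the positions `0, …, k + 1` that is harmonic on the chain `c` of length `k`. -/
def Harmonic (c : List ℕ) (m : ℕ → ℚ) : Prop :=
  ∀ i, 1 ≤ i → i ≤ c.length → (entry 1 c i : ℚ) * m i = m (i - 1) + m (i + 1)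

/-- The old boundary value becomes the value at the new node `2`, and the new boundary value is `m 0
+ m c.length`. At the new node the equation is `2 * m 0 = (m 0 + m c.length) + m 1`, which is `hs`;
at the increased last node both sides grow by `m c.length`, since the old right boundary value was
`m 0` as well. -/
theorem Harmonic.two_cons_alphaLeft {c : List ℕ} (hc : c ≠ []) {m : ℕ → ℚ} (h : Harmonic c m)
    (he : m 0 = m (c.length + 1)) (hs : m 0 = m 1 + m c.length) :
    Harmonic (2 :: alphaLeft c) (fun i => if i = 0 ∨ i = c.length + 2 then m 0 + m c.length
      else m (i - 1)) := by
  have hpos : 0 < c.length := List.length_pos_iff.2 hc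
  intro i h1 h2
  simp only [List.length_cons, length_alphaLeft] at h2
  rw [entry_cons, entry_alphaLeft _ hc]
  obtain ⟨k, rfl⟩ := Nat.exists_eq_add_of_le' h1
  have hshift : entry (1 + 1) c (k + 1) = entry 1 c k := by
    cases k with
    | zero => rw [entry_of_lt _ (by omega), entry_of_lt _ (by omega)]
    | succ k => simp [entry]
  rw [hshift]
  rcases Nat.eq_zero_or_pos k with rfl | hk
  · rw [entry_of_lt _ (by omega)]
    simp
    rw [if_neg (by omega), if_neg (by omega)]
    linarith
  · have := h k hk (by omega)
    have e1 : ¬ (k + 1 = 0 ∨ k + 1 = c.length + 2) := by omega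
    have e2 : ¬ (k + 1 - 1 = 0 ∨ k + 1 - 1 = c.length + 2) := by omega
    simp only [e1, e2, if_false, show ¬ k + 1 = 1 by omega]
    by_cases hkc : k = c.length
    · subst hkc
      rw [if_pos (show c.length + 1 + 1 = 0 ∨ c.length + 1 + 1 = c.length + 2 by omega),
        if_pos (show c.length + 1 + 1 = 1 + 1 + c.length by omega), Nat.add_sub_cancel]
      push_cast
      linarith
    · have e3 : ¬ (k + 1 + 1 = 0 ∨ k + 1 + 1 = c.length + 2) := by omega
      simp only [e3, if_false, show ¬ k + 1 + 1 = 1 + 1 + c.length by omega, Nat.add_sub_cancel]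
      push_cast
      linarith

theorem Harmonic.reverse {c : List ℕ} {m : ℕ → ℚ} (h : Harmonic c m) :
    Harmonic c.reverse (fun i => m (c.length + 1 - i)) := by
  intro i h1 h2
  rw [List.length_reverse] at h2
  rw [entry_reverse _ h1 h2]
  have := h (c.length + 1 - i) (by omega) (by omega)
  simp only
  rw [this, show c.length + 1 - i - 1 = c.length + 1 - (i + 1) by omega,
    show c.length + 1 - i + 1 = c.length + 1 - (i - 1) by omega, add_comm]

theorem entry_replicate (d x v : ℕ) : entry 1 (List.replicate d x) v =
    if 1 ≤ v ∧ v ≤ d then x else 0 := by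
  unfold entry
  by_cases h : 1 ≤ v ∧ v ≤ d
  · rw [if_pos h, if_pos h.1, List.getD_eq_getElem _ _ (by simp; omega), List.getElem_replicate]
  · rw [if_neg h]
    split_ifs
    · exact List.getD_eq_default _ _ (by simp; omega)
    · rfl

/-- The multiplicities on a chain of type T. -/
structure IsMult (w : List Bool) (c : List ℕ) (m : ℕ → ℚ) : Prop where
  harmonic : Harmonic c m
  zero : m 0 = (farey w).1 + (farey w).2
  succ : m (c.length + 1) = (farey w).1 + (farey w).2
  first : m 1 = (farey w).1
  last : m c.length = (farey w).2

theorem IsMult.false {w : List Bool} {c : List ℕ} (hc : c ≠ []) {m : ℕ → ℚ} (h : IsMult w c m) :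
    ∃ m', IsMult (false :: w) (2 :: alphaLeft c) m' := by
  have hpos : 0 < c.length := List.length_pos_iff.2 hc
  refine ⟨_, h.harmonic.two_cons_alphaLeft hc (by rw [h.zero, h.succ]) ?_, ?_, ?_, ?_, ?_⟩
  · rw [h.zero, h.first, h.last]
  · simp [h.zero, h.last, farey]
  · simp [h.zero, h.last, farey]
  · simp [h.zero, farey]
  · simp only [List.length_cons, length_alphaLeft, farey]
    rw [if_neg (by omega), ← h.last]
    rfl

theorem IsMult.reverse {w : List Bool} {c : List ℕ} {m : ℕ → ℚ} (h : IsMult w c m) :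
    IsMult (w.map not) c.reverse (fun i => m (c.length + 1 - i)) := by
  have hf : farey (w.map not) = ((farey w).2, (farey w).1) := by
    clear h
    induction w with
    | nil => rfl
    | cons b w ih => cases b <;> simp [farey, ih, add_comm]
  refine ⟨h.harmonic.reverse, ?_, ?_, ?_, ?_⟩
  · simp [hf, h.succ, add_comm]
  · simp [hf, h.zero, add_comm]
  · simp [hf, h.last]
  · simp [hf, h.first]

theorem exists_isMult (w : List Bool) {d : ℕ} (hd : 1 ≤ d) : ∃ m, IsMult w (path w d).chain m := by
  induction w with
  | nil =>
    have hne : alphaLeft (List.replicate d 2) ≠ [] := by simp; omega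
    -- The chain is (4), or 3, 2, …, 2, 3: the constant `1` with boundary value `2` is harmonic.
    refine ⟨fun i => if i = 0 ∨ i = d + 1 then 2 else 1, ?_, ?_, ?_, ?_, ?_⟩
    · intro i h1 h2
      rw [path_chain_nil] at h2 ⊢
      simp only [length_alphaRight, length_alphaLeft, List.length_replicate] at h2
      rw [entry_alphaRight _ hne, entry_alphaLeft _ (by simp; omega), entry_replicate,
        if_pos (show 1 ≤ i ∧ i ≤ d by omega), List.length_replicate]
      by_cases e1 : i = 1 <;> by_cases e2 : i = d
      · subst e2; subst e1; norm_num
      · subst e1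
        rw [if_neg (show ¬ (1 + 1 = 1 + d) by omega)]
        simp [show ¬ d = 0 by omega, show ¬ d = 1 by omega]
        norm_num
      · subst e2
        simp [e1, show i + 1 = 1 + i by omega, show ¬ i = 0 by omega, show ¬ i - 1 = 0 by omega,
          show ¬ i - 1 = 1 + i by omega]
        norm_num
      · simp [e1, show ¬ i + 1 = 1 + d by omega, show ¬ i = 0 by omega, show ¬ i - 1 = 0 by omega,
          show ¬ i - 1 = d + 1 by omega, show ¬ i = d + 1 by omega, e2]
        norm_num
    · norm_num [farey]
    · rw [path_chain_nil]; norm_num [farey]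
    · simp [farey, show ¬ d = 0 by omega]
    · rw [path_chain_nil]; simp [farey, show ¬ d = 0 by omega]
  | cons b w ih =>
    obtain ⟨m, hm⟩ := ih
    have hc := path_chain_ne_nil w hd
    cases b
    · rw [path_chain_false w hd]
      exact hm.false hc
    · rw [path_chain_true w hd]
      -- The letter `true` is the reflection of `false`, so it is treated by reflecting twice.
      obtain ⟨m', hm'⟩ := hm.reverse.false (by simpa using hc)
      have := hm'.reverse
      simp only [List.reverse_cons, reverse_alphaLeft, List.reverse_reverse, List.map_cons,
        List.map_map] at this
      have hw : (not ∘ not) = (id : Bool → Bool) := by funext b; simp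
      rw [hw, List.map_id] at this
      exact ⟨_, this⟩

/-- Entries ≥ 2 make a nonnegative harmonic function convex, so one that leaves `0` upwards keeps
increasing. -/
theorem Harmonic.pos_of_pos {c : List ℕ} (hc : IsW2 c) {m : ℕ → ℚ} (h : Harmonic c m) (h0 : m 0 = 0)
    (h1 : 0 < m 1) : 0 < m (c.length + 1) := by
  have key : ∀ i, i ≤ c.length → 0 ≤ m i ∧ m i < m (i + 1) := by
    intro i
    induction i with
    | zero => intro _; rw [h0]; exact ⟨le_rfl, h1⟩
    | succ i ih =>
      intro hi
      obtain ⟨e1, e2⟩ := ih (by omega)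
      have e3 := h (i + 1) (by omega) hi
      have e4 : (2 : ℚ) ≤ entry 1 c (i + 1) := by
        have : entry 1 c (i + 1) = c.get ⟨i, by omega⟩ := by
          simp [entry, List.getElem?_eq_getElem (show i < c.length by omega)]
        rw [this]
        exact_mod_cast hc _ (List.get_mem _ _)
      rw [Nat.add_sub_cancel] at e3
      constructor <;> nlinarith
  obtain ⟨e1, e2⟩ := key c.length le_rfl
  linarith

/-- A harmonic function is determined by its values at the ends. -/
theorem Harmonic.eq {c : List ℕ} (hc : IsW2 c) {m m' : ℕ → ℚ} (h : Harmonic c m)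
    (h' : Harmonic c m') (h0 : m 0 = m' 0) (h1 : m (c.length + 1) = m' (c.length + 1)) :
    ∀ i, i ≤ c.length + 1 → m i = m' i := by
  have sub : Harmonic c (fun i => m i - m' i) := by
    intro i h2 h3
    have := h i h2 h3
    have := h' i h2 h3
    simp only
    linarith
  have sub' : Harmonic c (fun i => m' i - m i) := by
    intro i h2 h3
    have := h i h2 h3
    have := h' i h2 h3
    simp only
    linarith
  have hone : m 1 = m' 1 := by
    rcases lt_trichotomy (m 1) (m' 1) with h2 | h2 | h2
    · have := sub'.pos_of_pos hc (by simp [h0]) (by simpa using h2)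
      linarith
    · exact h2
    · have := sub.pos_of_pos hc (by simp [h0]) (by simpa using h2)
      linarith
  have key : ∀ i, i ≤ c.length → m i = m' i ∧ m (i + 1) = m' (i + 1) := by
    intro i
    induction i with
    | zero => intro _; exact ⟨h0, hone⟩
    | succ i ih =>
      intro hi
      obtain ⟨e1, e2⟩ := ih (by omega)
      have e3 := h (i + 1) (by omega) hi
      have e4 := h' (i + 1) (by omega) hi
      rw [Nat.add_sub_cancel] at e3 e4
      refine ⟨e2, ?_⟩
      rw [e2, e1] at e3
      linarith
  intro i hi
  cases i with
  | zero => exact h0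
  | succ i => exact (key i (by omega)).2

/-! ### The pull-back of the canonical divisor -/

/-- In terms of `μ = 1 - δ` the constants cancel: K · E_i = b_i - 2 is offset by the
self-intersection and by two neighbours. The value `1` beyond both ends of the chain makes a missing
neighbour contribute `0`, so end curves need no separate formula. -/
theorem canonicalDeg_eq (b : List ℕ) (δ : Fin b.length → ℚ) (μ : ℕ → ℚ)
    (h : ∀ i : Fin b.length, δ i = 1 - μ (i.1 + 1)) (h0 : μ 0 = 1) (h1 : μ (b.length + 1) = 1)
    (i : Fin b.length) :
    canonicalDeg b δ i = (entry 1 b (i.1 + 1) : ℚ) * μ (i.1 + 1) - μ i.1 - μ (i.1 + 2) := by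
  have hw : ((Gam b).weight i : ℚ) = -(entry 1 b (i.1 + 1) : ℚ) := by
    have : entry 1 b (i.1 + 1) = b.get i := by
      simp [entry]
    rw [this]
    simp [Gam]
  have hsum : ∑ j : Fin b.length, δ j * ((Gam b).inter j i : ℚ) =
      ∑ j : Fin b.length, ((if j = i then -(δ i * (entry 1 b (i.1 + 1) : ℚ)) else 0) +
        ((if j.1 + 1 = i.1 then δ j else 0) + (if j.1 = i.1 + 1 then δ j else 0))) := by
    apply Finset.sum_congr rfl
    intro j _
    have hadj : (Gam b).graph.Adj j i ↔ j.1 + 1 = i.1 ∨ i.1 + 1 = j.1 := by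
      change (SimpleGraph.pathGraph b.length).Adj j i ↔ _
      rw [SimpleGraph.pathGraph_adj]
    by_cases hji : j = i
    · subst hji
      have e : (Gam b).inter j j = (Gam b).weight j := if_pos rfl
      rw [e, if_pos rfl, if_neg (by omega), if_neg (by omega), hw]
      ring
    · have hne : j.1 ≠ i.1 := fun h => hji (Fin.ext h)
      rw [if_neg hji]
      by_cases ha : (Gam b).graph.Adj j i
      · have e : (Gam b).inter j i = 1 := (if_neg hji).trans (if_pos ha)
        rw [e]
        rw [hadj] at ha
        rcases ha with ha | ha
        · rw [if_pos ha, if_neg (by omega)]; simp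
        · rw [if_neg (by omega), if_pos ha.symm]; simp
      · have e : (Gam b).inter j i = 0 := (if_neg hji).trans (if_neg ha)
        rw [e]
        rw [hadj] at ha
        rw [if_neg (by omega), if_neg (by omega)]; simp
  have s2 : ∑ j : Fin b.length, (if j.1 + 1 = i.1 then δ j else 0) = 1 - μ i.1 := by
    rcases Nat.eq_zero_or_pos i.1 with hi | hi
    · rw [hi, h0, Finset.sum_eq_zero]
      · simp
      · intro j _; rw [if_neg (by omega)]
    · rw [Finset.sum_eq_single (⟨i.1 - 1, by omega⟩ : Fin b.length)]
      · rw [if_pos (by simp; omega), h]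
        simp [show i.1 - 1 + 1 = i.1 by omega]
      · intro j _ hj
        rw [if_neg]
        intro h; apply hj; apply Fin.ext; simp; omega
      · simp
  have s3 : ∑ j : Fin b.length, (if j.1 = i.1 + 1 then δ j else 0) = 1 - μ (i.1 + 2) := by
    by_cases hi : i.1 + 1 < b.length
    · rw [Finset.sum_eq_single (⟨i.1 + 1, hi⟩ : Fin b.length)]
      · rw [if_pos rfl, h]
      · intro j _ hj
        rw [if_neg]
        intro h; apply hj; exact Fin.ext h
      · simp
    · rw [show i.1 + 2 = b.length + 1 by omega, h1, Finset.sum_eq_zero]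
      · simp
      · intro j _; rw [if_neg (by omega)]
  rw [canonicalDeg, hsum, Finset.sum_add_distrib, Finset.sum_add_distrib, s2, s3, hw,
    Finset.sum_ite_eq' Finset.univ i, if_pos (Finset.mem_univ i), h i]
  ring

/-- The log discrepancies `μ` for which the pull-back of the canonical divisor is
`K + ∑ (1 - μ_i) E_i`; the canonical divisor is ample. -/
structure IsAmple (b : List ℕ) (C : Finset ℕ) (μ : ℕ → ℚ) : Prop where
  one : ∀ i, i ∉ C → μ i = 1
  eq : ∀ i ∈ C, (entry 1 b i : ℚ) * μ i = μ (i - 1) + μ (i + 1)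
  lt : ∀ i, 1 ≤ i → i ≤ b.length → i ∉ C → μ (i - 1) + μ (i + 1) < entry 1 b i

theorem ample_iff (b : List ℕ) {C : Finset ℕ} (hC : C ⊆ Finset.Icc 1 b.length) :
    (∃ δ : Fin b.length → ℚ,
      (∀ i, i.1 + 1 ∉ C → δ i = 0) ∧
      (∀ i, i.1 + 1 ∈ C → canonicalDeg b δ i = 0) ∧
      (∀ i, i.1 + 1 ∉ C → 0 < canonicalDeg b δ i)) ↔ ∃ μ, IsAmple b C μ := by
  have hC' : ∀ i ∈ C, 1 ≤ i ∧ i ≤ b.length := fun i hi => Finset.mem_Icc.1 (hC hi)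
  constructor
  · rintro ⟨δ, h1, h2, h3⟩
    set μ : ℕ → ℚ := fun k => if hk : 1 ≤ k ∧ k ≤ b.length then 1 - δ ⟨k - 1, by omega⟩ else 1
      with hμ
    have e0 : μ 0 = 1 := by simp [hμ]
    have e1 : μ (b.length + 1) = 1 := by simp [hμ]
    have e2 : ∀ i : Fin b.length, δ i = 1 - μ (i.1 + 1) := by
      intro i
      have : 1 ≤ i.1 + 1 ∧ i.1 + 1 ≤ b.length := by omega
      simp only [hμ, dif_pos this]
      simp
    refine ⟨μ, ?_, ?_, ?_⟩
    · intro i hi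
      by_cases hk : 1 ≤ i ∧ i ≤ b.length
      · have := e2 ⟨i - 1, by omega⟩
        rw [h1 _ (by simpa [show i - 1 + 1 = i by omega] using hi)] at this
        simp only [show i - 1 + 1 = i by omega] at this
        linarith
      · simp only [hμ, dif_neg hk]
    · intro i hi
      obtain ⟨k, rfl⟩ := Nat.exists_eq_add_of_le' (hC' i hi).1
      have h4 := (hC' _ hi).2
      have := h2 ⟨k, by omega⟩ hi
      rw [canonicalDeg_eq b δ μ e2 e0 e1] at this
      simp only [Nat.add_sub_cancel] at this ⊢
      linarith
    · intro i hi h4 h5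
      obtain ⟨k, rfl⟩ := Nat.exists_eq_add_of_le' hi
      have h6 := h3 ⟨k, by omega⟩ h5
      have h7 := h1 ⟨k, by omega⟩ h5
      rw [canonicalDeg_eq b δ μ e2 e0 e1] at h6
      rw [e2] at h7
      have h8 : μ (k + 1) = 1 := by simp only at h7; linarith
      simp only [Nat.add_sub_cancel, h8] at h6 ⊢
      linarith
  · rintro ⟨μ, h1, h2, h3⟩
    have e0 : μ 0 = 1 := h1 0 fun h => by have := hC' 0 h; omega
    have e1 : μ (b.length + 1) = 1 := h1 _ fun h => by have := hC' _ h; omega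
    refine ⟨fun i => 1 - μ (i.1 + 1), ?_, ?_, ?_⟩
    · intro i hi
      simp [h1 _ hi]
    · intro i hi
      rw [canonicalDeg_eq b _ μ (fun _ => rfl) e0 e1]
      have := h2 _ hi
      rw [Nat.add_sub_cancel] at this
      linarith
    · intro i hi
      rw [canonicalDeg_eq b _ μ (fun _ => rfl) e0 e1]
      have := h3 _ (by omega) (by omega) hi
      rw [Nat.add_sub_cancel] at this
      rw [h1 _ hi]
      linarith

end PRes

namespace PRes
open Item Tr

/-! ### Intervals of a chain -/

theorem entry_eq_getElem? (L : List ℕ) {i : ℕ} (h : 1 ≤ i) :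
    entry 1 L i = (L[i - 1]?).getD 0 := by
  rw [entry, if_pos h, List.getD_eq_getElem?_getD]

theorem entry_drop (L : List ℕ) (k : ℕ) {i : ℕ} (h : 1 ≤ i) :
    entry 1 (L.drop k) i = entry 1 L (k + i) := by
  rw [entry_eq_getElem? _ h, entry_eq_getElem? _ (by omega), List.getElem?_drop,
    show k + i - 1 = k + (i - 1) by omega]

theorem entry_take (L : List ℕ) {k i : ℕ} (h : 1 ≤ i) (hk : i ≤ k) :
    entry 1 (L.take k) i = entry 1 L i := by
  rw [entry_eq_getElem? _ h, entry_eq_getElem? _ h, List.getElem?_take, if_pos (by omega)]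

theorem entry_slice (b : List ℕ) {l u i : ℕ} (hi : 1 ≤ i) (hu : l + i ≤ u + 1) :
    entry 1 (slice b l u) i = entry 1 b (l - 1 + i) := by
  rw [slice, entry_take _ hi (by omega), entry_drop _ _ hi]

theorem length_slice (b : List ℕ) {l u : ℕ} (hl : 1 ≤ l) (hu : u ≤ b.length) :
    (slice b l u).length = u + 1 - l := by
  rw [slice, List.length_take, List.length_drop]
  omega

theorem slice_drop (b : List ℕ) {k l u : ℕ} (hl : 1 ≤ l) :
    slice (b.drop k) l u = slice b (k + l) (k + u) := by
  rw [slice, slice, List.drop_drop, show k + (l - 1) = k + l - 1 by omega,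
    show k + u + 1 - (k + l) = u + 1 - l by omega]

theorem exists_entry_of_mem {L : List ℕ} {x : ℕ} (h : x ∈ L) :
    ∃ i, 1 ≤ i ∧ i ≤ L.length ∧ entry 1 L i = x := by
  obtain ⟨n, hn, rfl⟩ := List.getElem_of_mem h
  exact ⟨n + 1, by omega, by omega, by rw [entry_eq_getElem? _ (by omega)]; simp [hn]⟩

theorem entry_mem {L : List ℕ} {i : ℕ} (h : 1 ≤ i) (hi : i ≤ L.length) : entry 1 L i ∈ L := by
  rw [entry_eq_getElem? _ h, List.getElem?_eq_getElem (by omega)]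
  exact List.getElem_mem _

theorem exists_entry_of_mem_slice {b : List ℕ} {l u x : ℕ} (hl : 1 ≤ l) (hu : u ≤ b.length)
    (h : x ∈ slice b l u) : ∃ i, l ≤ i ∧ i ≤ u ∧ entry 1 b i = x := by
  obtain ⟨i, h1, h2, h3⟩ := exists_entry_of_mem h
  rw [length_slice b hl hu] at h2
  rw [entry_slice b h1 (by omega)] at h3
  exact ⟨_, by omega, by omega, h3⟩

theorem entry_mem_slice {b : List ℕ} {l u i : ℕ} (hl : 1 ≤ l) (hu : u ≤ b.length) (h1 : l ≤ i)
    (h2 : i ≤ u) : entry 1 b i ∈ slice b l u := by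
  have := entry_mem (L := slice b l u) (i := i + 1 - l) (by omega)
    (by rw [length_slice b hl hu]; omega)
  rwa [entry_slice b (by omega) (by omega), show l - 1 + (i + 1 - l) = i by omega] at this

theorem IsComponent.unique {C : Finset ℕ} {l u l' u' i : ℕ} (h : IsComponent C l u)
    (h' : IsComponent C l' u') (h1 : l ≤ i) (h2 : i ≤ u) (h3 : l' ≤ i) (h4 : i ≤ u') :
    l = l' ∧ u = u' := by
  constructor
  · rcases lt_trichotomy l l' with h5 | h5 | h5
    · exact absurd (h.2.1 (l' - 1) (by omega) (by omega)) h'.2.2.1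
    · exact h5
    · exact absurd (h'.2.1 (l - 1) (by omega) (by omega)) h.2.2.1
  · rcases lt_trichotomy u u' with h5 | h5 | h5
    · exact absurd (h'.2.1 (u + 1) (by omega) (by omega)) h.2.2.2
    · exact h5
    · exact absurd (h.2.1 (u' + 1) (by omega) (by omega)) h'.2.2.2

theorem exists_isComponent {C : Finset ℕ} (h0 : 0 ∉ C) {i : ℕ} (hi : i ∈ C) :
    ∃ l u, IsComponent C l u ∧ l ≤ i ∧ i ≤ u := by
  classical
  have hex : ∃ j, i ≤ j ∧ j ∉ C := by
    refine ⟨C.sup id + 1 + i, by omega, fun h => ?_⟩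
    have : C.sup id + 1 + i ≤ C.sup id := Finset.le_sup (f := id) h
    omega
  have hu := Nat.find_spec hex
  have hmin : ∀ j, i ≤ j → j < Nat.find hex → j ∈ C := by
    intro j h1 h2
    by_contra h3
    exact Nat.find_min hex h2 ⟨h1, h3⟩
  have hl : Nat.findGreatest (fun j => j ∉ C) i ∉ C :=
    Nat.findGreatest_spec (P := fun j => j ∉ C) (Nat.zero_le i) h0
  have hle := Nat.findGreatest_le (P := fun j => j ∉ C) i
  have hmax : ∀ j, Nat.findGreatest (fun j => j ∉ C) i < j → j ≤ i → j ∈ C := by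
    intro j h1 h2
    by_contra h3
    exact Nat.findGreatest_is_greatest h1 h2 h3
  set u := Nat.find hex
  set l := Nat.findGreatest (fun j => j ∉ C) i
  have hlt : l ≠ i := fun h => hl (h ▸ hi)
  have hut : u ≠ i := fun h => hu.2 (h ▸ hi)
  refine ⟨l + 1, u - 1, ⟨by omega, fun j h1 h2 => ?_, hl, ?_⟩, by omega, by omega⟩
  · rcases le_total j i with h | h
    · exact hmax j (by omega) h
    · exact hmin j h (by omega)
  · rw [show u - 1 + 1 = u by omega]; exact hu.2

/-! ### The intervals that belong to polygons -/

/-- The polygon `t` belongs to the positions `l, …, u` of the chain. -/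
def IsTee (Z : List Item) (t : Tr) (l u : ℕ) : Prop :=
  ∃ Z₁ Z₂, Z = Z₁ ++ tr t :: Z₂ ∧ l = (chain Z₁).length + 1 ∧ u = (chain Z₁).length + t.chain.length

theorem isTee_nil {t : Tr} {l u : ℕ} : ¬ IsTee [] t l u := by
  rintro ⟨Z₁, Z₂, h, -⟩
  simp at h

theorem isTee_num {x : ℕ} {Z : List Item} {t : Tr} {l u : ℕ} :
    IsTee (num x :: Z) t l u ↔ ∃ l' u', l = l' + 1 ∧ u = u' + 1 ∧ IsTee Z t l' u' := by
  constructor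
  · rintro ⟨Z₁, Z₂, h, rfl, rfl⟩
    cases Z₁ with
    | nil => simp at h
    | cons i Z₁ =>
      simp only [List.cons_append, List.cons.injEq] at h
      obtain ⟨rfl, rfl⟩ := h
      exact ⟨_, _, by simp, by simp; omega, Z₁, Z₂, rfl, rfl, rfl⟩
  · rintro ⟨l', u', rfl, rfl, Z₁, Z₂, rfl, rfl, rfl⟩
    exact ⟨num x :: Z₁, Z₂, rfl, by simp, by simp; omega⟩

theorem isTee_tr {s : Tr} {Z : List Item} {t : Tr} {l u : ℕ} :
    IsTee (tr s :: Z) t l u ↔ (t = s ∧ l = 1 ∧ u = s.chain.length) ∨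
      ∃ l' u', l = s.chain.length + l' ∧ u = s.chain.length + u' ∧ IsTee Z t l' u' := by
  constructor
  · rintro ⟨Z₁, Z₂, h, rfl, rfl⟩
    cases Z₁ with
    | nil =>
      simp only [List.nil_append, List.cons.injEq, Item.tr.injEq] at h
      obtain ⟨rfl, rfl⟩ := h
      left; simp
    | cons i Z₁ =>
      simp only [List.cons_append, List.cons.injEq] at h
      obtain ⟨rfl, rfl⟩ := h
      right
      exact ⟨_, _, by simp; omega, by simp; omega, Z₁, Z₂, rfl, rfl, rfl⟩
  · rintro (⟨rfl, rfl, rfl⟩ | ⟨l', u', rfl, rfl, Z₁, Z₂, rfl, rfl, rfl⟩)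
    · exact ⟨[], Z, rfl, rfl, by simp⟩
    · exact ⟨tr s :: Z₁, Z₂, rfl, by simp; omega, by simp; omega⟩

theorem IsTee.one_le {Z : List Item} {t : Tr} {l u : ℕ} (h : IsTee Z t l u) : 1 ≤ l := by
  obtain ⟨Z₁, Z₂, -, rfl, -⟩ := h
  omega

theorem IsTee.le_length {Z : List Item} {t : Tr} {l u : ℕ} (h : IsTee Z t l u) :
    u ≤ (chain Z).length := by
  obtain ⟨Z₁, Z₂, rfl, -, rfl⟩ := h
  simp

theorem IsTee.length_eq {Z : List Item} {t : Tr} {l u : ℕ} (h : IsTee Z t l u) :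
    u + 1 = l + t.chain.length := by
  obtain ⟨Z₁, Z₂, rfl, rfl, rfl⟩ := h
  omega

theorem IsTee.slice {Z : List Item} {t : Tr} {l u : ℕ} (h : IsTee Z t l u) :
    slice (chain Z) l u = t.chain := by
  obtain ⟨Z₁, Z₂, rfl, rfl, rfl⟩ := h
  rw [PRes.slice, chain_append, chain_tr, Nat.add_sub_cancel, List.drop_left,
    show (chain Z₁).length + t.chain.length + 1 - ((chain Z₁).length + 1) = t.chain.length by omega,
    List.take_left]

theorem Valid.append_right {Z₁ Z₂ : List Item} (h : Valid (Z₁ ++ Z₂)) : Valid Z₂ := by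
  induction Z₁ with
  | nil => exact h
  | cons i Z₁ ih => exact ih h.of_cons

theorem PItems.append_right {Z₁ Z₂ : List Item} (h : PItems (Z₁ ++ Z₂)) : PItems Z₂ := by
  induction Z₁ with
  | nil => exact h
  | cons i Z₁ ih => exact ih h.of_cons

theorem IsTee.le {Z : List Item} {t : Tr} {l u : ℕ} (h : IsTee Z t l u) (hZ : Valid Z) : l ≤ u := by
  have h1 := h.length_eq
  obtain ⟨Z₁, Z₂, rfl, -, -⟩ := h
  have := hZ.append_right
  have := List.length_pos_iff.2 (Tr.chain_ne_nil this.2.1 this.2.2.1)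
  omega

theorem IsTee.exists_path {Z : List Item} {t : Tr} {l u : ℕ} (h : IsTee Z t l u) (hZ : PItems Z) :
    ∃ w d, 1 ≤ d ∧ t = path w d := by
  obtain ⟨Z₁, Z₂, rfl, -, -⟩ := h
  obtain ⟨w, d, hd, ht, -⟩ := hZ.append_right.2
  exact ⟨w, d, hd, ht⟩

theorem IsTee.head_eq {Z : List Item} {t : Tr} {l u : ℕ} (h : IsTee Z t l u) (hZ : Valid Z)
    (hl : l ≤ 1) : ∃ Z', Z = tr t :: Z' := by
  obtain ⟨Z₁, Z₂, rfl, rfl, -⟩ := h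
  cases Z₁ with
  | nil => exact ⟨_, rfl⟩
  | cons i Z₁ =>
    exfalso
    cases i with
    | num x => simp at hl
    | tr s =>
      have := List.length_pos_iff.2 (Tr.chain_ne_nil hZ.2.1 hZ.2.2.1)
      simp at hl
      rw [hl.1] at this
      simp at this

theorem Valid.isTee_disjoint {Z : List Item} (hZ : Valid Z) {t t' : Tr} {l u l' u' : ℕ}
    (h : IsTee Z t l u) (h' : IsTee Z t' l' u') :
    (t = t' ∧ l = l' ∧ u = u') ∨ u + 1 < l' ∨ u' + 1 < l := by
  induction Z generalizing l u l' u' with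
  | nil => exact absurd h isTee_nil
  | cons i Z ih =>
    cases i with
    | num x =>
      obtain ⟨l₁, u₁, rfl, rfl, h1⟩ := isTee_num.1 h
      obtain ⟨l₂, u₂, rfl, rfl, h2⟩ := isTee_num.1 h'
      rcases ih hZ.of_cons h1 h2 with ⟨rfl, rfl, rfl⟩ | h3 | h3
      · exact Or.inl ⟨rfl, rfl, rfl⟩
      · omega
      · omega
    | tr s =>
      have key : ∀ {t l u}, IsTee Z t l u → 1 < l := by
        intro t l u h
        by_contra h1
        obtain ⟨Z', rfl⟩ := h.head_eq hZ.of_cons (by omega)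
        exact hZ.2.2.2 t Z' rfl
      rcases isTee_tr.1 h with ⟨rfl, rfl, rfl⟩ | ⟨l₁, u₁, rfl, rfl, h1⟩ <;>
        rcases isTee_tr.1 h' with ⟨rfl, rfl, rfl⟩ | ⟨l₂, u₂, rfl, rfl, h2⟩
      · exact Or.inl ⟨rfl, rfl, rfl⟩
      · have := key h2; omega
      · have := key h1; omega
      · rcases ih hZ.of_cons h1 h2 with ⟨rfl, rfl, rfl⟩ | h3 | h3
        · exact Or.inl ⟨rfl, rfl, rfl⟩
        · omega
        · omega

theorem exists_isTee_or_num (Z : List Item) {i : ℕ} (h1 : 1 ≤ i) (h2 : i ≤ (chain Z).length) :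
    (∃ t l u, IsTee Z t l u ∧ l ≤ i ∧ i ≤ u) ∨
      ∃ Z₁ x Z₂, Z = Z₁ ++ num x :: Z₂ ∧ i = (chain Z₁).length + 1 := by
  induction Z generalizing i with
  | nil => simp at h2; omega
  | cons j Z ih =>
    cases j with
    | num x =>
      rcases Nat.eq_or_lt_of_le h1 with rfl | h3
      · exact Or.inr ⟨[], x, Z, rfl, rfl⟩
      · rcases ih (i := i - 1) (by omega) (by simp at h2; omega) with
          ⟨t, l, u, h, g1, g2⟩ | ⟨Z₁, y, Z₂, rfl, hi⟩
        · exact Or.inl ⟨t, l + 1, u + 1, isTee_num.2 ⟨l, u, rfl, rfl, h⟩, by omega, by omega⟩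
        · exact Or.inr ⟨num x :: Z₁, y, Z₂, rfl, by simp; omega⟩
    | tr s =>
      rcases Nat.lt_or_ge s.chain.length i with h3 | h3
      · rcases ih (i := i - s.chain.length) (by omega) (by simp at h2; omega) with
          ⟨t, l, u, h, g1, g2⟩ | ⟨Z₁, y, Z₂, rfl, hi⟩
        · exact Or.inl ⟨t, s.chain.length + l, s.chain.length + u,
            isTee_tr.2 (Or.inr ⟨l, u, rfl, rfl, h⟩), by omega, by omega⟩
        · exact Or.inr ⟨tr s :: Z₁, y, Z₂, rfl, by simp; omega⟩
      · exact Or.inl ⟨s, 1, s.chain.length, isTee_tr.2 (Or.inl ⟨rfl, rfl, rfl⟩), h1, h3⟩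

theorem entry_chain_num (Z₁ Z₂ : List Item) (x : ℕ) :
    entry 1 (chain (Z₁ ++ num x :: Z₂)) ((chain Z₁).length + 1) = x := by
  rw [entry_eq_getElem? _ (by omega)]
  simp

/-- The values at the ends of a chain of type T of a function that is harmonic with value `1`
outside. -/
theorem eq_of_harmonic {w : List Bool} {d : ℕ} (hd : 1 ≤ d) {m : ℕ → ℚ}
    (h : Harmonic (path w d).chain m) (h0 : m 0 = 1) (h1 : m ((path w d).chain.length + 1) = 1) :
    m 1 = (farey w).1 / ((farey w).1 + (farey w).2) ∧
      m (path w d).chain.length = (farey w).2 / ((farey w).1 + (farey w).2) := by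
  obtain ⟨m', hm'⟩ := exists_isMult w hd
  have hf := farey_pos w
  have hn : ((farey w).1 + (farey w).2 : ℚ) ≠ 0 := by
    have : (0 : ℚ) < (farey w).1 := by exact_mod_cast hf.1
    positivity
  have hm : Harmonic (path w d).chain (fun i => m' i / ((farey w).1 + (farey w).2)) := by
    intro i g1 g2
    have := hm'.harmonic i g1 g2
    simp only
    rw [← add_div, ← this]
    ring
  have hpos := List.length_pos_iff.2 (path_chain_ne_nil w hd)
  have key := h.eq (path w d).chain_isW2 hm (by rw [h0, hm'.zero, div_self hn])
    (by rw [h1, hm'.succ, div_self hn])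
  refine ⟨?_, ?_⟩
  · rw [key 1 (by omega), hm'.first]
  · rw [key _ (by omega), hm'.last]

theorem exists_harmonic (w : List Bool) {d : ℕ} (hd : 1 ≤ d) :
    ∃ m, Harmonic (path w d).chain m ∧ m 0 = 1 ∧ m ((path w d).chain.length + 1) = 1 := by
  obtain ⟨m', hm'⟩ := exists_isMult w hd
  have hf := farey_pos w
  have hn : ((farey w).1 + (farey w).2 : ℚ) ≠ 0 := by
    have : (0 : ℚ) < (farey w).1 := by exact_mod_cast hf.1
    positivity
  refine ⟨fun i => m' i / ((farey w).1 + (farey w).2), fun i g1 g2 => ?_, ?_, ?_⟩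
  · have := hm'.harmonic i g1 g2
    simp only
    rw [← add_div, ← this]
    ring
  · simp only; rw [hm'.zero, div_self hn]
  · simp only; rw [hm'.succ, div_self hn]

/-- The right-hand side is ampleness on a -1-curve between the intervals for `w` and `w'`. Written
with b/(a+b) = 1 - a/(a+b), it compares the quotients of the two pairs, as `wlt_iff` does. -/
theorem wlt_iff_sum_lt (w w' : List Bool) : wlt w w' ↔
    ((farey w).2 / ((farey w).1 + (farey w).2) + (farey w').1 / ((farey w').1 + (farey w').2) : ℚ)
      < 1 := by
  have hf := farey_pos w
  have hf' := farey_pos w'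
  rw [wlt_iff]
  have a1 : (0 : ℚ) < (farey w).1 := by exact_mod_cast hf.1
  have a2 : (0 : ℚ) < (farey w).2 := by exact_mod_cast hf.2
  have a3 : (0 : ℚ) < (farey w').1 := by exact_mod_cast hf'.1
  have a4 : (0 : ℚ) < (farey w').2 := by exact_mod_cast hf'.2
  rw [div_add_div _ _ (by positivity) (by positivity), div_lt_one (by positivity),
    ← Nat.cast_lt (α := ℚ)]
  push_cast
  constructor <;> intro h <;> nlinarith

theorem farey_div_pos (w : List Bool) :
    (0 : ℚ) < (farey w).1 / ((farey w).1 + (farey w).2) ∧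
    (0 : ℚ) < (farey w).2 / ((farey w).1 + (farey w).2) ∧
    ((farey w).1 / ((farey w).1 + (farey w).2) : ℚ) < 1 ∧
    ((farey w).2 / ((farey w).1 + (farey w).2) : ℚ) < 1 := by
  have hf := farey_pos w
  have a1 : (0 : ℚ) < (farey w).1 := by exact_mod_cast hf.1
  have a2 : (0 : ℚ) < (farey w).2 := by exact_mod_cast hf.2
  refine ⟨by positivity, by positivity, ?_, ?_⟩ <;> rw [div_lt_one (by positivity)] <;> linarith

end PRes

namespace PRes
open Item Tr

/-! ### P-resolutions from sequences of items -/

/-- The position lies in an interval that belongs to a polygon. -/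
def InTee (Z : List Item) (i : ℕ) : Prop := ∃ t l u, IsTee Z t l u ∧ l ≤ i ∧ i ≤ u

/-- The positions of the contracted curves. -/
noncomputable def contracted (Z : List Item) : Finset ℕ :=
  @Finset.filter ℕ (fun i =>
    InTee Z i ∨ (entry 1 (chain Z) i = 2 ∧ ¬ InTee Z (i - 1) ∧ ¬ InTee Z (i + 1)))
    (Classical.decPred _) (Finset.Icc 1 (chain Z).length)

theorem mem_contracted {Z : List Item} {i : ℕ} : i ∈ contracted Z ↔
    (1 ≤ i ∧ i ≤ (chain Z).length) ∧
      (InTee Z i ∨ (entry 1 (chain Z) i = 2 ∧ ¬ InTee Z (i - 1) ∧ ¬ InTee Z (i + 1))) := by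
  rw [contracted, @Finset.mem_filter _ _ (Classical.decPred _), Finset.mem_Icc]

theorem InTee.mem {Z : List Item} {i : ℕ} (h : InTee Z i) : i ∈ contracted Z := by
  rw [mem_contracted]
  refine ⟨?_, Or.inl h⟩
  obtain ⟨t, l, u, ht, h1, h2⟩ := h
  have := ht.one_le
  have := ht.le_length
  omega

theorem IsTee.not_inTee {Z : List Item} (hZ : Valid Z) {t : Tr} {l u : ℕ} (h : IsTee Z t l u) :
    ¬ InTee Z (l - 1) ∧ ¬ InTee Z (u + 1) := by
  have h0 := h.one_le
  have h1 := h.le hZ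
  constructor
  · rintro ⟨t', l', u', h', h2, h3⟩
    have := h'.one_le
    rcases hZ.isTee_disjoint h h' with ⟨rfl, rfl, rfl⟩ | h4 | h4 <;> omega
  · rintro ⟨t', l', u', h', h2, h3⟩
    rcases hZ.isTee_disjoint h h' with ⟨rfl, rfl, rfl⟩ | h4 | h4 <;> omega

theorem IsTee.inTee {Z : List Item} {t : Tr} {l u i : ℕ} (h : IsTee Z t l u) (h1 : l ≤ i)
    (h2 : i ≤ u) : InTee Z i := ⟨t, l, u, h, h1, h2⟩

theorem IsTee.isComponent {Z : List Item} (hZ : Valid Z) {t : Tr} {l u : ℕ} (h : IsTee Z t l u) :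
    IsComponent (contracted Z) l u := by
  have h0 := h.one_le
  have h1 := h.le hZ
  obtain ⟨n1, n2⟩ := h.not_inTee hZ
  refine ⟨h1, fun i g1 g2 => (h.inTee g1 g2).mem, fun hm => ?_, fun hm => ?_⟩
  · rcases (mem_contracted.1 hm).2 with g | ⟨-, -, g⟩
    · exact n1 g
    · exact g (h.inTee (by omega) (by omega))
  · rcases (mem_contracted.1 hm).2 with g | ⟨-, g, -⟩
    · exact n2 g
    · exact g (h.inTee (by omega) (by omega))

theorem isComponent_cases {Z : List Item} (hZ : Valid Z) {l u : ℕ}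
    (h : IsComponent (contracted Z) l u) :
    (∃ t, IsTee Z t l u) ∨ IsTypeA (slice (chain Z) l u) := by
  have hl := (mem_contracted.1 (h.2.1 l le_rfl h.1)).1
  have hu := (mem_contracted.1 (h.2.1 u h.1 le_rfl)).1
  by_cases hT : ∃ i, l ≤ i ∧ i ≤ u ∧ InTee Z i
  · obtain ⟨i, h1, h2, t, l', u', ht, h3, h4⟩ := hT
    obtain ⟨rfl, rfl⟩ := h.unique (ht.isComponent hZ) h1 h2 h3 h4
    exact Or.inl ⟨t, ht⟩
  · right
    constructor
    · intro he
      have := length_slice (chain Z) hl.1 hu.2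
      rw [he] at this
      simp at this
      have := h.1
      omega
    · intro x hx
      obtain ⟨i, h1, h2, rfl⟩ := exists_entry_of_mem_slice hl.1 hu.2 hx
      rcases (mem_contracted.1 (h.2.1 i h1 h2)).2 with g | g
      · exact absurd ⟨i, h1, h2, g⟩ hT
      · exact g.1

theorem isTComponent_contracted {Z : List Item} (hZ : Valid Z) (hP : PItems Z) {l u : ℕ} :
    IsTComponent (chain Z) (contracted Z) l u ↔ ∃ t, IsTee Z t l u := by
  constructor
  · rintro ⟨h, hT⟩
    rcases isComponent_cases hZ h with h1 | h1
    · exact h1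
    · obtain ⟨w, d, hd, hc⟩ := hT.exists_path
      obtain ⟨x, hx, h3⟩ := path_chain_not_two w hd
      rw [hc] at h1
      have := h1.2 x hx
      omega
  · rintro ⟨t, ht⟩
    refine ⟨ht.isComponent hZ, ?_⟩
    obtain ⟨w, d, hd, rfl⟩ := ht.exists_path hP
    rw [ht.slice]
    exact isTypeT_path w hd

/-- The log discrepancies on an interval that belongs to a polygon. -/
theorem IsTee.exists_harmonic {Z : List Item} (hZ : Valid Z) (hP : PItems Z) {t : Tr} {l u : ℕ}
    (h : IsTee Z t l u) : ∃ m : ℕ → ℚ, m (l - 1) = 1 ∧ m (u + 1) = 1 ∧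
      (∀ i, l ≤ i → i ≤ u → (entry 1 (chain Z) i : ℚ) * m i = m (i - 1) + m (i + 1)) ∧
      ∀ w d, 1 ≤ d → t = path w d → m l = (farey w).1 / ((farey w).1 + (farey w).2) ∧
        m u = (farey w).2 / ((farey w).1 + (farey w).2) := by
  have h0 := h.one_le
  have h1 := h.le hZ
  have h2 := h.length_eq
  have h3 := h.le_length
  obtain ⟨w, d, hd, rfl⟩ := h.exists_path hP
  obtain ⟨m, hm, m0, m1⟩ := PRes.exists_harmonic w hd
  refine ⟨fun i => m (i + 1 - l), ?_, ?_, ?_, ?_⟩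
  · simp only; rw [show l - 1 + 1 - l = 0 by omega, m0]
  · simp only; rw [show u + 1 + 1 - l = (path w d).chain.length + 1 by omega, m1]
  · intro i g1 g2
    have := hm (i + 1 - l) (by omega) (by omega)
    rw [← h.slice, entry_slice _ (by omega) (by omega)] at this
    simp only
    rw [show l - 1 + (i + 1 - l) = i by omega] at this
    rw [this, show i + 1 - l - 1 = i - 1 + 1 - l by omega, show i + 1 - l + 1 = i + 1 + 1 - l by omega]
  · rintro w' d' hd' he
    obtain ⟨rfl, rfl⟩ := path_injective he
    obtain ⟨e1, e2⟩ := eq_of_harmonic hd hm m0 m1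
    simp only
    rw [show l + 1 - l = 1 by omega, show u + 1 - l = (path w d).chain.length by omega]
    exact ⟨e1, e2⟩

/-- The values of the log discrepancies. -/
structure IsDisc (Z : List Item) (μ : ℕ → ℚ) : Prop where
  one : ∀ i, ¬ InTee Z i → μ i = 1
  eq : ∀ i, InTee Z i → (entry 1 (chain Z) i : ℚ) * μ i = μ (i - 1) + μ (i + 1)
  ends : ∀ w d l u, 1 ≤ d → IsTee Z (path w d) l u →
    μ l = (farey w).1 / ((farey w).1 + (farey w).2) ∧
      μ u = (farey w).2 / ((farey w).1 + (farey w).2)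

theorem exists_isDisc {Z : List Item} (hZ : Valid Z) (hP : PItems Z) : ∃ μ, IsDisc Z μ := by
  classical
  have ex : ∀ t l u, ∃ m : ℕ → ℚ, IsTee Z t l u → m (l - 1) = 1 ∧ m (u + 1) = 1 ∧
      (∀ i, l ≤ i → i ≤ u → (entry 1 (chain Z) i : ℚ) * m i = m (i - 1) + m (i + 1)) ∧
      ∀ w d, 1 ≤ d → t = path w d → m l = (farey w).1 / ((farey w).1 + (farey w).2) ∧
        m u = (farey w).2 / ((farey w).1 + (farey w).2) := by
    intro t l u
    by_cases h : IsTee Z t l u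
    · obtain ⟨m, hm⟩ := h.exists_harmonic hZ hP
      exact ⟨m, fun _ => hm⟩
    · exact ⟨0, fun h' => absurd h' h⟩
  choose M hM using ex
  have ex' : ∀ i, ∃ x : ℚ, (¬ InTee Z i → x = 1) ∧
      ∀ t l u, IsTee Z t l u → l ≤ i → i ≤ u → x = M t l u i := by
    intro i
    by_cases h : InTee Z i
    · obtain ⟨t, l, u, ht, h1, h2⟩ := h
      refine ⟨M t l u i, fun h => absurd (ht.inTee h1 h2) h, fun t' l' u' ht' h3 h4 => ?_⟩
      rcases hZ.isTee_disjoint ht ht' with ⟨rfl, rfl, rfl⟩ | h5 | h5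
      · rfl
      · omega
      · omega
    · exact ⟨1, fun _ => rfl, fun t l u ht h1 h2 => absurd (ht.inTee h1 h2) h⟩
  choose μ hμ1 hμ2 using ex'
  -- The agreement extends by one position on both sides, where both functions are `1`, because two
  -- such intervals never touch. The harmonic equations at the ends of the interval need this.
  have key : ∀ t l u, IsTee Z t l u → ∀ i, l - 1 ≤ i → i ≤ u + 1 → μ i = M t l u i := by
    intro t l u ht i h1 h2
    have h0 := ht.one_le
    obtain ⟨n1, n2⟩ := ht.not_inTee hZ
    obtain ⟨m1, m2, -, -⟩ := hM t l u ht
    rcases Nat.lt_or_ge i l with h3 | h3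
    · obtain rfl : i = l - 1 := by omega
      rw [m1, hμ1 _ n1]
    · rcases Nat.lt_or_ge u i with h4 | h4
      · obtain rfl : i = u + 1 := by omega
        rw [m2, hμ1 _ n2]
      · exact hμ2 i t l u ht h3 h4
  refine ⟨μ, hμ1, ?_, ?_⟩
  · rintro i ⟨t, l, u, ht, h1, h2⟩
    rw [key t l u ht i (by omega) (by omega), key t l u ht (i - 1) (by omega) (by omega),
      key t l u ht (i + 1) (by omega) (by omega)]
    exact (hM t l u ht).2.2.1 i h1 h2
  · intro w d l u hd ht
    have := ht.le hZ
    rw [key _ l u ht l (by omega) (by omega), key _ l u ht u (by omega) (by omega)]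
    exact (hM _ l u ht).2.2.2 w d hd rfl

theorem IsDisc.left {Z : List Item} (hP : PItems Z) {μ : ℕ → ℚ} (h : IsDisc Z μ)
    {i : ℕ} (hi : ¬ InTee Z i) : μ (i - 1) ≤ 1 ∧ (InTee Z (i - 1) → μ (i - 1) < 1) := by
  have key : InTee Z (i - 1) → μ (i - 1) < 1 := by
    rintro ⟨t, l, u, ht, h1, h2⟩
    obtain ⟨w, d, hd, rfl⟩ := ht.exists_path hP
    have h3 : ¬ (l ≤ i ∧ i ≤ u) := fun h => hi (ht.inTee h.1 h.2)
    have h4 := ht.one_le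
    obtain rfl : i - 1 = u := by omega
    rw [(h.ends w d l _ hd ht).2]
    exact (farey_div_pos w).2.2.2
  refine ⟨?_, key⟩
  by_cases h1 : InTee Z (i - 1)
  · exact (key h1).le
  · exact (h.one _ h1).le

theorem IsDisc.right {Z : List Item} (hP : PItems Z) {μ : ℕ → ℚ} (h : IsDisc Z μ)
    {i : ℕ} (hi : ¬ InTee Z i) : μ (i + 1) ≤ 1 ∧ (InTee Z (i + 1) → μ (i + 1) < 1) := by
  have key : InTee Z (i + 1) → μ (i + 1) < 1 := by
    rintro ⟨t, l, u, ht, h1, h2⟩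
    obtain ⟨w, d, hd, rfl⟩ := ht.exists_path hP
    have h3 : ¬ (l ≤ i ∧ i ≤ u) := fun h => hi (ht.inTee h.1 h.2)
    obtain rfl : i + 1 = l := by omega
    rw [(h.ends w d _ u hd ht).1]
    exact (farey_div_pos w).2.2.1
  refine ⟨?_, key⟩
  by_cases h1 : InTee Z (i + 1)
  · exact (key h1).le
  · exact (h.one _ h1).le

/-- Off the polygons `μ = 1`, and neighbouring values are at most `1`, strictly less at the end of a
polygon. So entries ≥ 3 cause no problem. An entry `2` has positive degree if it is next to a
polygon and degree `0` otherwise, in which case it is contracted. An entry `1` stands between two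
polygons, and its degree is positive by the order of their words. -/
theorem IsDisc.isAmple {Z : List Item} (hZ : Valid Z) (hP : PItems Z)
    (h1 : ∀ X', Z ≠ num 1 :: X') {μ : ℕ → ℚ} (h : IsDisc Z μ) :
    IsAmple (chain Z) (contracted Z) μ := by
  refine ⟨fun i hi => h.one i fun hT => hi hT.mem, ?_, ?_⟩
  · intro i hi
    by_cases hT : InTee Z i
    · exact h.eq i hT
    · rcases (mem_contracted.1 hi).2 with g | ⟨g1, g2, g3⟩
      · exact absurd g hT
      · rw [h.one _ hT, h.one _ g2, h.one _ g3, g1]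
        norm_num
  · intro i hi1 hi2 hiC
    have hT : ¬ InTee Z i := fun hT => hiC hT.mem
    obtain ⟨L1, L2⟩ := h.left hP hT
    obtain ⟨R1, R2⟩ := h.right hP hT
    rcases exists_isTee_or_num Z hi1 hi2 with ⟨t, l, u, ht, g1, g2⟩ | ⟨Z₁, x, Z₂, hz, hi⟩
    · exact absurd (ht.inTee g1 g2) hT
    · have hx : entry 1 (chain Z) i = x := by rw [hz, hi, entry_chain_num]
      rw [hx]
      have hv : Valid (num x :: Z₂) := by rw [hz] at hZ; exact hZ.append_right
      match x, hv with
      | 0, hv => exact absurd hv.2.1 (by omega)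
      | 1, hv =>
        obtain ⟨t', Z₃, rfl⟩ := hv.2.2.1 rfl
        obtain ⟨Z₀, j, rfl⟩ := (List.eq_nil_or_concat Z₁).resolve_left (by
          rintro rfl; exact h1 _ hz)
        rw [List.concat_eq_append, List.append_assoc] at hz
        have hv' : Valid (j :: num 1 :: tr t' :: Z₃) := by rw [hz] at hZ; exact hZ.append_right
        have hp' : PItems (j :: num 1 :: tr t' :: Z₃) := by rw [hz] at hP; exact hP.append_right
        cases j with
        | num y => exact absurd rfl (hv'.2.2.2 _)
        | tr t =>
          have T1 : IsTee Z t ((chain Z₀).length + 1) (i - 1) :=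
            ⟨Z₀, _, hz, rfl, by rw [hi]; simp⟩
          have T2 : IsTee Z t' (i + 1) (i + t'.chain.length) :=
            ⟨Z₀ ++ [tr t, num 1], Z₃, by rw [hz]; simp, by rw [hi]; simp; omega, by
              rw [hi]; simp; omega⟩
          obtain ⟨w, d, hd, rfl, hlt⟩ := hp'.2
          obtain ⟨w', d', hd', rfl⟩ := T2.exists_path hP
          have := (wlt_iff_sum_lt w w').1 (hlt w' d' Z₃ rfl)
          rw [(h.ends w d _ _ hd T1).2, (h.ends w' d' _ _ hd' T2).1]
          exact_mod_cast this
      | 2, hv =>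
        have : InTee Z (i - 1) ∨ InTee Z (i + 1) := by
          by_contra hn
          push Not at hn
          exact hiC (mem_contracted.2 ⟨⟨hi1, hi2⟩, Or.inr ⟨hx, hn.1, hn.2⟩⟩)
        push_cast
        rcases this with g | g
        · have := L2 g; linarith
        · have := R2 g; linarith
      | x + 3, hv =>
        have : (0 : ℚ) ≤ x := by positivity
        push_cast
        linarith

theorem isPResolution_contracted {Z : List Item} (hZ : Valid Z) (hP : PItems Z)
    (h1 : ∀ X', Z ≠ num 1 :: X') (h0 : Z ≠ []) : IsPResolution (chain Z) (contracted Z) := by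
  have hsub : contracted Z ⊆ Finset.Icc 1 (chain Z).length := fun i hi =>
    Finset.mem_Icc.2 (mem_contracted.1 hi).1
  refine ⟨hZ.isW, hsub, ?_, ?_, ?_⟩
  -- The list comes from a code, and blowing down its runs leaves the chain of that code, which has
  -- entries ≥ 2.
  · obtain ⟨X, hX, rfl⟩ := exists_code hZ hP h1
    refine ⟨chain X, hX.valid.chain_ne_nil ?_, hX.isW2_chain, hX.blowStar.blowsDownTo⟩
    rintro rfl
    exact h0 rfl
  · intro l u h
    rcases isComponent_cases hZ h with ⟨t, ht⟩ | h2
    · exact Or.inl ((isTComponent_contracted hZ hP).2 ⟨t, ht⟩).2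
    · exact Or.inr h2
  · obtain ⟨μ, hμ⟩ := exists_isDisc hZ hP
    exact (ample_iff _ hsub).2 ⟨μ, hμ.isAmple hZ hP h1⟩

/-! ### Sequences of items from P-resolutions -/

theorem IsComponent.one_le {C : Finset ℕ} {n l u : ℕ} (hC : C ⊆ Finset.Icc 1 n)
    (h : IsComponent C l u) : 1 ≤ l ∧ u ≤ n :=
  ⟨(Finset.mem_Icc.1 (hC (h.2.1 l le_rfl h.1))).1, (Finset.mem_Icc.1 (hC (h.2.1 u h.1 le_rfl))).2⟩

theorem IsAmple.harmonic {b : List ℕ} {C : Finset ℕ} (hC : C ⊆ Finset.Icc 1 b.length) {μ : ℕ → ℚ}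
    (h : IsAmple b C μ) {l u : ℕ} (hc : IsComponent C l u) :
    Harmonic (slice b l u) (fun i => μ (l - 1 + i)) := by
  obtain ⟨h1, h2⟩ := hc.one_le hC
  intro i g1 g2
  rw [length_slice b h1 h2] at g2
  rw [entry_slice b g1 (by omega)]
  have := h.eq (l - 1 + i) (hc.2.1 _ (by omega) (by omega))
  simp only
  rw [this, show l - 1 + i - 1 = l - 1 + (i - 1) by omega, show l - 1 + i + 1 = l - 1 + (i + 1) by omega]

theorem IsAmple.ends {b : List ℕ} {C : Finset ℕ} (hC : C ⊆ Finset.Icc 1 b.length) {μ : ℕ → ℚ}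
    (h : IsAmple b C μ) {l u : ℕ} (hc : IsComponent C l u) {w : List Bool} {d : ℕ} (hd : 1 ≤ d)
    (hs : slice b l u = (path w d).chain) :
    μ l = (farey w).1 / ((farey w).1 + (farey w).2) ∧
      μ u = (farey w).2 / ((farey w).1 + (farey w).2) := by
  obtain ⟨h1, h2⟩ := hc.one_le hC
  have h3 := hc.1
  have hlen := length_slice b h1 h2
  have hm := h.harmonic hC hc
  rw [hs] at hm hlen
  have := eq_of_harmonic hd hm (by simpa using h.one _ hc.2.2.1) (by
    rw [hlen, show l - 1 + (u + 1 - l + 1) = u + 1 by omega]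
    exact h.one _ hc.2.2.2)
  rwa [hlen, show l - 1 + 1 = l by omega, show l - 1 + (u + 1 - l) = u by omega] at this

/-- On -2-nodes the constant `1` is harmonic, and it is the only harmonic function with boundary
values `1`: such intervals do not influence their neighbours. -/
theorem IsAmple.one_of_isTypeA {b : List ℕ} {C : Finset ℕ} (hC : C ⊆ Finset.Icc 1 b.length)
    {μ : ℕ → ℚ} (h : IsAmple b C μ) {l u i : ℕ} (hc : IsComponent C l u)
    (hA : IsTypeA (slice b l u)) (h3 : l ≤ i) (h4 : i ≤ u) : μ i = 1 := by
  obtain ⟨h1, h2⟩ := hc.one_le hC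
  have hlen := length_slice b h1 h2
  have hm := h.harmonic hC hc
  have hone : Harmonic (slice b l u) (fun _ => 1) := by
    intro i g1 g2
    rw [hA.2 _ (entry_mem g1 g2)]
    norm_num
  have := hm.eq (fun x hx => (hA.2 x hx).ge) hone (by simpa using h.one _ hc.2.2.1) (by
    rw [hlen, show l - 1 + (u + 1 - l + 1) = u + 1 by omega]
    exact h.one _ hc.2.2.2) (i + 1 - l) (by omega)
  rwa [show l - 1 + (i + 1 - l) = i by omega] at this

section

variable {b : List ℕ} {C : Finset ℕ}

theorem IsPResolution.one_of_not (hR : IsPResolution b C) {μ : ℕ → ℚ} (h : IsAmple b C μ) {i : ℕ}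
    (hi : ¬ ∃ l u, IsTComponent b C l u ∧ l ≤ i ∧ i ≤ u) : μ i = 1 := by
  by_cases hiC : i ∈ C
  · have h0 : 0 ∉ C := fun h => by have := Finset.mem_Icc.1 (hR.subset h); omega
    obtain ⟨l, u, hc, h1, h2⟩ := exists_isComponent h0 hiC
    rcases hR.singularities l u hc with hT | hA
    · exact absurd ⟨l, u, ⟨hc, hT⟩, h1, h2⟩ hi
    · exact h.one_of_isTypeA hR.subset hc hA h1 h2
  · exact h.one i hiC

theorem IsTComponent.exists_path (h : IsTComponent b C l u) :
    ∃ w d, 1 ≤ d ∧ slice b l u = (path w d).chain := h.2.exists_path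

/-- A curve with self-intersection number `-1` lies between two singularities of type T. -/
theorem IsPResolution.neighbors (hR : IsPResolution b C) {i : ℕ} (h1 : 1 ≤ i) (h2 : i ≤ b.length)
    (hb : entry 1 b i = 1) : i ∉ C ∧ (∃ l, IsTComponent b C l (i - 1)) ∧
      ∃ u, IsTComponent b C (i + 1) u := by
  obtain ⟨μ, h⟩ := (ample_iff b hR.subset).1 hR.ample
  have h0 : 0 ∉ C := fun h => by have := Finset.mem_Icc.1 (hR.subset h); omega
  have hiC : i ∉ C := by
    intro hiC
    obtain ⟨l, u, hc, g1, g2⟩ := exists_isComponent h0 hiC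
    obtain ⟨g3, g4⟩ := hc.one_le hR.subset
    have hm := entry_mem_slice g3 g4 g1 g2
    rcases hR.singularities l u hc with hT | hA
    · obtain ⟨w, d, hd, hs⟩ := hT.exists_path
      have := (path w d).chain_isW2 _ (hs ▸ hm)
      omega
    · have := hA.2 _ hm
      omega
  have hlt := h.lt i h1 h2 hiC
  rw [hb] at hlt
  have nonneg : ∀ {j : ℕ}, (j = i - 1 ∨ j = i + 1) → 0 < μ j ∧
      ((¬ ∃ l u, IsTComponent b C l u ∧ l ≤ j ∧ j ≤ u) → μ j = 1) := by
    intro j hj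
    refine ⟨?_, hR.one_of_not h⟩
    by_cases hT : ∃ l u, IsTComponent b C l u ∧ l ≤ j ∧ j ≤ u
    · obtain ⟨l, u, hT, g1, g2⟩ := hT
      obtain ⟨w, d, hd, hs⟩ := hT.exists_path
      obtain ⟨e1, e2⟩ := h.ends hR.subset hT.1 hd hs
      have hni : ¬ (l ≤ i ∧ i ≤ u) := fun hh => hiC (hT.1.2.1 i hh.1 hh.2)
      have hp := farey_div_pos w
      have hl := (hT.1.one_le hR.subset).1
      rcases hj with rfl | rfl
      · obtain rfl : i - 1 = u := by omega
        rw [e2]; exact hp.2.1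
      · obtain rfl : i + 1 = l := by omega
        rw [e1]; exact hp.1
    · rw [hR.one_of_not h hT]; norm_num
  obtain ⟨p1, q1⟩ := nonneg (j := i - 1) (Or.inl rfl)
  obtain ⟨p2, q2⟩ := nonneg (j := i + 1) (Or.inr rfl)
  push_cast at hlt
  refine ⟨hiC, ?_, ?_⟩
  · by_contra hn
    have : μ (i - 1) = 1 := by
      apply q1
      rintro ⟨l, u, hT, g1, g2⟩
      have hni : ¬ (l ≤ i ∧ i ≤ u) := fun hh => hiC (hT.1.2.1 i hh.1 hh.2)
      have hl := (hT.1.one_le hR.subset).1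
      obtain rfl : i - 1 = u := by omega
      exact hn ⟨l, hT⟩
    linarith
  · by_contra hn
    have : μ (i + 1) = 1 := by
      apply q2
      rintro ⟨l, u, hT, g1, g2⟩
      have hni : ¬ (l ≤ i ∧ i ≤ u) := fun hh => hiC (hT.1.2.1 i hh.1 hh.2)
      obtain rfl : i + 1 = l := by omega
      exact hn ⟨u, hT⟩
    linarith

/-- Induction on the length `n` of the part after position `k`, which never lies inside an interval
of type T. Either such an interval starts at `k + 1` and is taken as a polygon, or the node `k + 1`
is taken as an entry. -/
theorem IsPResolution.exists_items_drop (hR : IsPResolution b C) : ∀ n k, k + n = b.length →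
    (∀ l u, IsTComponent b C l u → l ≤ k → u ≤ k) →
    ∃ Z, chain Z = b.drop k ∧ Valid Z ∧ PItems Z ∧
      ∀ l u, (∃ t, IsTee Z t l u) ↔ 1 ≤ l ∧ IsTComponent b C (k + l) (k + u) := by
  intro n
  induction n using Nat.strong_induction_on with
  | _ n ih =>
  intro k hk hstr
  have inC : ∀ {l u}, IsTComponent b C l u → 1 ≤ l ∧ l ≤ u ∧ u ≤ b.length := fun h => by
    have := h.1.one_le hR.subset
    have := h.1.1
    omega
  by_cases h0 : n = 0
  · refine ⟨[], by rw [chain_nil, List.drop_of_length_le (by omega)], trivial, trivial, ?_⟩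
    intro l u
    constructor
    · rintro ⟨t, ht⟩; exact absurd ht isTee_nil
    · rintro ⟨h1, h2⟩
      have := inC h2
      omega
  by_cases hT : ∃ u, IsTComponent b C (k + 1) u
  · obtain ⟨u, hT⟩ := hT
    obtain ⟨w, d, hd, hs⟩ := hT.2.exists_path
    have hu := inC hT
    have hlen := length_slice b (l := k + 1) (u := u) (by omega) hu.2.2
    rw [hs] at hlen
    have hstr' : ∀ l' u', IsTComponent b C l' u' → l' ≤ u → u' ≤ u := by
      intro l' u' h' hl'
      rcases Nat.lt_or_ge k l' with h1 | h1
      · have := hT.1.unique h'.1 (i := l') (by omega) hl' le_rfl h'.1.1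
        omega
      · have := hstr l' u' h' h1
        omega
    obtain ⟨Z, hZ, hV, hP, hTee⟩ := ih (b.length - u) (by omega) u (by omega) hstr'
    have hch : (path w d).chain ++ b.drop u = b.drop k := by
      rw [← hs, slice, Nat.add_sub_cancel]
      conv_rhs => rw [← List.take_append_drop (u + 1 - (k + 1)) (b.drop k), List.drop_drop]
      congr 2
      omega
    have hne : ∀ t' X', Z ≠ tr t' :: X' := by
      rintro t' X' rfl
      have := ((hTee 1 t'.chain.length).1 ⟨t', isTee_tr.2 (Or.inl ⟨rfl, rfl, rfl⟩)⟩).2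
      exact hT.1.2.2.2 (this.1.2.1 _ le_rfl this.1.1)
    refine ⟨tr (path w d) :: Z, by rw [chain_tr, hZ, hch], ⟨hV, path_good w hd, path_ne_leaf w d, hne⟩,
      ⟨hP, w, d, hd, rfl, ?_⟩, ?_⟩
    · rintro w' d' X' rfl
      -- The order of the words is forced by ampleness on the -1-curve at position `u + 1`.
      obtain ⟨μ, hμ⟩ := (ample_iff b hR.subset).1 hR.ample
      have T' : IsTee (num 1 :: tr (path w' d') :: X') (path w' d') 2 ((path w' d').chain.length + 1) :=
        isTee_num.2 ⟨1, _, rfl, rfl, isTee_tr.2 (Or.inl ⟨rfl, rfl, rfl⟩)⟩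
      have hd' : 1 ≤ d' := by
        obtain ⟨w₂, d₂, h₂, he⟩ := T'.exists_path hP
        rw [(path_injective he).2]; exact h₂
      have hc' := ((hTee _ _).1 ⟨_, T'⟩).2
      have hs' : slice b (u + 2) (u + ((path w' d').chain.length + 1)) = (path w' d').chain := by
        rw [← slice_drop b (by omega), ← hZ, T'.slice]
      have e1 := (hμ.ends hR.subset hT.1 hd hs).2
      have e2 := (hμ.ends hR.subset hc'.1 hd' hs').1
      have hb : entry 1 b (u + 1) = 1 := by
        rw [← entry_drop b u le_rfl, ← hZ]
        simp [entry]
      have hin := inC hc'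
      have := hμ.lt (u + 1) (by omega) (by omega) hT.1.2.2.2
      rw [hb, Nat.add_sub_cancel, e1, e2] at this
      exact (wlt_iff_sum_lt w w').2 (by exact_mod_cast this)
    · intro l' u'
      constructor
      · rintro ⟨t, ht⟩
        rcases isTee_tr.1 ht with ⟨rfl, rfl, rfl⟩ | ⟨l₁, u₁, rfl, rfl, h1⟩
        · refine ⟨le_rfl, ?_⟩
          rwa [hlen, show k + (u + 1 - (k + 1)) = u by omega]
        · have := (hTee l₁ u₁).1 ⟨t, h1⟩
          refine ⟨by omega, ?_⟩
          rw [hlen, show k + (u + 1 - (k + 1) + l₁) = u + l₁ by omega,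
            show k + (u + 1 - (k + 1) + u₁) = u + u₁ by omega]
          exact this.2
      · rintro ⟨h1, h2⟩
        rcases Nat.lt_or_ge u (k + l') with h3 | h3
        · have h4 := inC h2
          obtain ⟨t, ht⟩ := (hTee (k + l' - u) (k + u' - u)).2 ⟨by omega, by
            rwa [show u + (k + l' - u) = k + l' by omega, show u + (k + u' - u) = k + u' by omega]⟩
          exact ⟨t, isTee_tr.2 (Or.inr ⟨_, _, by omega, by omega, ht⟩)⟩
        · obtain ⟨e1, e2⟩ := hT.1.unique h2.1 (i := k + l') (by omega) h3 le_rfl h2.1.1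
          exact ⟨_, isTee_tr.2 (Or.inl ⟨rfl, by omega, by omega⟩)⟩
  · have hstr' : ∀ l' u', IsTComponent b C l' u' → l' ≤ k + 1 → u' ≤ k + 1 := by
      intro l' u' h' hl'
      rcases Nat.lt_or_ge k l' with h1 | h1
      · obtain rfl : l' = k + 1 := by omega
        exact absurd ⟨u', h'⟩ hT
      · have := hstr l' u' h' h1
        omega
    obtain ⟨Z, hZ, hV, hP, hTee⟩ := ih (n - 1) (by omega) (k + 1) (by omega) hstr'
    have hx : b.drop k = entry 1 b (k + 1) :: b.drop (k + 1) := by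
      rw [List.drop_eq_getElem_cons (by omega), entry_eq_getElem? _ (by omega), Nat.add_sub_cancel,
        List.getElem?_eq_getElem (by omega)]
      rfl
    refine ⟨num (entry 1 b (k + 1)) :: Z, by rw [chain_num, hZ, hx], ⟨hV, ?_, ?_, ?_⟩, hP, ?_⟩
    · exact hR.entries _ (entry_mem (by omega) (by omega))
    · intro h1
      obtain ⟨-, -, u, hu⟩ := hR.neighbors (by omega) (by omega) h1
      have := inC hu
      obtain ⟨t, ht⟩ := (hTee 1 (u - (k + 1))).2 ⟨le_rfl, by
        rwa [show k + 1 + (u - (k + 1)) = u by omega]⟩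
      exact ⟨t, ht.head_eq hV le_rfl⟩
    -- An entry `1` at `k + 2` would need an interval of type T that ends at `k + 1`; none starts
    -- there, and none starts earlier and reaches beyond `k`.
    · rintro X' rfl
      have hlen := congrArg List.length hZ
      simp at hlen
      have hb : entry 1 b (k + 2) = 1 := by
        rw [show k + 2 = k + 1 + 1 from rfl, ← entry_drop b (k + 1) le_rfl, ← hZ]
        simp [entry]
      obtain ⟨-, ⟨l, hl⟩, -⟩ := hR.neighbors (by omega) (by omega) hb
      rcases Nat.lt_or_ge k l with h1 | h1
      · have := inC hl
        obtain rfl : l = k + 1 := by omega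
        exact hT ⟨_, hl⟩
      · have := hstr _ _ hl h1
        omega
    · intro l u
      constructor
      · rintro ⟨t, ht⟩
        obtain ⟨l', u', rfl, rfl, h'⟩ := isTee_num.1 ht
        have := ((hTee l' u').1 ⟨t, h'⟩).2
        refine ⟨by omega, ?_⟩
        rwa [show k + (l' + 1) = k + 1 + l' by omega, show k + (u' + 1) = k + 1 + u' by omega]
      · rintro ⟨h1, h2⟩
        have h3 := inC h2
        have h4 : l ≠ 1 := by
          rintro rfl
          exact hT ⟨_, h2⟩
        obtain ⟨t, ht⟩ := (hTee (l - 1) (u - 1)).2 ⟨by omega, by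
          rwa [show k + 1 + (l - 1) = k + l by omega, show k + 1 + (u - 1) = k + u by omega]⟩
        exact ⟨t, isTee_num.2 ⟨_, _, by omega, by omega, ht⟩⟩

theorem IsPResolution.exists_items (hR : IsPResolution b C) :
    ∃ Z, chain Z = b ∧ Valid Z ∧ PItems Z ∧ Z ≠ [] ∧ (∀ X', Z ≠ num 1 :: X') ∧
      ∀ l u, IsTComponent b C l u ↔ ∃ t, IsTee Z t l u := by
  have hpos : ∀ {l u}, IsTComponent b C l u → 1 ≤ l := fun h => (h.1.one_le hR.subset).1
  obtain ⟨Z, hZ, hV, hP, hTee⟩ := hR.exists_items_drop b.length 0 (by omega) (fun l u h hl => by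
    have := hpos h; omega)
  rw [List.drop_zero] at hZ
  refine ⟨Z, hZ, hV, hP, ?_, ?_, ?_⟩
  · rintro rfl
    obtain ⟨c, hc, -, hbc⟩ := hR.quotient
    rw [← hZ] at hbc
    exact hc (eq_nil_of_blowsDownTo hbc)
  · rintro X' rfl
    have hb : entry 1 b 1 = 1 := by rw [← hZ]; simp [entry]
    have hl : 1 ≤ b.length := by rw [← hZ]; simp
    obtain ⟨-, ⟨l, hl⟩, -⟩ := hR.neighbors le_rfl hl hb
    have := hl.1.1
    have := hpos hl
    omega
  · intro l u
    rw [hTee]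
    simp only [Nat.zero_add]
    exact ⟨fun h => ⟨hpos h, h⟩, fun h => h.2⟩

end

end PRes

namespace PRes
open Item Tr

/-! ### Associated positions -/

theorem AssocRev.le_length : ∀ {L : List ℕ} {i j : ℕ}, AssocRev L i j → i ≤ L.length
  | [], _, _, h => absurd h id
  | 0 :: L, i, j, h => by
    rcases h with h | ⟨rfl, -⟩
    · have := AssocRev.le_length h; simp; omega
    · simp
  | 1 :: L, i, j, h => by
    rcases h with h | ⟨rfl, -⟩
    · have := AssocRev.le_length h; simp; omega
    · simp
  | (n + 2) :: L, i, j, h => by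
    rcases h with h | ⟨rfl, -⟩
    · have := AssocRev.le_length h; simp; omega
    · simp

theorem assocRev_cons (x : ℕ) {L : List ℕ} {i j : ℕ} (hi : i ≤ L.length) :
    AssocRev (x :: L) i j ↔ AssocRev L i j := by
  match x with
  | 0 => exact ⟨fun h => h.resolve_right fun h => by omega, Or.inl⟩
  | 1 => exact ⟨fun h => h.resolve_right fun h => by omega, Or.inl⟩
  | n + 2 => exact ⟨fun h => h.resolve_right fun h => by omega, Or.inl⟩

theorem assocRev_append (e : List ℕ) {L : List ℕ} {i j : ℕ} (hi : i ≤ L.length) :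
    AssocRev (e ++ L) i j ↔ AssocRev L i j := by
  induction e with
  | nil => rfl
  | cons x e ih => rw [List.cons_append, assocRev_cons x (by simp; omega), ih]

theorem length_openR_cons (n : ℕ) (L : List ℕ) :
    (openR ((n + 2) :: L)).length = (openR L).length + n := by
  rw [openR_add_two, List.length_append, List.length_replicate, length_alphaRight, Nat.add_comm]

theorem assocRev_head (n : ℕ) (L : List ℕ) (j : ℕ) : AssocRev ((n + 2) :: L) (L.length + 1) j ↔
    (openR L).length ≤ j ∧ j ≤ (openR L).length + n := by
  have e : (if StartsBlock L then (Rrev L).length + 1 else (Rrev L).length) =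
      (openR L).length := by
    rw [openR]; split_ifs <;> simp
  constructor
  · rintro (h | ⟨-, h⟩)
    · have := h.le_length; omega
    · rwa [e] at h
  · intro h
    right
    rw [e]
    exact ⟨rfl, h⟩

/-- By `assocRev_head` the positions associated with one entry form an interval that starts at the
last position of the image reached so far, where `openR` supplies that position at the start of a
block. Consecutive intervals overlap in one position, so their union is an interval. -/
theorem exists_assocRev_iff {d : List ℕ} (hd : IsW2 d) (h0 : d ≠ []) (L : List ℕ) (j : ℕ) :
    (openR L).length ≤ (openR (d ++ L)).length ∧
    ((∃ i, L.length + 1 ≤ i ∧ i ≤ L.length + d.length ∧ AssocRev (d ++ L) i j) ↔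
      (openR L).length ≤ j ∧ j ≤ (openR (d ++ L)).length) := by
  induction d with
  | nil => exact absurd rfl h0
  | cons x d ih =>
    obtain ⟨n, rfl⟩ := Nat.exists_eq_add_of_le' (hd.of_cons.1)
    rw [List.cons_append, length_openR_cons]
    have hlen : (d ++ L).length + 1 = L.length + (d.length + 1) := by simp; omega
    have split : (∃ i, L.length + 1 ≤ i ∧ i ≤ L.length + ((n + 2) :: d).length ∧
        AssocRev ((n + 2) :: (d ++ L)) i j) ↔
        (∃ i, L.length + 1 ≤ i ∧ i ≤ L.length + d.length ∧ AssocRev (d ++ L) i j) ∨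
          ((openR (d ++ L)).length ≤ j ∧ j ≤ (openR (d ++ L)).length + n) := by
      rw [← assocRev_head]
      constructor
      · rintro ⟨i, h1, h2, h3⟩
        simp only [List.length_cons] at h2
        rcases Nat.lt_or_ge i (L.length + (d.length + 1)) with h4 | h4
        · exact Or.inl ⟨i, h1, by omega, (assocRev_cons _ (by simp; omega)).1 h3⟩
        · right
          rwa [hlen, show L.length + (d.length + 1) = i by omega]
      · rintro (⟨i, h1, h2, h3⟩ | h)
        · exact ⟨i, h1, by simp; omega, (assocRev_cons _ (by simp; omega)).2 h3⟩
        · exact ⟨_, by omega, by simp; omega, h⟩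
    rw [split]
    rcases eq_or_ne d [] with rfl | h1
    · simp only [List.nil_append, List.length_nil, Nat.add_zero]
      refine ⟨by omega, ?_⟩
      constructor
      · rintro (⟨i, h1, h2, -⟩ | h)
        · omega
        · exact h
      · exact Or.inr
    · obtain ⟨h2, h3⟩ := ih hd.of_cons.2 h1
      rw [h3]
      omega

/-- `Valid` speaks of the item after an entry `1`; as the whole list does not begin with `1`, a
polygon also precedes each such entry. This is needed because the association of positions reads the
reversed beginning of the chain. -/
theorem Valid.mirror_left {Z₁ : List Item} : ∀ {Z₂ : List Item}, Valid (Z₁ ++ Z₂) →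
    (∀ X', Z₁ ++ Z₂ ≠ num 1 :: X') → Valid (mirror Z₁) := by
  induction Z₁ using List.reverseRecOn with
  | nil => intro _ _ _; exact trivial
  | append_singleton Z₁ i ih =>
    intro Z₂ h h1
    rw [List.append_assoc] at h h1
    have hv := ih h h1
    rw [mirror_append]
    have h2 := h.append_right
    have hlast : Z₁ = [] ∨ ∃ Z₀ j, Z₁ = Z₀ ++ [j] ∧ Valid (j :: i :: Z₂) := by
      rcases List.eq_nil_or_concat Z₁ with rfl | ⟨Z₀, j, rfl⟩
      · exact Or.inl rfl
      · right
        rw [List.concat_eq_append] at h ⊢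
        rw [List.append_assoc] at h
        exact ⟨Z₀, j, rfl, h.append_right⟩
    have hm : ∀ {Z₀ : List Item} {j : Item}, mirror (Z₀ ++ [j]) = j.mirror :: mirror Z₀ := by
      intro Z₀ j
      rw [mirror_append]; rfl
    cases i with
    | num x =>
      refine ⟨hv, h2.2.1, ?_, ?_⟩
      · rintro rfl
        rcases hlast with rfl | ⟨Z₀, j, rfl, hj⟩
        · exact absurd rfl (h1 Z₂)
        · rw [hm]
          cases j with
          | num y => exact absurd rfl (hj.2.2.2 _)
          | tr t => exact ⟨_, _, rfl⟩
      · intro X' he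
        rcases hlast with rfl | ⟨Z₀, j, rfl, hj⟩
        · simp at he
        · rw [hm] at he
          cases j with
          | num y =>
            change num y :: mirror Z₀ = num 1 :: X' at he
            obtain ⟨t, X', h5⟩ := hj.2.2.1 (Item.num.inj (List.cons.inj he).1)
            simp at h5
          | tr t => simp [Item.mirror] at he
    | tr t =>
      refine ⟨hv, h2.2.1.mirror, fun he => h2.2.2.1 (mirror_eq_leaf.1 he), ?_⟩
      intro t' X' he
      rcases hlast with rfl | ⟨Z₀, j, rfl, hj⟩
      · simp at he
      · rw [hm] at he
        cases j with
        | num y => simp [Item.mirror] at he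
        | tr s => exact absurd rfl (hj.2.2.2 _ _)

theorem total_mirror (X : List Item) : total (shapes (mirror X)) = total (shapes X) := by
  rw [shapes_mirror]
  simp [total, Function.comp_def]

theorem mirror_chain_left {Z₁ Z₂ : List Item} (h : Valid (Z₁ ++ Z₂)) :
    (chain Z₁).reverse = chain (mirror Z₁) := by
  induction Z₁ generalizing Z₂ with
  | nil => rfl
  | cons i Z₁ ih =>
    rw [mirror_cons, chain_append, ← ih h.of_cons]
    cases i with
    | num x => simp [Item.mirror]
    | tr t => simp [Item.mirror, Tr.chain_mirror h.2.1]

theorem length_openR_left {Z₁ Z₂ : List Item} (h : Valid (Z₁ ++ Z₂))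
    (h1 : ∀ X', Z₁ ++ Z₂ ≠ num 1 :: X') :
    (openR (chain Z₁).reverse).length = total (shapes Z₁) + 1 := by
  have hm := h.mirror_left h1
  rw [mirror_chain_left h, hm.openR_chain, hm.length_lab, total_mirror]

theorem assocPositions_eq {Z₁ Z₂ : List Item} {t : Tr} (h : Valid (Z₁ ++ tr t :: Z₂))
    (h1 : ∀ X', Z₁ ++ tr t :: Z₂ ≠ num 1 :: X') :
    assocPositions (chain (Z₁ ++ tr t :: Z₂)) ((chain Z₁).length + 1)
        ((chain Z₁).length + t.chain.length) =
      Finset.Icc (1 + total (shapes Z₁)) (1 + total (shapes Z₁) + t.size) := by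
  have hlen : (R (chain (Z₁ ++ tr t :: Z₂))).length = total (shapes (Z₁ ++ tr t :: Z₂)) + 1 := by
    rw [h.R_chain (by simp) h1, h.length_lab]
  have ht := h.append_right
  have hne := Tr.chain_ne_nil ht.2.1 ht.2.2.1
  have e1 := length_openR_left h h1
  have e2 := length_openR_left (Z₁ := Z₁ ++ [tr t]) (Z₂ := Z₂) (by simpa using h) (by simpa using h1)
  ext j
  have key := (exists_assocRev_iff (d := t.chain.reverse) t.chain_isW2.reverse (by simpa using hne)
    (chain Z₁).reverse j).2
  have e3 : t.chain.reverse ++ (chain Z₁).reverse = (chain (Z₁ ++ [tr t])).reverse := by simp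
  rw [e3, e1, e2] at key
  simp only [List.length_reverse] at key
  simp only [shapes_append, total_append, shapes_tr, shapes_nil, total_cons, total_nil,
    size_strip, Nat.add_zero] at key hlen
  -- Later entries of the chain do not change the associations of earlier positions.
  have e4 : ∀ i, i ≤ (chain Z₁).length + t.chain.length →
      (Assoc (chain (Z₁ ++ tr t :: Z₂)) i j ↔ AssocRev (chain (Z₁ ++ [tr t])).reverse i j) := by
    intro i hi
    rw [Assoc, show (chain (Z₁ ++ tr t :: Z₂)).reverse =
      (chain Z₂).reverse ++ (chain (Z₁ ++ [tr t])).reverse by simp, assocRev_append _ (by simp; omega)]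
  rw [assocPositions]
  refine (@Finset.mem_filter _ _ (Classical.decPred _) _ _).trans ?_
  rw [Finset.mem_Icc, Finset.mem_Icc, hlen]
  constructor
  · rintro ⟨-, i, g1, g2, g3⟩
    have := key.1 ⟨i, g1, g2, (e4 i g2).1 g3⟩
    omega
  · intro hj
    refine ⟨by omega, ?_⟩
    obtain ⟨i, g1, g2, g3⟩ := key.2 (by omega)
    exact ⟨i, g1, g2, (e4 i g2).2 g3⟩

/-! ### The subdivisions that belong to graphs of type T -/

theorem path_strip (w : List Bool) (d : ℕ) : (path w d).strip = path w 0 := by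
  induction w with
  | nil => rfl
  | cons b w ih => cases b <;> simp [path, strip, ih]

theorem size_path (w : List Bool) (d : ℕ) : (path w d).size = w.length + 2 := by
  induction w with
  | nil => rfl
  | cons b w ih => cases b <;> simp [path, Tr.size, ih]; omega

theorem entry_full_leaf (p v : ℕ) : entry p leaf.full v = 0 := by
  simp [full, mid, first, last, entry_cons]

/-- The defect sits at the central vertex. Each letter `true` adds one vertex to the left of it,
hence its position `p + 1 + w.count true`. -/
theorem entry_full_path (w : List Bool) (d p v : ℕ) : entry p (path w d).full v =
    entry p (path w 0).full v + if v = p + 1 + w.count true then d else 0 := by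
  induction w generalizing p with
  | nil =>
    simp only [path, entry_full_node, entry_full_leaf, List.count_nil, Nat.add_zero,
      show leaf.size = 1 from rfl]
    by_cases h1 : v = p + 1
    · simp [h1]
    · simp [h1]
  | cons b w ih =>
    cases b
    · simp only [path, entry_full_node, entry_full_leaf, size_path, ih p,
        show leaf.size = 1 from rfl, List.count_cons]
      simp
      omega
    · simp only [path, entry_full_node, entry_full_leaf, size_path, ih (p + 1),
        show leaf.size = 1 from rfl, List.count_cons]
      simp
      split_ifs <;> omega

theorem path_first_last (w : List Bool) (d : ℕ) : (w = [] ∧ (path w d).first = 1 ∧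
    (path w d).last = 1) ∨ (∃ u, w = false :: u ∧ 2 ≤ (path w d).first ∧ (path w d).last = 1) ∨
    (∃ u, w = true :: u ∧ (path w d).first = 1 ∧ 2 ≤ (path w d).last) := by
  have pos : ∀ w : List Bool, 1 ≤ (path w d).first ∧ 1 ≤ (path w d).last := by
    intro w
    rcases w with _ | ⟨_ | _, w⟩ <;> simp [path, first, last]
  rcases w with _ | ⟨_ | _, w⟩
  · left; simp [path, first, last]
  · right; left
    refine ⟨w, rfl, ?_, ?_⟩
    · have := (pos w).1
      simp only [path, first]; omega
    · simp [path, last]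
  · right; right
    refine ⟨w, rfl, ?_, ?_⟩
    · simp [path, first]
    · have := (pos w).2
      simp only [path, last]; omega

/-- The labels of the vertices other than the central one determine the word. -/
theorem path_unique {w w' : List Bool} {d d' : ℕ} (hl : w.length = w'.length) (p : ℕ)
    (h : ∀ v, v ≠ p + 1 + w'.count true →
      entry p (path w d).full v = entry p (path w' d').full v) : w = w' := by
  induction w generalizing w' p with
  | nil => exact (List.length_eq_zero_iff.1 hl.symm).symm
  | cons b w ih =>
    obtain ⟨b', w', rfl⟩ := List.exists_cons_of_ne_nil (l := w') (by rintro rfl; simp at hl)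
    have hl' : w.length = w'.length := by simpa using hl
    have hcnt : (b' :: w').count true ≤ w'.length + 1 := by
      have := List.count_le_length (a := true) (l := b' :: w')
      simpa using this
    have h1 := h p (by omega)
    have hcnt' : ∀ u : List Bool, p + 2 + u.length ≠ p + 1 + u.count true := by
      intro u
      have := List.count_le_length (a := true) (l := u)
      omega
    have h2 := h (p + 2 + (b' :: w').length) (hcnt' _)
    have f := path_first_last (b :: w) d
    have f' := path_first_last (b' :: w') d'
    rw [entry_full, entry_full, if_pos rfl, if_pos rfl, entry_of_lt _ (by omega),
      entry_of_lt _ (by omega), size_path, size_path, if_neg (by omega), if_neg (by omega)] at h1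
    have m1 := (path (b :: w) d).length_mid
    have m2 := (path (b' :: w') d').length_mid
    rw [size_path] at m1 m2
    have hl'' : (b :: w).length = (b' :: w').length := hl
    rw [entry_full, entry_full, size_path, size_path, hl, entry_of_ge _ (by omega),
      entry_of_ge _ (by omega)] at h2
    have k1 : ¬ p + 2 + (b' :: w').length = p := by omega
    have k2 : p + 2 + (b' :: w').length = p + ((b' :: w').length + 2) := by omega
    rw [if_neg k1, if_neg k1, if_pos k2, if_pos k2] at h2
    -- The first letter is `false` if the first vertex lies in at least two triangles, and `true` if
    -- the last one does. The ends are never central, so `h` applies to them.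
    have hb : b = b' := by
      cases b <;> cases b' <;> simp at f f' <;> first | rfl | omega
    subst hb
    rw [List.cons.injEq]
    refine ⟨rfl, ?_⟩
    cases b
    · refine ih hl' p fun v hv => ?_
      have := h v (by simpa using hv)
      simp only [path, entry_full_node, entry_full_leaf, size_path, hl'] at this
      omega
    · refine ih hl' (p + 1) fun v hv => ?_
      have := h v (by rw [List.count_cons]; simp; omega)
      simp only [path, entry_full_node, entry_full_leaf, size_path, hl',
        show leaf.size = 1 from rfl] at this
      omega

/-- The first letter of the word is the triangle glued last: `false` adds a new largest vertex and
`true` a new smallest one. -/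
theorem isTCore_path (w : List Bool) (d p : ℕ) :
    IsTCore p (p + 1 + w.count true) (p + (path w d).size)
      (Finset.Icc p (p + (path w d).size)) ((path w d).tri p) := by
  induction w generalizing p with
  | nil =>
    have e : Finset.Icc p (p + 2) = {p, p + 1, p + 2} := by
      ext v; simp only [Finset.mem_Icc, Finset.mem_insert, Finset.mem_singleton]; omega
    have := IsTCore.base p (p + 1) (p + 2) (by omega) (by omega)
    have e2 : (path [] d).tri p = {{p, p + 1, p + 2}} := by simp [path, tri, Tr.size]
    rw [e2]
    change IsTCore p (p + 1) (p + 2) (Finset.Icc p (p + 2)) _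
    rw [e]
    exact this
  | cons b w ih =>
    cases b
    · have h1 := IsTCore.right _ _ _ (p + (path w d).size + 1) _ _ (ih p) (by omega)
      have e : insert (p + (path w d).size + 1) (Finset.Icc p (p + (path w d).size)) =
          Finset.Icc p (p + ((path w d).size + 1)) := by
        ext v; simp; omega
      rw [e] at h1
      simpa [path, tri, Tr.size, Nat.add_assoc] using h1
    · have h1 := IsTCore.left _ _ _ p _ _ (ih (p + 1)) (by omega)
      have e : insert p (Finset.Icc (p + 1) (p + 1 + (path w d).size)) =
          Finset.Icc p (p + (1 + (path w d).size)) := by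
        ext v; simp; omega
      rw [e] at h1
      simpa [path, tri, Tr.size, Nat.add_assoc, Nat.add_comm, Nat.add_left_comm] using h1

theorem IsTCore.bounds {x c z : ℕ} {V : Finset ℕ} {Δ : Finset (Finset ℕ)} (h : IsTCore x c z V Δ) :
    x < c ∧ c < z ∧ x ∈ V ∧ z ∈ V ∧ ∀ v ∈ V, x ≤ v ∧ v ≤ z := by
  induction h with
  | base x c z h₁ h₂ => simp; omega
  | right x c z w V Δ h hw ih =>
    obtain ⟨h1, h2, h3, h4, h5⟩ := ih
    refine ⟨h1, h2.trans hw, by simp [h3], by simp, fun v hv => ?_⟩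
    rcases Finset.mem_insert.1 hv with rfl | hv
    · omega
    · have := h5 v hv; omega
  | left x c z w V Δ h hw ih =>
    obtain ⟨h1, h2, h3, h4, h5⟩ := ih
    refine ⟨hw.trans h1, h2, by simp, by simp [h4], fun v hv => ?_⟩
    rcases Finset.mem_insert.1 hv with rfl | hv
    · omega
    · have := h5 v hv; omega

theorem IsTCore.exists_path {x c z : ℕ} {V : Finset ℕ} {Δ : Finset (Finset ℕ)}
    (h : IsTCore x c z V Δ) (hV : V = Finset.Icc x z) :
    ∃ w, z = x + (path w 0).size ∧ c = x + 1 + w.count true ∧ Δ = (path w 0).tri x := by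
  induction h with
  | base x c z h₁ h₂ =>
    have e : ∀ v, v ∈ ({x, c, z} : Finset ℕ) ↔ v ∈ Finset.Icc x z := fun v => by rw [hV]
    simp only [Finset.mem_insert, Finset.mem_singleton, Finset.mem_Icc] at e
    have e1 := e (x + 1)
    have e2 := e (c + 1)
    obtain rfl : c = x + 1 := by omega
    obtain rfl : z = x + 2 := by omega
    exact ⟨[], rfl, rfl, by simp [path, tri, Tr.size]⟩
  | right x c z w V Δ h hw ih =>
    have hb := h.bounds
    have e : ∀ v, v ∈ insert w V ↔ v ∈ Finset.Icc x w := fun v => by rw [hV]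
    simp only [Finset.mem_insert, Finset.mem_Icc] at e
    have hz : w = z + 1 := by
      by_contra hne
      rcases (e (z + 1)).2 (by omega) with h1 | h1
      · omega
      · have := hb.2.2.2.2 _ h1; omega
    obtain ⟨u, h1, h2, h3⟩ := ih (by
      ext v
      rw [Finset.mem_Icc]
      refine ⟨hb.2.2.2.2 v, fun hv => ?_⟩
      exact ((e v).2 (by omega)).resolve_left (by omega))
    refine ⟨false :: u, ?_, by simpa using h2, ?_⟩
    · simp [path, Tr.size]; omega
    · simp only [path, tri, Tr.size, ← h1, Finset.union_empty, h3]
      rw [← Nat.add_assoc, ← h1, hz]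
  | left x c z w V Δ h hw ih =>
    have hb := h.bounds
    have e : ∀ v, v ∈ insert w V ↔ v ∈ Finset.Icc w z := fun v => by rw [hV]
    simp only [Finset.mem_insert, Finset.mem_Icc] at e
    have hx : x = w + 1 := by
      by_contra hne
      rcases (e (w + 1)).2 (by omega) with h1 | h1
      · omega
      · have := hb.2.2.2.2 _ h1; omega
    obtain ⟨u, h1, h2, h3⟩ := ih (by
      ext v
      rw [Finset.mem_Icc]
      refine ⟨hb.2.2.2.2 v, fun hv => ?_⟩
      exact ((e v).2 (by omega)).resolve_left (by omega))
    refine ⟨true :: u, ?_, ?_, ?_⟩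
    · simp [path, Tr.size]; omega
    · rw [List.count_cons]; simp; omega
    · simp only [path, tri, Tr.size, Finset.empty_union, h3]
      rw [← hx, ← Nat.add_assoc, ← hx, ← h1]

theorem fan_singleton (p : ℕ) (t : Tr) : fan p [t] = insert {0, p, p + t.size} (t.tri p) := by
  simp [fan]

theorem idx_insert_zero {p q v : ℕ} (hp : 1 ≤ p) (h1 : p ≤ v) (h2 : v ≤ q) :
    idx (insert 0 (Finset.Icc p q)) v = v + 1 - p := by
  have : (insert 0 (Finset.Icc p q)).filter (· < v) = insert 0 (Finset.Ico p v) := by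
    ext u; simp; omega
  rw [idx, this, Finset.card_insert_of_notMem (by simp; omega), Nat.card_Ico]
  omega

theorem idx_zero (p q : ℕ) : idx (insert 0 (Finset.Icc p q)) 0 = 0 := by
  rw [idx, Finset.card_eq_zero, Finset.filter_eq_empty_iff]
  simp

theorem entry_labels (t : Tr) (p v : ℕ) : entry p t.labels v =
    entry p t.full v + (if v = p then 1 else 0) + if v = p + t.size then 1 else 0 := by
  have := t.length_mid
  have := t.size_pos
  rw [labels, List.cons_append, entry_cons, entry_append, entry_cons, entry_nil, entry_full,
    show p + 1 + t.mid.length = p + t.size by omega]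
  split_ifs <;> omega

theorem R_path (w : List Bool) {d : ℕ} (hd : 1 ≤ d) :
    R (path w d).chain = (path w d).labels := by
  rw [R_eq_Rrev (path w d).chain_isW2.isW, Rrev_chain (path_good w hd) (path_ne_leaf w d)]

theorem label_path (w : List Bool) {d p v : ℕ} (hd : 1 ≤ d) (hp : 1 ≤ p) (h1 : p ≤ v)
    (h2 : v ≤ p + (path w d).size) :
    label (insert 0 (Finset.Icc p (p + (path w d).size))) (R (path w d).chain) v =
      entry p (path w d).labels v := by
  rw [label_eq_entry, idx_insert_zero hp h1 h2, R_path w hd, entry, entry, if_pos (by omega),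
    if_pos h1]
  congr 1
  omega

theorem degree_fan_path (w : List Bool) {d d' p v : ℕ} (hp : 1 ≤ p) (h1 : p ≤ v)
    (V : Finset ℕ) (w' : List Bool) :
    degree V (fan p [path w' d']) (R (path w d).chain) v =
      entry p (path w' 0).full v + (if v = p then 1 else 0) +
        if v = p + (path w' 0).size then 1 else 0 := by
  have h2 : IsW2 (R (path w d).chain) := by
    rw [R_eq_Rrev (path w d).chain_isW2.isW]
    exact isW2_Rrev (path w d).chain_isW2
  rw [degree_eq v fun s _ u _ => label_ne_one h2 u, card_filter_fan_cons_mem p hp _ _ v (by omega),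
    path_strip, size_path, size_path]
  simp only [fan, Finset.filter_empty, Finset.card_empty]
  omega

theorem isSubdivision_insert_zero {p : ℕ} (hp : 1 ≤ p) (t : Tr) :
    IsSubdivision (insert 0 (Finset.Icc p (p + t.size))) (fan p [t]) := by
  have h1 := t.size_pos
  have h := IsSubdivision.glue {0, p} (Finset.Icc p (p + t.size)) ∅ (t.tri p) 0 p (p + t.size)
    (.digon 0 p (by omega)) (tri_isSubdivision t p) (by simp [IsLeast, lowerBounds])
    (by simp [IsGreatest, upperBounds]) (by simp [IsLeast, lowerBounds]; intro a ha _; exact ha)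
    (by simp [IsGreatest, upperBounds])
  have e : ({0, p} : Finset ℕ) ∪ Finset.Icc p (p + t.size) =
      insert 0 (Finset.Icc p (p + t.size)) := by
    ext v; simp
  rwa [e, Finset.empty_union, ← fan_singleton] at h

theorem isTSubdivisionOf_iff (w : List Bool) {d p : ℕ} (hd : 1 ≤ d) (hp : 1 ≤ p)
    (D : Finset (Finset ℕ)) :
    IsTSubdivisionOf (path w d).chain (insert 0 (Finset.Icc p (p + (path w d).size))) D ↔
      D = fan p [path w d] := by
  have hsz := size_path w d
  constructor
  · rintro ⟨-, c, ⟨v₀, x, z, V', Δ', hT, hv, hV, rfl⟩, hdeg⟩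
    have hb := hT.bounds
    have e : ∀ v, v ∈ insert 0 (Finset.Icc p (p + (path w d).size)) ↔ v ∈ insert v₀ V' :=
      fun v => by rw [hV]
    simp only [Finset.mem_insert, Finset.mem_Icc] at e
    have b := hb.2.2.2.2
    have hv0 : v₀ = 0 := by
      rcases (e 0).1 (Or.inl rfl) with h | h
      · exact h.symm
      · have := b 0 h; omega
    subst hv0
    have hV' : ∀ v, v ∈ V' ↔ p ≤ v ∧ v ≤ p + (path w d).size := by
      intro v
      constructor
      · intro h
        have := b v h
        exact ((e v).2 (Or.inr h)).resolve_left (by omega)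
      · intro h
        exact ((e v).1 (Or.inr h)).resolve_left (by omega)
    have hx : x = p := by
      have h1 := (hV' x).1 hb.2.2.1
      have h2 := b p ((hV' p).2 (by omega))
      omega
    have hz : z = p + (path w d).size := by
      have h1 := (hV' z).1 hb.2.2.2.1
      have h2 := b _ ((hV' (p + (path w d).size)).2 (by omega))
      omega
    subst hx hz
    obtain ⟨w', hs, hc, rfl⟩ := hT.exists_path (by ext v; rw [hV', Finset.mem_Icc])
    rw [hs, ← fan_singleton] at hdeg ⊢
    have hl : w.length = w'.length := by
      rw [size_path, size_path] at hs; omega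
    suffices hw : w = w' by
      subst hw
      rw [fan_singleton, fan_singleton, ← path_strip w d, tri_strip, size_strip]
    -- The subdivision is given by some word `w'`, so its degrees are the numbers of triangles of
    -- `path w' 0`; away from its centre they equal the labels, which come from `w`.
    refine path_unique hl x (d := d) (d' := 0) fun v hv => ?_
    by_cases hr : x ≤ v ∧ v ≤ x + (path w d).size
    · have h1 := hdeg v (by simp; omega) (by rw [← hs, idx_insert_zero hp hr.1 hr.2]; omega) (by omega)
      rw [← hs, degree_fan_path w hp hr.1, label_path w hd hp hr.1 hr.2,
        entry_labels, size_path, size_path, hl] at h1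
      omega
    · rcases Nat.lt_or_ge v x with h1 | h1
      · rw [entry_of_lt _ h1, entry_of_lt _ h1]
      · rw [entry_of_ge _ (by rw [length_full]; omega),
          entry_of_ge _ (by rw [length_full, size_path]; omega)]
  · rintro rfl
    have hdl : ∀ v, p ≤ v → v ≤ p + (path w d).size →
        degree (insert 0 (Finset.Icc p (p + (path w d).size))) (fan p [path w d])
          (R (path w d).chain) v + (if v = p + 1 + w.count true then d else 0) =
        label (insert 0 (Finset.Icc p (p + (path w d).size))) (R (path w d).chain) v := by
      intro v h1 h2
      rw [degree_fan_path w hp h1, label_path w hd hp h1 h2, entry_labels,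
        entry_full_path w d, size_path, size_path]
      omega
    have hmem : ∀ v ∈ insert 0 (Finset.Icc p (p + (path w d).size)),
        idx (insert 0 (Finset.Icc p (p + (path w d).size))) v ≠ 0 →
        p ≤ v ∧ v ≤ p + (path w d).size := by
      intro v hv h0
      rcases Finset.mem_insert.1 hv with rfl | hv
      · exact absurd (idx_zero _ _) h0
      · exact Finset.mem_Icc.1 hv
    refine ⟨⟨isSubdivision_insert_zero hp _, ?_, ?_, ?_⟩, p + 1 + w.count true, ?_, ?_⟩
    · rw [R_path w hd, length_labels, Finset.card_insert_of_notMem (by simp; omega), Nat.card_Icc]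
      omega
    · rw [R_eq_Rrev (path w d).chain_isW2.isW]
      exact isW_Rrev (path w d).chain_isW2.isW
    · intro v hv h0
      obtain ⟨h1, h2⟩ := hmem v hv h0
      rw [← hdl v h1 h2]
      omega
    · exact ⟨0, p, _, _, _, isTCore_path w d p, by omega, rfl, fan_singleton _ _⟩
    · intro v hv h0 hc
      obtain ⟨h1, h2⟩ := hmem v hv h0
      rw [← hdl v h1 h2, if_neg hc]
      rfl

/-! ### The subdivision that belongs to a P-resolution -/

theorem mem_fan_replicate_leaf (m k : ℕ) (T : Finset ℕ) :
    T ∈ fan k (List.replicate m leaf) ↔ ∃ i, k ≤ i ∧ i < k + m ∧ T = {0, i, i + 1} := by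
  induction m generalizing k with
  | zero =>
    simp [fan]
    intro i h1 h2
    omega
  | succ m ih =>
    rw [List.replicate_succ, fan, Finset.mem_insert, Finset.mem_union, show leaf.size = 1 from rfl, ih]
    simp only [tri, Finset.notMem_empty, false_or]
    constructor
    · rintro (rfl | ⟨i, h1, h2, rfl⟩)
      · exact ⟨k, le_rfl, by omega, rfl⟩
      · exact ⟨i, by omega, by omega, rfl⟩
    · rintro ⟨i, h1, h2, rfl⟩
      rcases Nat.eq_or_lt_of_le h1 with rfl | h3
      · exact Or.inl rfl
      · exact Or.inr ⟨i, h3, by omega, rfl⟩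

/-- The polygon `t` belongs to the vertices `c, …` after the first vertex. -/
def TeeAt (Z : List Item) (t : Tr) (c : ℕ) : Prop :=
  ∃ Z₁ Z₂, Z = Z₁ ++ tr t :: Z₂ ∧ c = total (shapes Z₁)

theorem shapes_cons (i : Item) (Z : List Item) : shapes (i :: Z) = i.shapes ++ shapes Z := rfl

theorem teeAt_num {x : ℕ} {Z : List Item} {t : Tr} {c : ℕ} : TeeAt (num x :: Z) t c ↔
    ∃ c', c = total (num x).shapes + c' ∧ TeeAt Z t c' := by
  constructor
  · rintro ⟨Z₁, Z₂, h, rfl⟩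
    cases Z₁ with
    | nil => simp at h
    | cons i Z₁ =>
      simp only [List.cons_append, List.cons.injEq] at h
      obtain ⟨rfl, rfl⟩ := h
      exact ⟨_, by rw [shapes_cons, total_append], Z₁, Z₂, rfl, rfl⟩
  · rintro ⟨c', rfl, Z₁, Z₂, rfl, rfl⟩
    exact ⟨num x :: Z₁, Z₂, rfl, by rw [shapes_cons, total_append]⟩

theorem teeAt_tr {s : Tr} {Z : List Item} {t : Tr} {c : ℕ} : TeeAt (tr s :: Z) t c ↔
    (t = s ∧ c = 0) ∨ ∃ c', c = s.size + c' ∧ TeeAt Z t c' := by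
  constructor
  · rintro ⟨Z₁, Z₂, h, rfl⟩
    cases Z₁ with
    | nil =>
      simp only [List.nil_append, List.cons.injEq, Item.tr.injEq] at h
      exact Or.inl ⟨h.1.symm, rfl⟩
    | cons i Z₁ =>
      simp only [List.cons_append, List.cons.injEq] at h
      obtain ⟨rfl, rfl⟩ := h
      exact Or.inr ⟨_, by simp, Z₁, Z₂, rfl, rfl⟩
  · rintro (⟨rfl, rfl⟩ | ⟨c', rfl, Z₁, Z₂, rfl, rfl⟩)
    · exact ⟨[], Z, rfl, rfl⟩
    · exact ⟨tr s :: Z₁, Z₂, rfl, by simp⟩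

theorem item_shapes_num (x : ℕ) : ∃ m, (num x).shapes = List.replicate m leaf := by
  by_cases h : x = 1
  · exact ⟨2, by simp [Item.shapes, h]⟩
  · exact ⟨x - 2, by simp [Item.shapes, h]⟩

/-- Entries contribute only single edges, whose fan triangles are `{0, i, i + 1}`; they are the ones
with `i` and `i + 1` not in a common polygon. This is the form of the triangles in
`IsPTriangulation`. -/
theorem mem_fan_shapes (Z : List Item) (k : ℕ) (T : Finset ℕ) : T ∈ fan k (shapes Z) ↔
    (∃ t c, TeeAt Z t c ∧ T ∈ fan (k + c) [t]) ∨
      ∃ i, k ≤ i ∧ i + 1 ≤ k + total (shapes Z) ∧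
        (¬ ∃ t c, TeeAt Z t c ∧ k + c ≤ i ∧ i + 1 ≤ k + c + t.size) ∧ T = {0, i, i + 1} := by
  induction Z generalizing k with
  | nil =>
    simp [fan]
    constructor
    · rintro t c ⟨Z₁, Z₂, h, -⟩
      simp at h
    · intro i h1 h2
      omega
  | cons j Z ih =>
    cases j with
    | num x =>
      obtain ⟨m, hm⟩ := item_shapes_num x
      rw [shapes_cons, hm, fan_append, Finset.mem_union, mem_fan_replicate_leaf, ih, total_append]
      simp only [teeAt_num, hm, total_replicate_leaf]
      constructor
      · rintro (⟨i, h1, h2, rfl⟩ | ⟨t, c, h1, h2⟩ | ⟨i, h1, h2, h3, rfl⟩)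
        · right
          refine ⟨i, h1, by omega, ?_, rfl⟩
          rintro ⟨t, c, ⟨c', rfl, -⟩, h3, -⟩
          omega
        · left
          exact ⟨t, m + c, ⟨c, rfl, h1⟩, by rwa [← Nat.add_assoc]⟩
        · right
          refine ⟨i, by omega, by omega, ?_, rfl⟩
          rintro ⟨t, c, ⟨c', rfl, h4⟩, h5, h6⟩
          exact h3 ⟨t, c', h4, by omega, by omega⟩
      · rintro (⟨t, c, ⟨c', rfl, h1⟩, h2⟩ | ⟨i, h1, h2, h3, rfl⟩)
        · right; left
          exact ⟨t, c', h1, by rwa [Nat.add_assoc]⟩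
        · rcases Nat.lt_or_ge i (k + m) with h4 | h4
          · exact Or.inl ⟨i, h1, h4, rfl⟩
          · right; right
            refine ⟨i, h4, by omega, ?_, rfl⟩
            rintro ⟨t, c, h5, h6, h7⟩
            exact h3 ⟨t, m + c, ⟨c, rfl, h5⟩, by omega, by omega⟩
    | tr s =>
      have e : fan k (shapes (tr s :: Z)) = fan k [s] ∪ fan (k + s.size) (shapes Z) := by
        rw [shapes_tr, fan, size_strip, tri_strip, fan_singleton, Finset.insert_union]
      rw [e, Finset.mem_union, ih, shapes_tr, total_cons, size_strip]
      simp only [teeAt_tr]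
      constructor
      · rintro (h | ⟨t, c, h1, h2⟩ | ⟨i, h1, h2, h3, rfl⟩)
        · exact Or.inl ⟨s, 0, Or.inl ⟨rfl, rfl⟩, h⟩
        · exact Or.inl ⟨t, s.size + c, Or.inr ⟨c, rfl, h1⟩, by rwa [← Nat.add_assoc]⟩
        · right
          refine ⟨i, by omega, by omega, ?_, rfl⟩
          rintro ⟨t, c, (⟨rfl, rfl⟩ | ⟨c', rfl, h4⟩), h5, h6⟩
          · omega
          · exact h3 ⟨t, c', h4, by omega, by omega⟩
      · rintro (⟨t, c, (⟨rfl, rfl⟩ | ⟨c', rfl, h1⟩), h2⟩ | ⟨i, h1, h2, h3, rfl⟩)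
        · exact Or.inl h2
        · right; left
          exact ⟨t, c', h1, by rwa [Nat.add_assoc]⟩
        · right; right
          have h4 : k + s.size ≤ i := by
            by_contra h4
            exact h3 ⟨s, 0, Or.inl ⟨rfl, rfl⟩, by omega, by omega⟩
          refine ⟨i, h4, by omega, ?_, rfl⟩
          rintro ⟨t, c, h5, h6, h7⟩
          exact h3 ⟨t, s.size + c, Or.inr ⟨c, rfl, h5⟩, by omega, by omega⟩

/-- The set `C` enters only through its intervals of type T, which are the intervals of the
polygons. Their associated positions are the vertices of the polygons (`assocPositions_eq`), and
their subdivisions are unique (`isTSubdivisionOf_iff`). -/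
theorem isPTriangulation_iff {Z : List Item} (hZ : Valid Z) (hP : PItems Z) (h0 : Z ≠ [])
    (h1 : ∀ X', Z ≠ num 1 :: X') {C : Finset ℕ}
    (hC : ∀ l u, IsTComponent (chain Z) C l u ↔ ∃ t, IsTee Z t l u) (Δ : Finset (Finset ℕ)) :
    IsPTriangulation (chain Z) C Δ ↔ Δ = fan 1 (shapes Z) := by
  have hpos : ∀ {t c l u}, (∃ Z₁ Z₂, Z = Z₁ ++ tr t :: Z₂ ∧ c = total (shapes Z₁) ∧
      l = (chain Z₁).length + 1 ∧ u = (chain Z₁).length + t.chain.length) →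
      assocPositions (chain Z) l u = Finset.Icc (1 + c) (1 + c + t.size) := by
    rintro t c l u ⟨Z₁, Z₂, rfl, rfl, rfl, rfl⟩
    exact assocPositions_eq hZ h1
  have hsub : ∀ {t c l u}, (∃ Z₁ Z₂, Z = Z₁ ++ tr t :: Z₂ ∧ c = total (shapes Z₁) ∧
      l = (chain Z₁).length + 1 ∧ u = (chain Z₁).length + t.chain.length) →
      ∀ D, IsTSubdivisionOf (slice (chain Z) l u) (insert 0 (assocPositions (chain Z) l u)) D ↔
        D = fan (1 + c) [t] := by
    intro t c l u h D
    rw [hpos h]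
    obtain ⟨Z₁, Z₂, h2, -, h3, h4⟩ := h
    have ht : IsTee Z t l u := ⟨Z₁, Z₂, h2, h3, h4⟩
    obtain ⟨w, d, hd, rfl⟩ := ht.exists_path hP
    rw [ht.slice, isTSubdivisionOf_iff w hd (by omega)]
  have hlen : (R (chain Z)).length = 1 + total (shapes Z) := by
    rw [hZ.R_chain h0 h1, hZ.length_lab, Nat.add_comm]
  have tee : ∀ {t l u}, IsTee Z t l u → ∃ c, TeeAt Z t c ∧ ∃ Z₁ Z₂, Z = Z₁ ++ tr t :: Z₂ ∧
      c = total (shapes Z₁) ∧ l = (chain Z₁).length + 1 ∧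
      u = (chain Z₁).length + t.chain.length := by
    rintro t l u ⟨Z₁, Z₂, h2, h3, h4⟩
    exact ⟨_, ⟨Z₁, Z₂, h2, rfl⟩, Z₁, Z₂, h2, rfl, h3, h4⟩
  have tee' : ∀ {t c}, TeeAt Z t c → ∃ l u, IsTee Z t l u ∧ ∃ Z₁ Z₂, Z = Z₁ ++ tr t :: Z₂ ∧
      c = total (shapes Z₁) ∧ l = (chain Z₁).length + 1 ∧
      u = (chain Z₁).length + t.chain.length := by
    rintro t c ⟨Z₁, Z₂, h2, h3⟩
    exact ⟨_, _, ⟨Z₁, Z₂, h2, rfl, rfl⟩, Z₁, Z₂, h2, h3, rfl, rfl⟩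
  have main : ∀ D : ℕ → ℕ → Finset (Finset ℕ), (∀ l u, IsTComponent (chain Z) C l u →
      IsTSubdivisionOf (slice (chain Z) l u) (insert 0 (assocPositions (chain Z) l u)) (D l u)) →
      ∀ T, ((∃ l u, IsTComponent (chain Z) C l u ∧ T ∈ D l u) ∨
      (∃ i, 1 ≤ i ∧ i + 1 ≤ (R (chain Z)).length ∧
        (¬ ∃ l u, IsTComponent (chain Z) C l u ∧
          i ∈ assocPositions (chain Z) l u ∧ i + 1 ∈ assocPositions (chain Z) l u) ∧
        T = {0, i, i + 1})) ↔ T ∈ fan 1 (shapes Z) := by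
    intro D hD T
    rw [mem_fan_shapes, hlen]
    have e1 : (∃ l u, IsTComponent (chain Z) C l u ∧ T ∈ D l u) ↔
        ∃ t c, TeeAt Z t c ∧ T ∈ fan (1 + c) [t] := by
      constructor
      · rintro ⟨l, u, hl, hT⟩
        obtain ⟨t, ht⟩ := (hC l u).1 hl
        obtain ⟨c, hc, h2⟩ := tee ht
        rw [(hsub h2 _).1 (hD l u hl)] at hT
        exact ⟨t, c, hc, hT⟩
      · rintro ⟨t, c, hc, hT⟩
        obtain ⟨l, u, ht, h2⟩ := tee' hc
        have hl := (hC l u).2 ⟨t, ht⟩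
        rw [← (hsub h2 _).1 (hD l u hl)] at hT
        exact ⟨l, u, hl, hT⟩
    have e2 : ∀ i, (∃ l u, IsTComponent (chain Z) C l u ∧
          i ∈ assocPositions (chain Z) l u ∧ i + 1 ∈ assocPositions (chain Z) l u) ↔
        ∃ t c, TeeAt Z t c ∧ 1 + c ≤ i ∧ i + 1 ≤ 1 + c + t.size := by
      intro i
      constructor
      · rintro ⟨l, u, hl, h3, h4⟩
        obtain ⟨t, ht⟩ := (hC l u).1 hl
        obtain ⟨c, hc, h2⟩ := tee ht
        rw [hpos h2, Finset.mem_Icc] at h3 h4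
        exact ⟨t, c, hc, h3.1, h4.2⟩
      · rintro ⟨t, c, hc, h3, h4⟩
        obtain ⟨l, u, ht, h2⟩ := tee' hc
        refine ⟨l, u, (hC l u).2 ⟨t, ht⟩, ?_⟩
        rw [hpos h2, Finset.mem_Icc, Finset.mem_Icc]
        omega
    rw [e1]
    simp only [e2]
  constructor
  · rintro ⟨D, hD, hΔ⟩
    ext T
    rw [hΔ, main D hD]
  · rintro rfl
    have ex : ∀ l u, ∃ D, IsTComponent (chain Z) C l u →
        IsTSubdivisionOf (slice (chain Z) l u) (insert 0 (assocPositions (chain Z) l u)) D := by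
      intro l u
      by_cases hl : IsTComponent (chain Z) C l u
      · obtain ⟨t, ht⟩ := (hC l u).1 hl
        obtain ⟨c, -, h2⟩ := tee ht
        exact ⟨_, fun _ => (hsub h2 _).2 rfl⟩
      · exact ⟨∅, fun h => absurd h hl⟩
    choose D hD using ex
    exact ⟨D, hD, fun T => (main D hD T).symm⟩

end PRes

namespace PRes
open Item Tr

/-! ### Labelled subdivisions given by codes -/

section

variable {α : Type*} [LinearOrder α]

/-- The labels and the triangles of `S` are those given by the items `Z`. -/
def LabelledSubdivision.GivenBy (S : LabelledSubdivision α) (Z : List Item) : Prop :=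
  S.a = lab Z ∧ model S.V S.Δ = fan 1 (shapes Z)

theorem LabelledSubdivision.GivenBy.equiv_iff {S S' : LabelledSubdivision α} {Z Z' : List Item}
    (h : S.GivenBy Z) (h' : S'.GivenBy Z') (hZ : Valid Z) (hZ' : Valid Z')
    (h1 : ∀ X, Z ≠ num 1 :: X) (h1' : ∀ X, Z' ≠ num 1 :: X) (hm : Valid (mirror Z))
    (hm1 : ∀ X, mirror Z ≠ num 1 :: X) (hl : lab (mirror Z) = (lab Z).reverse) :
    S ≈ S' ↔ Z' = Z ∨ Z' = mirror Z := by
  rw [PRes.equiv_iff (map_strip_shapes Z) (map_strip_shapes Z') h.2 h'.2 (by rw [h.1, hZ.length_lab])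
    (by rw [h'.1, hZ'.length_lab]), h.1, h'.1, ← shapes_mirror, ← hl]
  constructor
  · rintro (⟨h2, h3⟩ | ⟨h2, h3⟩)
    · exact Or.inl (hZ'.ext hZ h1' h1 h3 h2)
    · exact Or.inr (hZ'.ext hm h1' hm1 h3 h2)
  · rintro (rfl | rfl)
    · exact Or.inl ⟨rfl, rfl⟩
    · exact Or.inr ⟨rfl, rfl⟩

theorem IsCode.equiv_iff {S S' : LabelledSubdivision α} {X Y : List Item} (hX : IsCode X)
    (hY : IsCode Y) (h0 : X ≠ []) (h : S.GivenBy X) (h' : S'.GivenBy Y) :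
    S ≈ S' ↔ Y = X ∨ Y = PRes.mirror X :=
  h.equiv_iff h' hX.valid hY.valid hX.ne_one hY.ne_one hX.mirror.valid hX.mirror.ne_one
    (hX.lab_mirror h0)

/-- The criterion is the same as in `IsCode.equiv_iff`, since `expand` is injective and commutes
with `mirror`. Hence the classes on both sides are codes up to reflection. -/
theorem IsCode.expand_equiv_iff {S S' : LabelledSubdivision α} {X Y : List Item} (hX : IsCode X)
    (hY : IsCode Y) (h0 : X ≠ []) (h : S.GivenBy (expand X)) (h' : S'.GivenBy (expand Y)) :
    S ≈ S' ↔ Y = X ∨ Y = PRes.mirror X := by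
  rw [h.equiv_iff h' hX.valid_expand hY.valid_expand hX.expand_head.1 hY.expand_head.1
    (by rw [← expand_mirror]; exact hX.mirror.valid_expand)
    (by rw [← expand_mirror]; exact hX.mirror.expand_head.1)
    (by rw [← expand_mirror]; exact hX.lab_expand_mirror h0), ← expand_mirror]
  exact or_congr ⟨hY.expand_injective hX, fun e => by rw [e]⟩
    ⟨hY.expand_injective hX.mirror, fun e => by rw [e]⟩

theorem exists_givenBy [Infinite α] {Z : List Item} (hZ : Valid Z) (h1 : ∀ X, Z ≠ num 1 :: X) :
    ∃ S : LabelledSubdivision α, S.GivenBy Z :=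
  exists_labelledSubdivision hZ.length_lab hZ.isW_lab (hZ.bound h1)

theorem mem_setP_iff {S : LabelledSubdivision α} :
    S ∈ setP α ↔ ∃ X, IsCode X ∧ X ≠ [] ∧ S.GivenBy (expand X) := by
  constructor
  · rintro ⟨b, C, hR, ha, hΔ⟩
    obtain ⟨Z, rfl, hZ, hP, h0, h1, hC⟩ := hR.exists_items
    obtain ⟨X, hX, rfl⟩ := exists_code hZ hP h1
    refine ⟨X, hX, by rintro rfl; exact h0 rfl, ?_, (isPTriangulation_iff hZ hP h0 h1 hC _).1 hΔ⟩
    rw [ha, hZ.R_chain h0 h1]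
  · rintro ⟨X, hX, h0, ha, hΔ⟩
    have h := hX.expand_ne_nil h0
    have h1 := hX.expand_head.1
    refine ⟨chain (expand X), contracted (expand X),
      isPResolution_contracted hX.valid_expand hX.pItems_expand h1 h, ?_,
      (isPTriangulation_iff hX.valid_expand hX.pItems_expand h h1
        (fun l u => isTComponent_contracted hX.valid_expand hX.pItems_expand) _).2 hΔ⟩
    rw [ha, hX.R_chain_expand h0]

/-- With labels ≥ 2 degrees are numbers of triangles, so admissibility is the bound that
`exists_code_of_bound` asks for. Conversely, `R` preserves sequences with entries ≥ 2. -/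
theorem mem_setM_iff {S : LabelledSubdivision α} :
    S ∈ setM α ↔ ∃ X, IsCode X ∧ X ≠ [] ∧ S.GivenBy X := by
  constructor
  · intro (h : IsW2 S.a)
    obtain ⟨s, hs, hlen, hm⟩ := S.exists_fan
    have hb := S.isLabelled.le_entry h
    rw [hm] at hb
    obtain ⟨y, q, hq⟩ := List.exists_cons_of_ne_nil (l := S.a) (by
      intro h0
      rw [h0] at hlen
      simp at hlen)
    rw [hq] at h hb hlen
    have hy := h y (by simp)
    obtain ⟨X, hX, hl, hsh⟩ := exists_code_of_bound hs (p := 1) (y := y) (q := q) le_rfl hlen.symm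
      (by omega) (fun x hx => h x (by simp [hx])) (fun _ _ => hy) (fun v hv => by
        rcases Nat.lt_or_ge (y :: q).length v with h2 | h2
        · rw [Finset.filter_eq_empty_iff.2, Finset.card_empty]
          · exact Nat.zero_le _
          · intro T hT hvT
            have := Finset.mem_range.1 ((fan_isSubdivision s).subset T hT hvT)
            omega
        · exact hb v hv h2)
    refine ⟨X, hX, ?_, by rw [hq, hl], by rw [hm, hsh]⟩
    rintro rfl
    rw [lab_nil] at hl
    have := (List.cons.inj hl).1
    omega
  · rintro ⟨X, hX, h0, ha, -⟩
    change IsW2 S.a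
    rw [ha, ← hX.R_chain h0, R_eq_Rrev hX.isW2_chain.isW]
    exact isW2_Rrev hX.isW2_chain

/-- The bijection is given by codes: the code `X` of a class of `setM` is the code of the class of
`setP` whose items are `expand X`. -/
theorem exists_equiv_isoClasses [Infinite α] : ∃ Φ : IsoClasses (setP α) ≃ IsoClasses (setM α),
    ∀ (S : setP α) (S' : setM α), Φ (isoClass S) = isoClass S' →
      ∃ X Y, IsCode X ∧ X ≠ [] ∧ S.1.GivenBy (expand X) ∧ S'.1.GivenBy Y ∧
        (Y = X ∨ Y = mirror X) := by
  choose c hc hc0 hcS using fun S : setP α => mem_setP_iff.1 S.2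
  have ex : ∀ S : setP α, ∃ S' : setM α, S'.1.GivenBy (c S) := fun S => by
    obtain ⟨S', h⟩ := exists_givenBy (α := α) (hc S).valid (hc S).ne_one
    exact ⟨⟨S', mem_setM_iff.2 ⟨_, hc S, hc0 S, h⟩⟩, h⟩
  choose f hf using ex
  have hiff : ∀ S T : setP α, S.1 ≈ T.1 ↔ (f S).1 ≈ (f T).1 := fun S T => by
    rw [(hc S).expand_equiv_iff (hc T) (hc0 S) (hcS S) (hcS T),
      (hc S).equiv_iff (hc T) (hc0 S) (hf S) (hf T)]
  let F : IsoClasses (setP α) → IsoClasses (setM α) :=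
    Quotient.lift (fun S => isoClass (f S)) fun S T h => Quotient.sound ((hiff S T).1 h)
  have hex : ∀ {S T : setM α}, isoClass S = isoClass T → S.1 ≈ T.1 := fun {S T} h =>
    @Quotient.exact _ ((isoSetoid α).comap (Subtype.val : setM α → LabelledSubdivision α)) S T h
  have hF : Function.Bijective F := by
    constructor
    · rintro ⟨S⟩ ⟨T⟩ h
      exact Quotient.sound ((hiff S T).2 (hex h))
    · rintro ⟨S'⟩
      obtain ⟨X, hX, h0, h⟩ := mem_setM_iff.1 S'.2
      obtain ⟨S, hS⟩ := exists_givenBy (α := α) hX.valid_expand hX.expand_head.1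
      let S₀ : setP α := ⟨S, mem_setP_iff.2 ⟨X, hX, h0, hS⟩⟩
      refine ⟨isoClass S₀, Quotient.sound ?_⟩
      -- The code chosen for `S₀` need not be `X`; it may be the mirror image, which gives the same
      -- class.
      exact ((hc S₀).equiv_iff hX (hc0 S₀) (hf S₀) h).2
        (((hc S₀).expand_equiv_iff hX (hc0 S₀) (hcS S₀) hS).1 (Setoid.refl S))
  refine ⟨Equiv.ofBijective F hF, fun S S' h => ?_⟩
  obtain ⟨Y, hY, -, hS'⟩ := mem_setM_iff.1 S'.2
  exact ⟨c S, Y, hc S, hc0 S, hcS S, hS',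
    ((hc S).equiv_iff hY (hc0 S) (hf S) hS').1 (hex h)⟩

theorem IsCode.blowsDownTo {X Y : List Item} (hX : IsCode X) (h : Y = X ∨ Y = PRes.mirror X) :
    (Gam (chain (expand X))).BlowsDownTo (Gam (chain Y)) := by
  rcases h with rfl | rfl
  · exact hX.blowStar.blowsDownTo
  · rw [hX.valid.chain_mirror]
    exact hX.blowStar.blowsDownTo.trans_iso (gam_reverse _)

end

end PRes

/-! ### The bijection of isomorphism classes and the blowing down of the graphs -/

theorem mainTheorem1 {𝒱 : Type*} [LinearOrder 𝒱] [Countable 𝒱] [Infinite 𝒱] :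
    ∃ Φ : PRes.IsoClasses (PRes.setP 𝒱) ≃ PRes.IsoClasses (PRes.setM 𝒱),
      ∀ (S : PRes.setP 𝒱) (S' : PRes.setM 𝒱),
        Φ (PRes.isoClass S) = PRes.isoClass S' →
          (PRes.Gam (PRes.R S.1.a)).BlowsDownTo (PRes.Gam (PRes.R S'.1.a)) := by
  obtain ⟨Φ, hΦ⟩ := PRes.exists_equiv_isoClasses (α := 𝒱)
  refine ⟨Φ, fun S S' h => ?_⟩
  obtain ⟨X, Y, hX, h0, hS, hS', hXY⟩ := hΦ S S' h
  have hY : PRes.IsCode Y ∧ Y ≠ [] := by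
    rcases hXY with rfl | rfl
    · exact ⟨hX, h0⟩
    · exact ⟨hX.mirror, by simpa [PRes.mirror] using h0⟩
  -- The labels are `R` of the chains of the codes, so applying the involution `R` once more gives
  -- back these chains.
  rw [hS.1, hS'.1, ← hX.R_chain_expand h0, ← hY.1.R_chain hY.2, PRes.R_R hX.valid_expand.isW,
    PRes.R_R hY.1.valid.isW]
  exact hX.blowsDownTo hXY
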